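/- Let $d\ge 2$ and let $I$ be a (possibly empty) set of brane labels. **Bordisms.** A cartesian space is a submanifold $U$ of some $\mathbb R^N$ diffeomorphic to some $\mathbb R^m$; $\mathrm{Cart}$ is the category of cartesian spaces and smooth maps, and $*$ is the one-point space. For $U\in\mathrm{Cart}$, the symmetric monoidal category $\mathrm{OCBord}_d(I)(U)$ of open-closed bordisms over $U$, with target space a point, is the following. * An object $Y$ is a compact $(d-1)$-manifold with (possibly empty) boundary, with an orientation of $\mathbb R\oplus TY$, with a sign (an orientation of $\mathbb R$) for each connected component of $Y$, with a label in $I$ for each component of $\partial Y$, and with the unique map $U\times Y\to *$. Let $C_+Y\subset\mathbb R\times Y$ be $[0,\infty)\times Y$ over the components with positive sign and $(-\infty,0]\times Y$ over the others, and let $C_-Y$ be defined with the opposite signs. * A bordism $Y_0\to Y_1$ is a compact oriented $d$-manifold $\Sigma$ with corners of index at most two whose boundary is decomposed into faces $\partial_0\Sigma$, $\partial_1\Sigma$, $\partial_2\Sigma$ with $\partial_0\Sigma\cap\partial_1\Sigma=\emptyset$ such that the corners are $\partial_2\Sigma\cap(\partial_0\Sigma\cup\partial_1\Sigma)$, with a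 label in $I$ for each component of $\partial_2\Sigma$, with orientation- and label-preserving collars, i.e. open embeddings with disjoint images of open neighbourhoods of $\{0\}\times Y_0$ in $C_+Y_0$ and of $\{0\}\times Y_1$ in $C_-Y_1$ which map $\{0\}\times Y_a$ onto $\partial_a\Sigma$, and with the unique map $U\times\Sigma\to *$. A morphism is a class of bordisms, where $\Sigma\sim\Sigma'$ if there is a fibrewise diffeomorphism $U\times\Sigma\to U\times\Sigma'$ over $U$ which preserves orientations and labels and which is compatible with the collars near $\{0\}\times Y_0$ and $\{0\}\times Y_1$ (on neighbourhoods independent of the point of $U$). * Composition is gluing along the collars, identities are cylinders, and the symmetric monoidal structure is disjoint union. Smooth maps $g:V\to U$ act by pullback $g^*$. The opposite $\mathrm{op}\,Y$ has the reversed orientation of $\mathbb R\oplus TY$, and the dual $Y^\vee$ has the reversed signs; $\mathrm{op}$ reverses the orientations of bordisms. The cylinder $[0,1]\times Y$ gives rise to the evaluation $\mathrm{ev}_Y:Y^\vee\sqcup Y\to\emptyset$ and to a canonical morphism $\flat_Y:\mathrm{op}\,Y\to Y^\vee$. **Field theories.** Let $\mathrm{Vect}$ be the symmetric monoidal category of finite-dimensional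 complex vector spaces, and $\mathrm{VBun}(U)$ that of smooth complex vector bundles over $U$. A $d$-dimensional open-closed TQFT with brane labels $I$ is a symmetric monoidal functor $\mathrm{OCBord}_d(I)(*)\to\mathrm{Vect}$; morphisms are monoidal natural transformations. They form a category $\mathrm{OCTQFT}_d^I$. A $d$-dimensional smooth OCFFT on the point with brane labels $I$ is a morphism $\mathscr Z:\mathrm{OCBord}_d(I)\to\mathrm{VBun}$ of presheaves of symmetric monoidal categories on $\mathrm{Cart}$, i.e. symmetric monoidal functors $\mathscr Z_U:\mathrm{OCBord}_d(I)(U)\to\mathrm{VBun}(U)$ together with coherent monoidal natural isomorphisms $\mathscr Z_V\circ g^*\cong g^*\circ\mathscr Z_U$ for all $g:V\to U$. Morphisms are families of monoidal natural transformations compatible with these isomorphisms. They form a category $\mathrm{OCFFT}_d(I)$. Both categories are symmetric monoidal under pointwise tensor product. **Invertibility and reflection positivity.** An open-closed TQFT is *invertible* if it assigns one-dimensional spaces to all objects with $\partial Y=\emptyset$ and isomorphisms to all bordisms with $\partial_2\Sigma=\emptyset$; a smooth OCFFT is *invertible* if, over each $U$, it assigns line bundles to these objects and bundle isomorphisms to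 these bordisms. A *reflection structure* on an open-closed TQFT $Z$ consists of isomorphisms $\alpha_Y:Z(\mathrm{op}\,Y)\to\overline{Z(Y)}$ forming a monoidal natural isomorphism $Z\circ\mathrm{op}\cong\overline{Z}$ compatible with $\mathrm{op}^2\cong\mathrm{id}$ and $\overline{\overline{V}}\cong V$; on a smooth OCFFT it consists of such isomorphisms $\mathscr Z_U(\mathrm{op}\,Y)\to\overline{\mathscr Z_U(Y)}$ over every $U$, compatible with pullbacks. It is *positive* if, for every $Y$, the sesquilinear pairing $$\overline{Z(Y)}\otimes Z(Y)\xrightarrow{\ \alpha_Y^{-1}\otimes 1\ }Z(\mathrm{op}\,Y)\otimes Z(Y)\xrightarrow{\ Z(\flat_Y)\otimes 1\ }Z(Y^\vee)\otimes Z(Y)\cong Z(Y^\vee\sqcup Y)\xrightarrow{\ Z(\mathrm{ev}_Y)\ }Z(\emptyset)\cong\mathbb C$$ is positive definite (fibrewise, in the case of a smooth OCFFT). *Reflection-positive* theories are theories with a positive reflection structure; their morphisms are the morphisms of theories which intertwine the reflection structures. **Theorem.** 1. For every $U\in\mathrm{Cart}$ with collapse map $c:U\to *$, the pullback functor $c^*:\mathrm{OCBord}_d(I)(*)\to\mathrm{OCBord}_d(I)(U)$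 is bijective on objects and, for all objects $Y,Y'$, bijective on the morphisms from $Y$ to $Y'$. 2. Evaluation on the one-point space, $$\mathrm{ev}_*:\mathrm{OCFFT}_d(I)\longrightarrow\mathrm{OCTQFT}_d^I,\qquad \mathscr Z\mapsto\mathscr Z(*),$$ is an equivalence of symmetric monoidal categories. 3. It restricts to an equivalence of symmetric monoidal categories between the full subcategories of invertible theories. 4. It extends to an equivalence of symmetric monoidal categories between reflection-positive smooth OCFFTs and reflection-positive open-closed TQFTs. 5. The equivalence in 4 restricts to an equivalence of symmetric monoidal categories between the full subcategories of theories that are both invertible and reflection-positive. -/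

import Mathlib

noncomputable section

open CategoryTheory MonoidalCategory

universe v₁ v₂ v₃ u₁ u₂ u₃ w

/-! ### Symmetric monoidal functors -/

theorem braiding_unit_unit (D : Type u₁) [Category.{v₁} D] [MonoidalCategory D]
    [SymmetricCategory D] : (β_ (𝟙_ D) (𝟙_ D)).hom = 𝟙 _ := by
  have h := braiding_leftUnitor (𝟙_ D)
  rw [← unitors_equal] at h
  rw [← cancel_mono (λ_ (𝟙_ D)).hom, h, Category.id_comp]

theorem comp_tensorHom {D : Type u₁} [Category.{v₁} D] [MonoidalCategory D] {P Q R P' R' : D}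
    (f : P ⟶ Q) (g : Q ⟶ R) (h : P' ⟶ R') : (f ≫ g) ⊗ₘ h = (f ▷ P') ≫ (g ⊗ₘ h) := by
  simp [MonoidalCategory.tensorHom_def]

theorem tensorHom_comp {D : Type u₁} [Category.{v₁} D] [MonoidalCategory D] {P Q R P' R' : D}
    (f : P ⟶ Q) (g : Q ⟶ R) (h : P' ⟶ R') : h ⊗ₘ (f ≫ g) = (P' ◁ f) ≫ (h ⊗ₘ g) := by
  simp [MonoidalCategory.tensorHom_def']

theorem tensorμ_braiding {D : Type u₁} [Category.{v₁} D] [MonoidalCategory D]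
    [SymmetricCategory D] (A B X Y : D) : tensorμ A B X Y ≫ (β_ (A ⊗ X) (B ⊗ Y)).hom =
    ((β_ A B).hom ⊗ₘ (β_ X Y).hom) ≫ tensorμ B A Y X := by
  simp [tensorμ, SymmetricCategory.braiding_swap_eq_inv_braiding X B, MonoidalCategory.tensorHom_def]

theorem tensorμ_braiding₂ {D : Type u₁} [Category.{v₁} D] [MonoidalCategory D]
    [SymmetricCategory D] (A B X Y : D) : tensorμ A B X Y ≫ ((β_ A X).hom ⊗ₘ (β_ B Y).hom) =
    (β_ (A ⊗ B) (X ⊗ Y)).hom ≫ tensorμ X Y A B := by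
  simp [tensorμ, SymmetricCategory.braiding_swap_eq_inv_braiding X B,
    SymmetricCategory.braiding_swap_eq_inv_braiding Y A, MonoidalCategory.tensorHom_def]

/-- The data of a symmetric monoidal category in which composition and the tensor product of
morphisms are recorded by their graphs. -/
structure SMData where
  Ob : Type w
  Hom : Ob → Ob → Type w
  Comp : ∀ {X Y Z : Ob}, Hom X Y → Hom Y Z → Hom X Z → Prop
  idn : ∀ X : Ob, Hom X X
  ten : Ob → Ob → Ob
  TenHom : ∀ {X X' Y Y' : Ob}, Hom X X' → Hom Y Y' → Hom (ten X Y) (ten X' Y') → Prop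
  one : Ob
  assoc : ∀ X Y Z : Ob, Hom (ten (ten X Y) Z) (ten X (ten Y Z))
  lunit : ∀ X : Ob, Hom (ten one X) X
  runit : ∀ X : Ob, Hom (ten X one) X
  swap : ∀ X Y : Ob, Hom (ten X Y) (ten Y X)

/-- Symmetric monoidal functors from `B` to a symmetric monoidal category `D`. -/
structure SMFun (B : SMData.{w}) (D : Type u₁) [Category.{v₁} D] [MonoidalCategory D]
    [SymmetricCategory D] where
  obj : B.Ob → D
  map : ∀ {X Y : B.Ob}, B.Hom X Y → (obj X ⟶ obj Y)
  map_idn : ∀ X, map (B.idn X) = 𝟙 (obj X)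
  map_comp : ∀ {X Y Z : B.Ob} (f : B.Hom X Y) (g : B.Hom Y Z) (h : B.Hom X Z),
    B.Comp f g h → map h = map f ≫ map g
  mapOne : 𝟙_ D ≅ obj B.one
  mapTen : ∀ X Y : B.Ob, obj X ⊗ obj Y ≅ obj (B.ten X Y)
  μ_nat : ∀ {X X' Y Y' : B.Ob} (f : B.Hom X X') (g : B.Hom Y Y')
    (h : B.Hom (B.ten X Y) (B.ten X' Y')), B.TenHom f g h →
      (map f ⊗ₘ map g) ≫ (mapTen X' Y').hom = (mapTen X Y).hom ≫ map h
  μ_assoc : ∀ X Y Z : B.Ob,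
    ((mapTen X Y).hom ▷ obj Z) ≫ (mapTen (B.ten X Y) Z).hom ≫ map (B.assoc X Y Z) =
      (α_ (obj X) (obj Y) (obj Z)).hom ≫ (obj X ◁ (mapTen Y Z).hom) ≫ (mapTen X (B.ten Y Z)).hom
  μ_lunit : ∀ X : B.Ob,
    (mapOne.hom ▷ obj X) ≫ (mapTen B.one X).hom ≫ map (B.lunit X) = (λ_ (obj X)).hom
  μ_runit : ∀ X : B.Ob,
    (obj X ◁ mapOne.hom) ≫ (mapTen X B.one).hom ≫ map (B.runit X) = (ρ_ (obj X)).hom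
  μ_swap : ∀ X Y : B.Ob,
    (mapTen X Y).hom ≫ map (B.swap X Y) = (β_ (obj X) (obj Y)).hom ≫ (mapTen Y X).hom

namespace SMFun

variable {B : SMData.{w}} {D : Type u₁} [Category.{v₁} D] [MonoidalCategory D]
  [SymmetricCategory D]

/-- Morphisms of symmetric monoidal functors: monoidal natural transformations. -/
structure Hom (F G : SMFun B D) where
  app : ∀ X : B.Ob, F.obj X ⟶ G.obj X
  nat : ∀ {X Y : B.Ob} (f : B.Hom X Y), F.map f ≫ app Y = app X ≫ G.map f
  app_one : F.mapOne.hom ≫ app B.one = G.mapOne.hom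
  app_ten : ∀ X Y : B.Ob, (F.mapTen X Y).hom ≫ app (B.ten X Y) = (app X ⊗ₘ app Y) ≫ (G.mapTen X Y).hom

theorem Hom.ext' {F G : SMFun B D} {a b : Hom F G} (h : a.app = b.app) : a = b := by
  cases a; cases b; cases h; rfl

/-- Replace the components by equal ones. -/
def Hom.copy {F G : SMFun B D} (a : Hom F G) (app : ∀ X, F.obj X ⟶ G.obj X) (h : app = a.app) :
    Hom F G where
  app := app
  nat := by subst h; exact a.nat
  app_one := by subst h; exact a.app_one
  app_ten := by subst h; exact a.app_ten

instance : Category (SMFun B D) where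
  Hom := Hom
  id F := ⟨fun _ => 𝟙 _, by simp, by simp, by simp⟩
  comp a b := ⟨fun X => a.app X ≫ b.app X,
    fun f => by rw [← Category.assoc, a.nat, Category.assoc, b.nat, Category.assoc],
    by rw [← Category.assoc, a.app_one, b.app_one],
    fun X Y => by
      rw [← Category.assoc, a.app_ten, Category.assoc, b.app_ten, ← Category.assoc,
        MonoidalCategory.tensorHom_comp_tensorHom]⟩
  id_comp _ := Hom.ext' (by simp)
  comp_id _ := Hom.ext' (by simp)
  assoc _ _ _ := Hom.ext' (by simp)

@[ext]
theorem hom_ext {F G : SMFun B D} {a b : F ⟶ G} (h : ∀ X, Hom.app a X = Hom.app b X) : a = b :=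
  Hom.ext' (funext h)

@[simp] theorem id_app (F : SMFun B D) (X : B.Ob) : Hom.app (𝟙 F) X = 𝟙 (F.obj X) := rfl
@[simp] theorem comp_app {F G H : SMFun B D} (a : F ⟶ G) (b : G ⟶ H) (X : B.Ob) :
    Hom.app (a ≫ b) X = a.app X ≫ b.app X := rfl

/-- A monoidal natural isomorphism from its components. -/
def isoMk {F G : SMFun B D} (e : ∀ X, F.obj X ≅ G.obj X)
    (nat : ∀ {X Y : B.Ob} (f : B.Hom X Y), F.map f ≫ (e Y).hom = (e X).hom ≫ G.map f)
    (one : F.mapOne.hom ≫ (e B.one).hom = G.mapOne.hom)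
    (ten : ∀ X Y : B.Ob,
      (F.mapTen X Y).hom ≫ (e (B.ten X Y)).hom = ((e X).hom ⊗ₘ (e Y).hom) ≫ (G.mapTen X Y).hom) :
    F ≅ G where
  hom := ⟨fun X => (e X).hom, nat, one, ten⟩
  inv := ⟨fun X => (e X).inv, fun {X Y} f => by
      rw [Iso.comp_inv_eq, Category.assoc, nat, Iso.inv_hom_id_assoc],
    by rw [Iso.comp_inv_eq, one],
    fun X Y => by
      rw [Iso.comp_inv_eq, Category.assoc, ten, ← Category.assoc,
        MonoidalCategory.tensorHom_comp_tensorHom]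
      simp⟩
  hom_inv_id := by ext X; exact (e X).hom_inv_id
  inv_hom_id := by ext X; exact (e X).inv_hom_id

@[simp] theorem isoMk_hom_app {F G : SMFun B D} (e : ∀ X, F.obj X ≅ G.obj X) (nat) (one) (ten)
    (X : B.Ob) : Hom.app (isoMk (F := F) (G := G) e nat one ten).hom X = (e X).hom := rfl
@[simp] theorem isoMk_inv_app {F G : SMFun B D} (e : ∀ X, F.obj X ≅ G.obj X) (nat) (one) (ten)
    (X : B.Ob) : Hom.app (isoMk (F := F) (G := G) e nat one ten).inv X = (e X).inv := rfl

/-- Pointwise tensor product. -/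
def tensor (F G : SMFun B D) : SMFun B D where
  obj X := F.obj X ⊗ G.obj X
  map f := F.map f ⊗ₘ G.map f
  map_idn X := by simp [map_idn]
  map_comp f g h H := by
    rw [F.map_comp f g h H, G.map_comp f g h H, MonoidalCategory.tensorHom_comp_tensorHom]
  mapOne :=
    { hom := (λ_ (𝟙_ D)).inv ≫ (F.mapOne.hom ⊗ₘ G.mapOne.hom)
      inv := (F.mapOne.inv ⊗ₘ G.mapOne.inv) ≫ (λ_ (𝟙_ D)).hom
      hom_inv_id := by simp [MonoidalCategory.tensorHom_comp_tensorHom_assoc]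
      inv_hom_id := by simp [MonoidalCategory.tensorHom_comp_tensorHom] }
  mapTen X Y :=
    { hom := tensorμ _ _ _ _ ≫ ((F.mapTen X Y).hom ⊗ₘ (G.mapTen X Y).hom)
      inv := ((F.mapTen X Y).inv ⊗ₘ (G.mapTen X Y).inv) ≫ tensorδ _ _ _ _
      hom_inv_id := by simp [MonoidalCategory.tensorHom_comp_tensorHom_assoc]
      inv_hom_id := by simp [MonoidalCategory.tensorHom_comp_tensorHom] }
  μ_nat {X X' Y Y'} f g h H := by
    dsimp only
    rw [tensorμ_natural_assoc, MonoidalCategory.tensorHom_comp_tensorHom, F.μ_nat f g h H,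
      G.μ_nat f g h H, Category.assoc, MonoidalCategory.tensorHom_comp_tensorHom]
  μ_assoc X Y Z := by
    dsimp only
    rw [MonoidalCategory.comp_whiskerRight, Category.assoc, Category.assoc,
      tensorμ_natural_left_assoc, MonoidalCategory.tensorHom_comp_tensorHom,
      MonoidalCategory.tensorHom_comp_tensorHom, F.μ_assoc, G.μ_assoc,
      ← MonoidalCategory.tensorHom_comp_tensorHom, ← MonoidalCategory.tensorHom_comp_tensorHom,
      reassoc_of% (MonoidalCategory.tensor_associativity (F.obj X) (G.obj X) (F.obj Y) (G.obj Y)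
        (F.obj Z) (G.obj Z)),
      MonoidalCategory.whiskerLeft_comp, Category.assoc, tensorμ_natural_right_assoc]
  μ_lunit X := by
    dsimp only
    rw [MonoidalCategory.comp_whiskerRight, Category.assoc, Category.assoc,
      tensorμ_natural_left_assoc, MonoidalCategory.tensorHom_comp_tensorHom,
      MonoidalCategory.tensorHom_comp_tensorHom, F.μ_lunit, G.μ_lunit,
      MonoidalCategory.tensor_left_unitality]
  μ_runit X := by
    dsimp only
    rw [MonoidalCategory.whiskerLeft_comp, Category.assoc, Category.assoc,
      tensorμ_natural_right_assoc, MonoidalCategory.tensorHom_comp_tensorHom,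
      MonoidalCategory.tensorHom_comp_tensorHom, F.μ_runit, G.μ_runit,
      MonoidalCategory.tensor_right_unitality]
  μ_swap X Y := by
    dsimp only
    rw [Category.assoc, MonoidalCategory.tensorHom_comp_tensorHom, F.μ_swap, G.μ_swap,
      ← MonoidalCategory.tensorHom_comp_tensorHom, ← Category.assoc, tensorμ_braiding₂,
      Category.assoc]

/-- The constant unit functor. -/
def unit (B : SMData.{w}) (D : Type u₁) [Category.{v₁} D] [MonoidalCategory D]
    [SymmetricCategory D] : SMFun B D where
  obj _ := 𝟙_ D
  map _ := 𝟙 _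
  map_idn _ := rfl
  map_comp _ _ _ _ := by simp
  mapOne := Iso.refl _
  mapTen _ _ := λ_ (𝟙_ D)
  μ_nat _ _ _ _ := by simp
  μ_assoc _ _ _ := by simp [unitors_equal]
  μ_lunit _ := by simp
  μ_runit _ := by simp [unitors_equal]
  μ_swap _ _ := by
    simp [← unitors_equal]

/-- The tensor product of monoidal natural transformations. -/
def tensorMap {F F' G G' : SMFun B D} (a : F ⟶ F') (b : G ⟶ G') :
    F.tensor G ⟶ F'.tensor G' where
  app X := a.app X ⊗ₘ b.app X
  nat f := by
    dsimp only [tensor]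
    rw [MonoidalCategory.tensorHom_comp_tensorHom, a.nat, b.nat,
      MonoidalCategory.tensorHom_comp_tensorHom]
  app_one := by
    dsimp only [tensor]
    rw [Category.assoc, MonoidalCategory.tensorHom_comp_tensorHom, a.app_one, b.app_one]
  app_ten X Y := by
    dsimp only [tensor]
    rw [Category.assoc, MonoidalCategory.tensorHom_comp_tensorHom, a.app_ten, b.app_ten,
      ← MonoidalCategory.tensorHom_comp_tensorHom, tensorμ_natural_assoc]

instance : MonoidalCategoryStruct (SMFun B D) where
  tensorObj := tensor
  tensorUnit := unit B D
  tensorHom := tensorMap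
  whiskerLeft F _ _ g := Hom.copy (tensorMap (𝟙 F) g) (fun X => F.obj X ◁ g.app X)
    (funext fun _ => (MonoidalCategory.id_tensorHom _ _).symm)
  whiskerRight f G := Hom.copy (tensorMap f (𝟙 G)) (fun X => f.app X ▷ G.obj X)
    (funext fun _ => (MonoidalCategory.tensorHom_id _ _).symm)
  associator F G H := isoMk (fun X => α_ (F.obj X) (G.obj X) (H.obj X))
    (fun f => by
      change ((F.map f ⊗ₘ G.map f) ⊗ₘ H.map f) ≫ _ = _ ≫ (F.map f ⊗ₘ G.map f ⊗ₘ H.map f)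
      exact MonoidalCategory.associator_naturality _ _ _)
    (by
      dsimp only [tensor]
      rw [comp_tensorHom, tensorHom_comp, Category.assoc, Category.assoc,
        MonoidalCategory.associator_naturality, ← Category.assoc, ← Category.assoc,
        ← Category.assoc]
      congr 1
      monoidal)
    (fun X Y => by
      dsimp only [tensor]
      have := associator_monoidal (F.obj X) (G.obj X) (H.obj X) (F.obj Y) (G.obj Y) (H.obj Y)
      rw [comp_tensorHom, tensorHom_comp, Category.assoc, Category.assoc,
        MonoidalCategory.associator_naturality, reassoc_of% this])
  leftUnitor F := isoMk (fun X => λ_ (F.obj X))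
    (fun {X Y} f => by
      change (𝟙 (𝟙_ D) ⊗ₘ F.map f) ≫ (λ_ (F.obj Y)).hom = (λ_ (F.obj X)).hom ≫ F.map f
      simp)
    (by
      change ((λ_ (𝟙_ D)).inv ≫ (𝟙 (𝟙_ D) ⊗ₘ F.mapOne.hom)) ≫ (λ_ (F.obj B.one)).hom = F.mapOne.hom
      simp)
    (fun X Y => by
      change (tensorμ (𝟙_ D) (F.obj X) (𝟙_ D) (F.obj Y) ≫ ((λ_ (𝟙_ D)).hom ⊗ₘ (F.mapTen X Y).hom)) ≫
        (λ_ (F.obj (B.ten X Y))).hom = ((λ_ (F.obj X)).hom ⊗ₘ (λ_ (F.obj Y)).hom) ≫ (F.mapTen X Y).hom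
      rw [leftUnitor_monoidal]
      simp [MonoidalCategory.tensorHom_def])
  rightUnitor F := isoMk (fun X => ρ_ (F.obj X))
    (fun {X Y} f => by
      change (F.map f ⊗ₘ 𝟙 (𝟙_ D)) ≫ (ρ_ (F.obj Y)).hom = (ρ_ (F.obj X)).hom ≫ F.map f
      simp)
    (by
      change ((λ_ (𝟙_ D)).inv ≫ (F.mapOne.hom ⊗ₘ 𝟙 (𝟙_ D))) ≫ (ρ_ (F.obj B.one)).hom = F.mapOne.hom
      simp [← unitors_equal])
    (fun X Y => by
      change (tensorμ (F.obj X) (𝟙_ D) (F.obj Y) (𝟙_ D) ≫ ((F.mapTen X Y).hom ⊗ₘ (λ_ (𝟙_ D)).hom)) ≫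
        (ρ_ (F.obj (B.ten X Y))).hom = ((ρ_ (F.obj X)).hom ⊗ₘ (ρ_ (F.obj Y)).hom) ≫ (F.mapTen X Y).hom
      rw [rightUnitor_monoidal]
      simp [MonoidalCategory.tensorHom_def'])

@[simp] theorem tensor_obj (F G : SMFun B D) (X : B.Ob) : (F ⊗ G).obj X = F.obj X ⊗ G.obj X := rfl
@[simp] theorem unit_obj (X : B.Ob) : (𝟙_ (SMFun B D)).obj X = 𝟙_ D := rfl
@[simp] theorem tensorHom_app {F F' G G' : SMFun B D} (a : F ⟶ F') (b : G ⟶ G') (X : B.Ob) :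
    Hom.app (a ⊗ₘ b) X = a.app X ⊗ₘ b.app X := rfl
@[simp] theorem whiskerLeft_app (F : SMFun B D) {G G' : SMFun B D} (b : G ⟶ G') (X : B.Ob) :
    Hom.app (F ◁ b) X = F.obj X ◁ b.app X := rfl
@[simp] theorem whiskerRight_app {F F' : SMFun B D} (a : F ⟶ F') (G : SMFun B D) (X : B.Ob) :
    Hom.app (a ▷ G) X = a.app X ▷ G.obj X := rfl
@[simp] theorem associator_app (F G H : SMFun B D) (X : B.Ob) :
    Hom.app (α_ F G H).hom X = (α_ (F.obj X) (G.obj X) (H.obj X)).hom := rfl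
@[simp] theorem associator_inv_app (F G H : SMFun B D) (X : B.Ob) :
    Hom.app (α_ F G H).inv X = (α_ (F.obj X) (G.obj X) (H.obj X)).inv := rfl
@[simp] theorem leftUnitor_app (F : SMFun B D) (X : B.Ob) :
    Hom.app (λ_ F).hom X = (λ_ (F.obj X)).hom := rfl
@[simp] theorem rightUnitor_app (F : SMFun B D) (X : B.Ob) :
    Hom.app (ρ_ F).hom X = (ρ_ (F.obj X)).hom := rfl

instance : MonoidalCategory (SMFun B D) where
  tensorHom_def a b := by ext X; simp [MonoidalCategory.tensorHom_def]
  id_tensorHom_id F G := by ext X; simp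
  tensorHom_comp_tensorHom _ _ _ _ := by ext X; simp
  whiskerLeft_id _ _ := by ext X; simp
  id_whiskerRight _ _ := by ext X; simp
  associator_naturality _ _ _ := by
    ext X; exact MonoidalCategory.associator_naturality _ _ _
  leftUnitor_naturality _ := by ext X; simp
  rightUnitor_naturality _ := by ext X; simp
  pentagon _ _ _ _ := by ext X; simp
  triangle _ _ := by ext X; simp

/-- The pointwise symmetry. -/
def swapIso (F G : SMFun B D) : F ⊗ G ≅ G ⊗ F :=
  isoMk (fun X => β_ (F.obj X) (G.obj X))
    (fun f => by
      change (F.map f ⊗ₘ G.map f) ≫ _ = _ ≫ (G.map f ⊗ₘ F.map f)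
      exact BraidedCategory.braiding_naturality _ _)
    (by
      change ((λ_ (𝟙_ D)).inv ≫ (F.mapOne.hom ⊗ₘ G.mapOne.hom)) ≫ _ =
        (λ_ (𝟙_ D)).inv ≫ (G.mapOne.hom ⊗ₘ F.mapOne.hom)
      rw [Category.assoc, BraidedCategory.braiding_naturality, braiding_unit_unit,
        Category.id_comp])
    (fun X Y => by
      change (tensorμ _ _ _ _ ≫ ((F.mapTen X Y).hom ⊗ₘ (G.mapTen X Y).hom)) ≫ _ =
        ((β_ (F.obj X) (G.obj X)).hom ⊗ₘ (β_ (F.obj Y) (G.obj Y)).hom) ≫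
          (tensorμ _ _ _ _ ≫ ((G.mapTen X Y).hom ⊗ₘ (F.mapTen X Y).hom))
      rw [Category.assoc, BraidedCategory.braiding_naturality, ← Category.assoc,
        tensorμ_braiding, Category.assoc])
@[simp] theorem swapIso_app (F G : SMFun B D) (X : B.Ob) :
    Hom.app (swapIso F G).hom X = (β_ (F.obj X) (G.obj X)).hom := rfl

instance : BraidedCategory (SMFun B D) where
  braiding := swapIso
  braiding_naturality_right F _ _ b := by
    ext X; simp
  braiding_naturality_left a F := by
    ext X; simp
  hexagon_forward F G H := by
    ext X; simp
  hexagon_reverse F G H := by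
    ext X; simp

@[simp] theorem braiding_app (F G : SMFun B D) (X : B.Ob) :
    Hom.app (β_ F G).hom X = (β_ (F.obj X) (G.obj X)).hom := rfl

instance : SymmetricCategory (SMFun B D) where
  symmetry F G := by ext X; simp

/-- Evaluation at an object. -/
def evalAt (D : Type u₁) [Category.{v₁} D] [MonoidalCategory D] [SymmetricCategory D]
    (X : B.Ob) : SMFun B D ⥤ D where
  obj F := F.obj X
  map a := a.app X

instance (X : B.Ob) : (evalAt D X).Monoidal :=
  Functor.CoreMonoidal.toMonoidal
    { εIso := Iso.refl _
      μIso := fun _ _ => Iso.refl _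
      μIso_hom_natural_left := by intros; simp [evalAt]
      μIso_hom_natural_right := by intros; simp [evalAt]
      associativity := by intros; simp [evalAt]
      left_unitality := by intros; simp [evalAt]
      right_unitality := by intros; simp [evalAt] }

theorem evalAt_mu (X : B.Ob) (F G : SMFun B D) :
    Functor.LaxMonoidal.μ (evalAt D X) F G = 𝟙 (F.obj X ⊗ G.obj X) := rfl

instance (X : B.Ob) : (evalAt D X).Braided where
  braided F G := by
    rw [evalAt_mu, evalAt_mu]
    simp [evalAt]

variable {E : Type u₂} [Category.{v₂} E] [MonoidalCategory E] [SymmetricCategory E]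

open Functor.LaxMonoidal in
/-- Postcomposition with a symmetric monoidal functor. -/
def postObj (K : D ⥤ E) [K.Braided] (F : SMFun B D) : SMFun B E where
  obj X := K.obj (F.obj X)
  map f := K.map (F.map f)
  map_idn X := by rw [F.map_idn, K.map_id]
  map_comp f g h H := by rw [F.map_comp f g h H, K.map_comp]
  mapOne := Functor.Monoidal.εIso K ≪≫ K.mapIso F.mapOne
  mapTen X Y := Functor.Monoidal.μIso K _ _ ≪≫ K.mapIso (F.mapTen X Y)
  μ_nat f g h H := by
    simp only [Iso.trans_hom, Functor.Monoidal.μIso_hom, Functor.mapIso_hom]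
    rw [Functor.LaxMonoidal.μ_natural_assoc, ← K.map_comp, F.μ_nat f g h H, K.map_comp,
      Category.assoc]
  μ_assoc X Y Z := by
    have := congrArg K.map (F.μ_assoc X Y Z)
    simp only [K.map_comp] at this
    simp only [Iso.trans_hom, Functor.Monoidal.μIso_hom, Functor.mapIso_hom,
      MonoidalCategory.comp_whiskerRight, MonoidalCategory.whiskerLeft_comp, Category.assoc]
    rw [Functor.LaxMonoidal.μ_natural_left_assoc, this,
      Functor.LaxMonoidal.associativity_assoc, Functor.LaxMonoidal.μ_natural_right_assoc]
  μ_lunit X := by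
    have := congrArg K.map (F.μ_lunit X)
    simp only [K.map_comp] at this
    simp only [Iso.trans_hom, Functor.Monoidal.μIso_hom, Functor.Monoidal.εIso_hom,
      Functor.mapIso_hom, MonoidalCategory.comp_whiskerRight, Category.assoc]
    rw [Functor.LaxMonoidal.μ_natural_left_assoc, this, Functor.LaxMonoidal.left_unitality]
  μ_runit X := by
    have := congrArg K.map (F.μ_runit X)
    simp only [K.map_comp] at this
    simp only [Iso.trans_hom, Functor.Monoidal.μIso_hom, Functor.Monoidal.εIso_hom,
      Functor.mapIso_hom, MonoidalCategory.whiskerLeft_comp, Category.assoc]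
    rw [Functor.LaxMonoidal.μ_natural_right_assoc, this, Functor.LaxMonoidal.right_unitality]
  μ_swap X Y := by
    have := congrArg K.map (F.μ_swap X Y)
    simp only [K.map_comp] at this
    simp only [Iso.trans_hom, Functor.Monoidal.μIso_hom, Functor.mapIso_hom, Category.assoc]
    rw [this, Functor.LaxBraided.braided_assoc]

/-- Postcomposition with a symmetric monoidal functor. -/
def post (B : SMData.{w}) (K : D ⥤ E) [K.Braided] : SMFun B D ⥤ SMFun B E where
  obj := postObj K
  map {F G} a :=
    { app := fun X => K.map (a.app X)
      nat := fun f => by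
        change K.map _ ≫ K.map _ = K.map _ ≫ K.map _
        rw [← K.map_comp, a.nat, K.map_comp]
      app_one := by
        change (Functor.LaxMonoidal.ε K ≫ K.map F.mapOne.hom) ≫ K.map _ =
          Functor.LaxMonoidal.ε K ≫ K.map G.mapOne.hom
        rw [Category.assoc, ← K.map_comp, a.app_one]
      app_ten := fun X Y => by
        change (Functor.LaxMonoidal.μ K _ _ ≫ K.map (F.mapTen X Y).hom) ≫ K.map (a.app _) =
          (K.map (a.app X) ⊗ₘ K.map (a.app Y)) ≫
            (Functor.LaxMonoidal.μ K (G.obj X) (G.obj Y) ≫ K.map (G.mapTen X Y).hom)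
        rw [Category.assoc, ← K.map_comp, a.app_ten, K.map_comp]
        exact (Functor.LaxMonoidal.μ_natural_assoc K _ _ _).symm }
  map_id F := by ext X; exact K.map_id _
  map_comp a b := by ext X; exact K.map_comp _ _

open Functor.LaxMonoidal Functor.Monoidal in
instance (K : D ⥤ E) [K.Braided] : (post B K).Monoidal :=
  Functor.CoreMonoidal.toMonoidal
    { εIso := isoMk (fun _ => εIso K)
        (fun _ => by change 𝟙 _ ≫ ε K = ε K ≫ K.map (𝟙 _); simp)
        (by change 𝟙 _ ≫ ε K = ε K ≫ K.map (𝟙 _); simp)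
        (fun _ _ => by
          change (λ_ (𝟙_ E)).hom ≫ ε K = (ε K ⊗ₘ ε K) ≫ μ K _ _ ≫ K.map (λ_ (𝟙_ D)).hom
          rw [MonoidalCategory.tensorHom_def', Category.assoc, ← left_unitality]
          simp)
      μIso := fun F G => isoMk (fun X => μIso K (F.obj X) (G.obj X))
        (fun f => by
          change (K.map _ ⊗ₘ K.map _) ≫ μ K _ _ = μ K _ _ ≫ K.map (_ ⊗ₘ _)
          rw [μ_natural])
        (by
          change ((λ_ (𝟙_ E)).inv ≫ ((ε K ≫ K.map F.mapOne.hom) ⊗ₘ (ε K ≫ K.map G.mapOne.hom))) ≫ μ K _ _ =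
            ε K ≫ K.map ((λ_ (𝟙_ D)).inv ≫ (F.mapOne.hom ⊗ₘ G.mapOne.hom))
          rw [← MonoidalCategory.tensorHom_comp_tensorHom, Category.assoc, Category.assoc, μ_natural,
            K.map_comp, MonoidalCategory.tensorHom_def', Category.assoc,
            ← MonoidalCategory.leftUnitor_inv_naturality_assoc, left_unitality_inv_assoc])
        (fun X Y => by
          change (tensorμ _ _ _ _ ≫ ((μ K _ _ ≫ K.map (F.mapTen X Y).hom) ⊗ₘ
              (μ K _ _ ≫ K.map (G.mapTen X Y).hom))) ≫ μ K _ _ =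
            (μ K _ _ ⊗ₘ μ K _ _) ≫ μ K _ _ ≫
              K.map (tensorμ _ _ _ _ ≫ ((F.mapTen X Y).hom ⊗ₘ (G.mapTen X Y).hom))
          rw [← MonoidalCategory.tensorHom_comp_tensorHom, Category.assoc, Category.assoc, μ_natural,
            K.map_comp, tensorμ_comp_μ_tensorHom_μ_comp_μ_assoc])
      μIso_hom_natural_left := fun a G => by
        ext X; exact μ_natural_left K _ _
      μIso_hom_natural_right := fun F b => by
        ext X; exact μ_natural_right K _ _
      associativity := fun F G H => by
        ext X; exact associativity K _ _ _
      left_unitality := fun F => by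
        ext X; exact left_unitality K _
      right_unitality := fun F => by
        ext X; exact right_unitality K _ }

open Functor.LaxMonoidal in
instance (K : D ⥤ E) [K.Braided] : (post B K).Braided where
  braided F G := by
    ext X
    exact Functor.LaxBraided.braided (F := K) (F.obj X) (G.obj X)

end SMFun

/-- A family of symmetric monoidal functors is a symmetric monoidal functor to the product. -/
instance piMonoidal {J : Type w} {S : Type u₁} [Category.{v₁} S] [MonoidalCategory S]
    {T : J → Type u₂} [∀ j, Category.{v₂} (T j)] [∀ j, MonoidalCategory (T j)]
    (K : ∀ j, S ⥤ T j) [∀ j, (K j).Monoidal] : (Functor.pi' K).Monoidal :=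
  Functor.CoreMonoidal.toMonoidal
    { εIso := Pi.isoMk fun j => Functor.Monoidal.εIso (K j)
      μIso := fun X Y => Pi.isoMk fun j => Functor.Monoidal.μIso (K j) X Y
      μIso_hom_natural_left := fun f X => by
        funext j; exact Functor.LaxMonoidal.μ_natural_left (K j) f X
      μIso_hom_natural_right := fun X f => by
        funext j; exact Functor.LaxMonoidal.μ_natural_right (K j) X f
      associativity := fun X Y Z => by
        funext j; exact Functor.LaxMonoidal.associativity (K j) X Y Z
      left_unitality := fun X => by
        funext j; exact Functor.LaxMonoidal.left_unitality (K j) X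
      right_unitality := fun X => by
        funext j; exact Functor.LaxMonoidal.right_unitality (K j) X }

instance piBraided {J : Type w} {S : Type u₁} [Category.{v₁} S] [MonoidalCategory S]
    [SymmetricCategory S] {T : J → Type u₂} [∀ j, Category.{v₂} (T j)]
    [∀ j, MonoidalCategory (T j)] [∀ j, SymmetricCategory (T j)]
    (K : ∀ j, S ⥤ T j) [∀ j, (K j).Braided] : (Functor.pi' K).Braided where
  braided X Y := by
    funext j; exact Functor.LaxBraided.braided (F := K j) X Y

instance piEvalMonoidal {J : Type w} {T : J → Type u₂} [∀ j, Category.{v₂} (T j)]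
    [∀ j, MonoidalCategory (T j)] (j : J) : (Pi.eval T j).Monoidal :=
  Functor.CoreMonoidal.toMonoidal
    { εIso := Iso.refl _
      μIso := fun _ _ => Iso.refl _
      μIso_hom_natural_left := fun f X =>
        (Category.comp_id (f j ▷ X j)).trans (Category.id_comp (f j ▷ X j)).symm
      μIso_hom_natural_right := fun X f =>
        (Category.comp_id (X j ◁ f j)).trans (Category.id_comp (X j ◁ f j)).symm
      associativity := fun X Y Z => by
        change (𝟙 (X j ⊗ Y j)) ▷ Z j ≫ 𝟙 _ ≫ (α_ (X j) (Y j) (Z j)).hom =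
          (α_ (X j) (Y j) (Z j)).hom ≫ X j ◁ (𝟙 (Y j ⊗ Z j)) ≫ 𝟙 _
        simp
      left_unitality := fun X => by
        change (λ_ (X j)).hom = 𝟙 (𝟙_ (T j)) ▷ X j ≫ 𝟙 _ ≫ (λ_ (X j)).hom
        simp
      right_unitality := fun X => by
        change (ρ_ (X j)).hom = X j ◁ 𝟙 (𝟙_ (T j)) ≫ 𝟙 _ ≫ (ρ_ (X j)).hom
        simp }

instance piEvalBraided {J : Type w} {T : J → Type u₂} [∀ j, Category.{v₂} (T j)]
    [∀ j, MonoidalCategory (T j)] [∀ j, SymmetricCategory (T j)] (j : J) :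
    (Pi.eval T j).Braided where
  braided X Y := by
    change 𝟙 _ ≫ (β_ (X j) (Y j)).hom = (β_ (X j) (Y j)).hom ≫ 𝟙 _
    simp

section TensorIso

theorem comp_tensorHom_right {D : Type u₁} [Category.{v₁} D] [MonoidalCategory D]
    {P Q R P' R' : D} (f : P ⟶ Q) (g : Q ⟶ R) (h : P' ⟶ R') :
    (f ≫ g) ⊗ₘ h = (f ⊗ₘ h) ≫ (g ▷ R') := by
  simp [MonoidalCategory.tensorHom_def']

theorem tensorHom_comp_right {D : Type u₁} [Category.{v₁} D] [MonoidalCategory D]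
    {P Q R P' R' : D} (f : P ⟶ Q) (g : Q ⟶ R) (h : P' ⟶ R') :
    h ⊗ₘ (f ≫ g) = (h ⊗ₘ f) ≫ (R' ◁ g) := by
  simp [MonoidalCategory.tensorHom_def]

open Functor.LaxMonoidal Functor.Monoidal

variable {S : Type u₁} [Category.{v₁} S] {T : Type u₂} [Category.{v₂} T]
  [MonoidalCategory S] [MonoidalCategory T] {P Q : S ⥤ T} [P.Monoidal] [Q.Monoidal]

/-- The tensor product of isomorphisms between values of monoidal functors. -/
def tIso {X Y : S} (x : P.obj X ≅ Q.obj X) (y : P.obj Y ≅ Q.obj Y) :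
    P.obj (X ⊗ Y) ≅ Q.obj (X ⊗ Y) :=
  (μIso P X Y).symm ≪≫ (x ⊗ᵢ y) ≪≫ μIso Q X Y

/-- The isomorphism between the values of monoidal functors on the unit. -/
def oneIso (P Q : S ⥤ T) [P.Monoidal] [Q.Monoidal] : P.obj (𝟙_ S) ≅ Q.obj (𝟙_ S) :=
  (εIso P).symm ≪≫ εIso Q

theorem μ_tIso {X Y : S} (x : P.obj X ≅ Q.obj X) (y : P.obj Y ≅ Q.obj Y) :
    μ P X Y ≫ (tIso x y).hom = (x.hom ⊗ₘ y.hom) ≫ μ Q X Y := by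
  simp [tIso]

theorem ε_oneIso : ε P ≫ (oneIso P Q).hom = ε Q := by simp [oneIso]

theorem tIso_nat {X X' Y Y' : S} {x : P.obj X ≅ Q.obj X} {y : P.obj Y ≅ Q.obj Y}
    {x' : P.obj X' ≅ Q.obj X'} {y' : P.obj Y' ≅ Q.obj Y'} {f : X ⟶ X'} {g : Y ⟶ Y'}
    (hf : P.map f ≫ x'.hom = x.hom ≫ Q.map f) (hg : P.map g ≫ y'.hom = y.hom ≫ Q.map g) :
    P.map (f ⊗ₘ g) ≫ (tIso x' y').hom = (tIso x y).hom ≫ Q.map (f ⊗ₘ g) := by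
  rw [← cancel_epi (μ P _ _), ← μ_natural_assoc, μ_tIso,
    MonoidalCategory.tensorHom_comp_tensorHom_assoc, hf, hg, reassoc_of% μ_tIso x y,
    ← μ_natural, MonoidalCategory.tensorHom_comp_tensorHom_assoc]

theorem tIso_assoc {X Y Z : S} (x : P.obj X ≅ Q.obj X) (y : P.obj Y ≅ Q.obj Y)
    (z : P.obj Z ≅ Q.obj Z) :
    P.map (α_ X Y Z).hom ≫ (tIso x (tIso y z)).hom =
      (tIso (tIso x y) z).hom ≫ Q.map (α_ X Y Z).hom := by
  rw [← cancel_epi (μ P (X ⊗ Y) Z), ← cancel_epi (μ P X Y ▷ P.obj Z), associativity_assoc, μ_tIso,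
    reassoc_of% μ_tIso (tIso x y) z, ← Category.assoc (_ ◁ _), ← tensorHom_comp, μ_tIso,
    ← Category.assoc (_ ▷ _), ← comp_tensorHom, μ_tIso, comp_tensorHom_right, tensorHom_comp_right,
    Category.assoc, Category.assoc, associativity, MonoidalCategory.associator_naturality_assoc]

theorem tIso_left {X : S} (x : P.obj X ≅ Q.obj X) :
    P.map (λ_ X).hom ≫ x.hom = (tIso (oneIso P Q) x).hom ≫ Q.map (λ_ X).hom := by
  rw [← cancel_epi (μ P (𝟙_ S) X), ← cancel_epi (ε P ▷ P.obj X), ← left_unitality_assoc,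
    reassoc_of% μ_tIso (oneIso P Q) x, ← Category.assoc (ε P ▷ _), ← comp_tensorHom, ε_oneIso,
    MonoidalCategory.tensorHom_def', Category.assoc, ← left_unitality]
  simp

theorem tIso_right {X : S} (x : P.obj X ≅ Q.obj X) :
    P.map (ρ_ X).hom ≫ x.hom = (tIso x (oneIso P Q)).hom ≫ Q.map (ρ_ X).hom := by
  rw [← cancel_epi (μ P X (𝟙_ S)), ← cancel_epi (P.obj X ◁ ε P), ← right_unitality_assoc,
    reassoc_of% μ_tIso x (oneIso P Q), ← Category.assoc (_ ◁ ε P), ← tensorHom_comp, ε_oneIso,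
    MonoidalCategory.tensorHom_def, Category.assoc, ← right_unitality]
  simp

end TensorIso

theorem tIso_swap {S : Type u₁} [Category.{v₁} S] {T : Type u₂} [Category.{v₂} T]
    [MonoidalCategory S] [MonoidalCategory T] [SymmetricCategory S] [SymmetricCategory T]
    {P Q : S ⥤ T} [P.Braided] [Q.Braided] {X Y : S} (x : P.obj X ≅ Q.obj X)
    (y : P.obj Y ≅ Q.obj Y) :
    P.map (β_ X Y).hom ≫ (tIso y x).hom = (tIso x y).hom ≫ Q.map (β_ X Y).hom := by
  rw [← cancel_epi (Functor.LaxMonoidal.μ P X Y), Functor.LaxBraided.braided_assoc, μ_tIso,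
    reassoc_of% μ_tIso x y, Functor.LaxBraided.braided, BraidedCategory.braiding_naturality_assoc]

section Inserter

variable {S : Type u₁} [Category.{v₁} S] {T : Type u₂} [Category.{v₂} T]

/-- The iso-inserter of `P` and `Q`: objects `X` together with an isomorphism `P X ≅ Q X`. -/
structure IsoIns (P Q : S ⥤ T) where
  obj : S
  iso : P.obj obj ≅ Q.obj obj

namespace IsoIns

variable {P Q : S ⥤ T}

/-- Morphisms are the morphisms which intertwine the isomorphisms. -/
@[ext]
structure Hom (X Y : IsoIns P Q) where
  hom : X.obj ⟶ Y.obj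
  w : P.map hom ≫ Y.iso.hom = X.iso.hom ≫ Q.map hom

instance : Category (IsoIns P Q) where
  Hom := Hom
  id X := ⟨𝟙 _, by simp⟩
  comp f g := ⟨f.hom ≫ g.hom, by
    rw [P.map_comp, Category.assoc, g.w, ← Category.assoc, f.w, Category.assoc, Q.map_comp]⟩
  id_comp _ := Hom.ext (Category.id_comp _)
  comp_id _ := Hom.ext (Category.comp_id _)
  assoc _ _ _ := Hom.ext (Category.assoc _ _ _)

@[ext]
theorem hom_ext {X Y : IsoIns P Q} {f g : X ⟶ Y} (h : Hom.hom f = Hom.hom g) : f = g := Hom.ext h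

@[simp] theorem id_hom (X : IsoIns P Q) : Hom.hom (𝟙 X) = 𝟙 X.obj := rfl
@[simp] theorem comp_hom {X Y Z : IsoIns P Q} (f : X ⟶ Y) (g : Y ⟶ Z) :
    Hom.hom (f ≫ g) = Hom.hom f ≫ Hom.hom g := rfl

variable (P Q) in
/-- The forgetful functor. -/
def forget : IsoIns P Q ⥤ S where
  obj X := X.obj
  map f := f.hom

instance : (forget P Q).Faithful where
  map_injective h := Hom.ext h

/-- Isomorphisms from compatible isomorphisms. -/
def isoMk {X Y : IsoIns P Q} (e : X.obj ≅ Y.obj)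
    (w : P.map e.hom ≫ Y.iso.hom = X.iso.hom ≫ Q.map e.hom) : X ≅ Y where
  hom := ⟨e.hom, w⟩
  inv := ⟨e.inv, by
    rw [← P.mapIso_inv, Iso.inv_comp_eq, P.mapIso_hom, ← Category.assoc, w, Category.assoc,
      ← Q.map_comp]
    simp⟩
  hom_inv_id := Hom.ext e.hom_inv_id
  inv_hom_id := Hom.ext e.inv_hom_id

@[simp] theorem isoMk_hom {X Y : IsoIns P Q} (e : X.obj ≅ Y.obj) (w) :
    Hom.hom (isoMk (X := X) (Y := Y) e w).hom = e.hom := rfl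
@[simp] theorem isoMk_inv {X Y : IsoIns P Q} (e : X.obj ≅ Y.obj) (w) :
    Hom.hom (isoMk (X := X) (Y := Y) e w).inv = e.inv := rfl

variable [MonoidalCategory S] [MonoidalCategory T] [P.Monoidal] [Q.Monoidal]

open Functor.LaxMonoidal Functor.Monoidal Functor.OplaxMonoidal

/-- Replace the underlying morphism by an equal one. -/
def Hom.copy {X Y : IsoIns P Q} (a : Hom X Y) (f : X.obj ⟶ Y.obj) (h : f = a.hom) : Hom X Y where
  hom := f
  w := by subst h; exact a.w

/-- Tensor product of morphisms. -/
def tensorMap {X X' Y Y' : IsoIns P Q} (f : X ⟶ X') (g : Y ⟶ Y') :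
    Hom (P := P) (Q := Q) ⟨X.obj ⊗ Y.obj, tIso X.iso Y.iso⟩ ⟨X'.obj ⊗ Y'.obj, tIso X'.iso Y'.iso⟩ where
  hom := f.hom ⊗ₘ g.hom
  w := tIso_nat f.w g.w

instance : MonoidalCategoryStruct (IsoIns P Q) where
  tensorObj X Y := ⟨X.obj ⊗ Y.obj, tIso X.iso Y.iso⟩
  tensorUnit := ⟨𝟙_ S, oneIso P Q⟩
  tensorHom := tensorMap
  whiskerLeft X _ _ g := Hom.copy (tensorMap (𝟙 X) g) (X.obj ◁ g.hom)
    (MonoidalCategory.id_tensorHom _ _).symm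
  whiskerRight f Y := Hom.copy (tensorMap f (𝟙 Y)) (f.hom ▷ Y.obj)
    (MonoidalCategory.tensorHom_id _ _).symm
  associator X Y Z := isoMk (α_ X.obj Y.obj Z.obj) (tIso_assoc _ _ _)
  leftUnitor X := isoMk (λ_ X.obj) (tIso_left _)
  rightUnitor X := isoMk (ρ_ X.obj) (tIso_right _)

@[simp] theorem tensor_obj (X Y : IsoIns P Q) : (X ⊗ Y).obj = X.obj ⊗ Y.obj := rfl
@[simp] theorem unit_obj : (𝟙_ (IsoIns P Q)).obj = 𝟙_ S := rfl
@[simp] theorem tensorHom_hom {X X' Y Y' : IsoIns P Q} (f : X ⟶ X') (g : Y ⟶ Y') :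
    Hom.hom (f ⊗ₘ g) = f.hom ⊗ₘ g.hom := rfl
@[simp] theorem whiskerLeft_hom (X : IsoIns P Q) {Y Y' : IsoIns P Q} (g : Y ⟶ Y') :
    Hom.hom (X ◁ g) = X.obj ◁ g.hom := rfl
@[simp] theorem whiskerRight_hom {X X' : IsoIns P Q} (f : X ⟶ X') (Y : IsoIns P Q) :
    Hom.hom (f ▷ Y) = f.hom ▷ Y.obj := rfl
@[simp] theorem associator_hom_hom (X Y Z : IsoIns P Q) :
    Hom.hom (α_ X Y Z).hom = (α_ X.obj Y.obj Z.obj).hom := rfl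
@[simp] theorem associator_inv_hom (X Y Z : IsoIns P Q) :
    Hom.hom (α_ X Y Z).inv = (α_ X.obj Y.obj Z.obj).inv := rfl
@[simp] theorem leftUnitor_hom_hom (X : IsoIns P Q) : Hom.hom (λ_ X).hom = (λ_ X.obj).hom := rfl
@[simp] theorem rightUnitor_hom_hom (X : IsoIns P Q) : Hom.hom (ρ_ X).hom = (ρ_ X.obj).hom := rfl

instance : MonoidalCategory (IsoIns P Q) where
  tensorHom_def a b := by ext; simp [MonoidalCategory.tensorHom_def]
  id_tensorHom_id F G := by ext; simp
  tensorHom_comp_tensorHom _ _ _ _ := by ext; simp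
  whiskerLeft_id _ _ := by ext; simp
  id_whiskerRight _ _ := by ext; simp
  associator_naturality _ _ _ := by
    ext; exact MonoidalCategory.associator_naturality _ _ _
  leftUnitor_naturality _ := by ext; simp
  rightUnitor_naturality _ := by ext; simp
  pentagon _ _ _ _ := by ext; simp
  triangle _ _ := by ext; simp

instance : (forget P Q).Monoidal :=
  Functor.CoreMonoidal.toMonoidal
    { εIso := Iso.refl _
      μIso := fun _ _ => Iso.refl _
      μIso_hom_natural_left := by intros; simp [forget]
      μIso_hom_natural_right := by intros; simp [forget]
      associativity := by intros; simp [forget]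
      left_unitality := by intros; simp [forget]
      right_unitality := by intros; simp [forget] }

end IsoIns

end Inserter

namespace IsoIns

variable {S : Type u₁} [Category.{v₁} S] {T : Type u₂} [Category.{v₂} T]
  [MonoidalCategory S] [MonoidalCategory T] [SymmetricCategory S] [SymmetricCategory T]
  {P Q : S ⥤ T} [P.Braided] [Q.Braided]

open Functor.LaxMonoidal Functor.Monoidal Functor.OplaxMonoidal

/-- The symmetry. -/
def swapIso (X Y : IsoIns P Q) : X ⊗ Y ≅ Y ⊗ X :=
  isoMk (β_ X.obj Y.obj) (tIso_swap _ _)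

@[simp] theorem swapIso_hom (X Y : IsoIns P Q) :
    Hom.hom (swapIso X Y).hom = (β_ X.obj Y.obj).hom := rfl

instance : BraidedCategory (IsoIns P Q) where
  braiding := swapIso
  braiding_naturality_right _ _ _ _ := by ext; simp
  braiding_naturality_left _ _ := by ext; simp
  hexagon_forward _ _ _ := by ext; simp
  hexagon_reverse _ _ _ := by ext; simp

@[simp] theorem braiding_hom (X Y : IsoIns P Q) :
    Hom.hom (β_ X Y).hom = (β_ X.obj Y.obj).hom := rfl

instance : SymmetricCategory (IsoIns P Q) where
  symmetry X Y := by ext; simp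

instance : (forget P Q).Braided where
  braided X Y := by
    change 𝟙 _ ≫ (β_ X.obj Y.obj).hom = (β_ X.obj Y.obj).hom ≫ 𝟙 _
    simp

end IsoIns

section Bundles

open scoped ContDiff TensorProduct

/-! ### Cartesian spaces -/

/-- Cartesian spaces: submanifolds of some `ℝ^N` which are diffeomorphic to some `ℝ^m`, i.e. images
of smooth embeddings `ℝ^m → ℝ^N`. -/
structure Cart where
  N : ℕ
  carrier : Set (EuclideanSpace ℝ (Fin N))
  exists_chart : ∃ (m : ℕ) (e : EuclideanSpace ℝ (Fin m) ≃ₜ carrier),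
    ContDiff ℝ ∞ (fun x => (e x : EuclideanSpace ℝ (Fin N))) ∧
    ∀ x, Function.Injective (fderiv ℝ (fun x => (e x : EuclideanSpace ℝ (Fin N))) x)

namespace Cart

/-- The underlying space. -/
abbrev Pt (U : Cart) : Type := U.carrier

/-- The dimension. -/
def dim (U : Cart) : ℕ := U.exists_chart.choose

/-- A global chart; smoothness on `U` does not depend on this choice. -/
def chart (U : Cart) : EuclideanSpace ℝ (Fin U.dim) ≃ₜ U.Pt := U.exists_chart.choose_spec.choose

/-- Smooth maps between cartesian spaces. -/
@[ext]
structure Hom (V U : Cart) where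
  toFun : V.Pt → U.Pt
  smooth : ContDiff ℝ ∞ (fun x => U.chart.symm (toFun (V.chart x)))

instance : Category Cart where
  Hom := Hom
  id U := ⟨id, by simpa using contDiff_fun_id⟩
  comp f g := ⟨g.toFun ∘ f.toFun, by
    have := g.smooth.comp f.smooth
    simpa [Function.comp_def] using this⟩

/-- The one-point cartesian space. -/
def pt : Cart where
  N := 0
  carrier := Set.univ
  exists_chart := ⟨0, (Homeomorph.Set.univ _).symm, contDiff_id, fun _ _ _ _ => Subsingleton.elim _ _⟩

/-- The point of the one-point cartesian space. -/
def star : pt.Pt := ⟨0, trivial⟩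

/-- The collapse map. -/
def collapse (U : Cart) : U ⟶ pt := Hom.mk (fun _ => star) (by exact contDiff_const)

/-- A complex valued function on a cartesian space is smooth at a point. -/
def SmoothAt {U : Cart} (g : U.Pt → ℂ) (x : U.Pt) : Prop :=
  ContDiffAt ℝ ∞ (fun y => g (U.chart y)) (U.chart.symm x)

theorem SmoothAt.mul {U : Cart} {g h : U.Pt → ℂ} {x : U.Pt} (hg : SmoothAt g x)
    (hh : SmoothAt h x) : SmoothAt (fun y => g y * h y) x := ContDiffAt.mul hg hh

theorem SmoothAt.sum {U : Cart} {ι : Type} {s : Finset ι} {g : ι → U.Pt → ℂ} {x : U.Pt}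
    (hg : ∀ i ∈ s, SmoothAt (g i) x) : SmoothAt (fun y => ∑ i ∈ s, g i y) x :=
  ContDiffAt.sum (f := fun i y => g i (U.chart y)) hg

theorem SmoothAt.conj {U : Cart} {g : U.Pt → ℂ} {x : U.Pt} (hg : SmoothAt g x) :
    SmoothAt (fun y => starRingEnd ℂ (g y)) x :=
  (Complex.conjCLE : ℂ →L[ℝ] ℂ).contDiff.contDiffAt.comp _ hg

theorem smoothAt_const {U : Cart} (c : ℂ) (x : U.Pt) : SmoothAt (fun _ => c) x := contDiffAt_const

theorem SmoothAt.congr {U : Cart} {g h : U.Pt → ℂ} {x : U.Pt} (hg : SmoothAt g x) {s : Set U.Pt}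
    (hs : IsOpen s) (hx : x ∈ s) (e : ∀ y ∈ s, h y = g y) : SmoothAt h x := by
  refine ContDiffAt.congr_of_eventuallyEq hg ?_
  have hx' : U.chart (U.chart.symm x) ∈ s := by simpa using hx
  filter_upwards [(hs.preimage U.chart.continuous).mem_nhds hx'] with y hy
  exact e _ hy

theorem SmoothAt.comp {V U : Cart} (f : V ⟶ U) {g : U.Pt → ℂ} {x : V.Pt}
    (hg : SmoothAt g (Hom.toFun f x)) : SmoothAt (fun y => g (Hom.toFun f y)) x := by
  have h1 := (Hom.smooth f).contDiffAt (x := V.chart.symm x)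
  have h2 : ContDiffAt ℝ ∞ (fun y => g (U.chart y))
      (U.chart.symm (Hom.toFun f (V.chart (V.chart.symm x)))) := by simpa [SmoothAt] using hg
  have := ContDiffAt.comp (V.chart.symm x) h2 h1
  simpa [SmoothAt, Function.comp_def] using this

theorem continuous_toFun {V U : Cart} (f : V ⟶ U) : Continuous (Hom.toFun f) := by
  have h := U.chart.continuous.comp ((Hom.smooth f).continuous.comp V.chart.symm.continuous)
  simpa [Function.comp_def] using h

end Cart

/-! ### Vector bundles -/

open Classical in
/-- A smooth complex vector bundle over `U`: a family of finite-dimensional vector spaces, with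
local frames `vec i` over the members `dom i` of an open cover (`cov i` is the dual coframe) such
that the transition functions are smooth. -/
structure VBun (U : Cart) where
  fib : U.Pt → FGModuleCat.{0} ℂ
  ι : Type
  κ : ι → Type
  fin : ∀ i, Fintype (κ i)
  dom : ι → Set U.Pt
  dom_open : ∀ i, IsOpen (dom i)
  cover : ∀ x, ∃ i, x ∈ dom i
  vec : ∀ i, κ i → ∀ x, fib x
  cov : ∀ i, κ i → ∀ x, fib x →ₗ[ℂ] ℂ
  dual : ∀ i, ∀ x ∈ dom i, ∀ a b, cov i a x (vec i b x) = if a = b then 1 else 0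
  span : ∀ i, ∀ x ∈ dom i, ∀ v, ∑ a, cov i a x v • vec i a x = v
  smooth : ∀ i j a b x, x ∈ dom i → x ∈ dom j → Cart.SmoothAt (fun y => cov j b y (vec i a y)) x

attribute [instance] VBun.fin

namespace VBun

variable {U : Cart}

/-- Smoothness of a fibrewise linear map. -/
def IsSmooth {E F : VBun U} (φ : ∀ x, E.fib x ⟶ F.fib x) : Prop :=
  ∀ i j a b x, x ∈ E.dom i → x ∈ F.dom j →
    Cart.SmoothAt (fun y => F.cov j b y ((φ y).hom.hom (E.vec i a y))) x

/-- Morphisms of vector bundles. -/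
@[ext]
structure Hom (E F : VBun U) where
  map : ∀ x, E.fib x ⟶ F.fib x
  smooth : IsSmooth map

theorem IsSmooth.comp {E F G : VBun U} {φ : ∀ x, E.fib x ⟶ F.fib x} {ψ : ∀ x, F.fib x ⟶ G.fib x}
    (hφ : IsSmooth φ) (hψ : IsSmooth ψ) : IsSmooth (fun x => φ x ≫ ψ x) := by
  intro i k a c x hi hk
  obtain ⟨j, hj⟩ := F.cover x
  have : Cart.SmoothAt (fun y => ∑ b, F.cov j b y ((φ y).hom.hom (E.vec i a y)) *
      G.cov k c y ((ψ y).hom.hom (F.vec j b y))) x :=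
    Cart.SmoothAt.sum fun b _ => (hφ i j a b x hi hj).mul (hψ j k b c x hj hk)
  refine this.congr (F.dom_open j) hj fun y hy => ?_
  have h := F.span j y hy ((φ y).hom.hom (E.vec i a y))
  change G.cov k c y ((ψ y).hom.hom ((φ y).hom.hom (E.vec i a y))) = _
  conv_lhs => rw [← h]
  simp [map_sum]

instance : Category (VBun U) where
  Hom := Hom
  id E := ⟨fun _ => 𝟙 _, fun i j a b x hi hj => E.smooth i j a b x hi hj⟩
  comp f g := ⟨fun x => f.map x ≫ g.map x, f.smooth.comp g.smooth⟩
  id_comp f := Hom.ext (by funext x; exact Category.id_comp (f.map x))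
  comp_id f := Hom.ext (by funext x; exact Category.comp_id (f.map x))
  assoc f g h := Hom.ext (by funext x; exact Category.assoc (f.map x) (g.map x) (h.map x))

@[ext]
theorem hom_ext {E F : VBun U} {f g : E ⟶ F} (h : ∀ x, Hom.map f x = Hom.map g x) : f = g :=
  Hom.ext (funext h)

@[simp] theorem id_map (E : VBun U) (x : U.Pt) : Hom.map (𝟙 E) x = 𝟙 (E.fib x) := rfl
@[simp] theorem comp_map {E F G : VBun U} (f : E ⟶ F) (g : F ⟶ G) (x : U.Pt) :
    Hom.map (f ≫ g) x = Hom.map f x ≫ Hom.map g x := rfl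

/-- Isomorphisms from fibrewise isomorphisms. -/
def isoMk {E F : VBun U} (e : ∀ x, E.fib x ≅ F.fib x) (h : IsSmooth fun x => (e x).hom)
    (h' : IsSmooth fun x => (e x).inv) : E ≅ F where
  hom := ⟨_, h⟩
  inv := ⟨_, h'⟩
  hom_inv_id := by ext x : 1; exact (e x).hom_inv_id
  inv_hom_id := by ext x : 1; exact (e x).inv_hom_id

@[simp] theorem isoMk_hom_map {E F : VBun U} (e : ∀ x, E.fib x ≅ F.fib x) (h) (h') (x : U.Pt) :
    Hom.map (isoMk (E := E) (F := F) e h h').hom x = (e x).hom := rfl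
@[simp] theorem isoMk_inv_map {E F : VBun U} (e : ∀ x, E.fib x ≅ F.fib x) (h) (h') (x : U.Pt) :
    Hom.map (isoMk (E := E) (F := F) e h h').inv x = (e x).inv := rfl

/-- The product of linear functionals. -/
def covMul {V W : FGModuleCat.{0} ℂ} (f : V →ₗ[ℂ] ℂ) (g : W →ₗ[ℂ] ℂ) :
    (V ⊗ W : FGModuleCat.{0} ℂ) →ₗ[ℂ] ℂ :=
  TensorProduct.dualDistrib ℂ V W (f ⊗ₜ g)

/-- The tensor product of elements. -/
def elt {V W : FGModuleCat.{0} ℂ} (v : V) (w : W) : (V ⊗ W : FGModuleCat.{0} ℂ) := v ⊗ₜ[ℂ] w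

theorem covMul_elt {V W : FGModuleCat.{0} ℂ} (f : V →ₗ[ℂ] ℂ) (g : W →ₗ[ℂ] ℂ) (v : V) (w : W) :
    covMul f g (elt v w) = f v * g w := TensorProduct.dualDistrib_apply _ _ _ _

theorem tensorHom_elt {V W V' W' : FGModuleCat.{0} ℂ} (f : V ⟶ V') (g : W ⟶ W') (v : V) (w : W) :
    (f ⊗ₘ g).hom.hom (elt v w) = elt (f.hom.hom v) (g.hom.hom w) := rfl

theorem tensor_span {V W : Type} [AddCommGroup V] [Module ℂ V] [AddCommGroup W] [Module ℂ W]
    {κ κ' : Type} [Fintype κ] [Fintype κ']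
    {c : κ → V →ₗ[ℂ] ℂ} {e : κ → V} {c' : κ' → W →ₗ[ℂ] ℂ} {e' : κ' → W}
    (h : ∀ v, ∑ a, c a v • e a = v) (h' : ∀ v, ∑ a, c' a v • e' a = v) (v : V ⊗[ℂ] W) :
    ∑ a : κ × κ', TensorProduct.dualDistrib ℂ V W (c a.1 ⊗ₜ c' a.2) v • (e a.1 ⊗ₜ[ℂ] e' a.2) = v := by
  induction v using TensorProduct.induction_on with
  | zero => simp
  | add x y hx hy =>
    simp only [map_add, add_smul, Finset.sum_add_distrib]
    rw [hx, hy]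
  | tmul x y =>
    simp only [TensorProduct.dualDistrib_apply]
    simp_rw [← TensorProduct.smul_tmul_smul, Fintype.sum_prod_type, ← TensorProduct.tmul_sum,
      ← TensorProduct.sum_tmul, h, h']

theorem tensor_dual_span {V W : FGModuleCat.{0} ℂ} {κ κ' : Type} [Fintype κ] [Fintype κ']
    {c : κ → V →ₗ[ℂ] ℂ} {e : κ → V} {c' : κ' → W →ₗ[ℂ] ℂ} {e' : κ' → W}
    (h : ∀ v, ∑ a, c a v • e a = v) (h' : ∀ v, ∑ a, c' a v • e' a = v)
    (v : (V ⊗ W : FGModuleCat.{0} ℂ)) :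
    ∑ a : κ × κ', covMul (c a.1) (c' a.2) v • elt (e a.1) (e' a.2) = v := tensor_span h h' v

/-- The tensor product of vector bundles. -/
def tensor (E F : VBun U) : VBun U where
  fib x := E.fib x ⊗ F.fib x
  ι := E.ι × F.ι
  κ i := E.κ i.1 × F.κ i.2
  fin _ := inferInstance
  dom i := E.dom i.1 ∩ F.dom i.2
  dom_open i := (E.dom_open _).inter (F.dom_open _)
  cover x := by
    obtain ⟨i, hi⟩ := E.cover x
    obtain ⟨j, hj⟩ := F.cover x
    exact ⟨(i, j), hi, hj⟩
  vec i a x := elt (E.vec i.1 a.1 x) (F.vec i.2 a.2 x)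
  cov i a x := covMul (E.cov i.1 a.1 x) (F.cov i.2 a.2 x)
  dual i x hx a b := by
    rw [covMul_elt, E.dual _ _ hx.1, F.dual _ _ hx.2]
    by_cases h1 : a.1 = b.1 <;> by_cases h2 : a.2 = b.2 <;> simp [Prod.ext_iff, h1, h2]
  span i x hx v := tensor_dual_span (E.span _ _ hx.1) (F.span _ _ hx.2) v
  smooth i j a b x hi hj := by
    simp only [covMul_elt]
    exact (E.smooth _ _ _ _ _ hi.1 hj.1).mul (F.smooth _ _ _ _ _ hi.2 hj.2)

/-- The trivial line bundle. -/
def unit (U : Cart) : VBun U where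
  fib _ := 𝟙_ (FGModuleCat.{0} ℂ)
  ι := Unit
  κ _ := Unit
  fin _ := inferInstance
  dom _ := Set.univ
  dom_open _ := isOpen_univ
  cover x := ⟨(), trivial⟩
  vec _ _ _ := (1 : ℂ)
  cov _ _ _ := (LinearMap.id : ℂ →ₗ[ℂ] ℂ)
  dual _ _ _ _ _ := by simp
  span _ _ _ v := by
    simp only [Finset.univ_unique, Finset.sum_singleton]
    exact mul_one (M := ℂ) v
  smooth _ _ _ _ _ _ _ := Cart.smoothAt_const _ _

theorem isSmooth_tensorHom {E E' F F' : VBun U} {φ : ∀ x, E.fib x ⟶ E'.fib x}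
    {ψ : ∀ x, F.fib x ⟶ F'.fib x} (hφ : IsSmooth φ) (hψ : IsSmooth ψ) :
    IsSmooth (E := tensor E F) (F := tensor E' F') (fun x => φ x ⊗ₘ ψ x) := by
  intro i j a b x hi hj
  have := (hφ i.1 j.1 a.1 b.1 x hi.1 hj.1).mul (hψ i.2 j.2 a.2 b.2 x hi.2 hj.2)
  refine this.congr isOpen_univ trivial fun y _ => ?_
  exact covMul_elt _ _ _ _

theorem isSmooth_id (E : VBun U) : IsSmooth (E := E) (F := E) (fun _ => 𝟙 _) := E.smooth

instance : MonoidalCategoryStruct (VBun U) where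
  tensorObj := tensor
  tensorUnit := unit U
  tensorHom f g := ⟨fun x => f.map x ⊗ₘ g.map x, isSmooth_tensorHom f.smooth g.smooth⟩
  whiskerLeft E _ _ g := ⟨fun x => E.fib x ◁ g.map x, by
    have := isSmooth_tensorHom (isSmooth_id E) g.smooth
    simpa only [MonoidalCategory.id_tensorHom] using this⟩
  whiskerRight f E := ⟨fun x => f.map x ▷ E.fib x, by
    have := isSmooth_tensorHom f.smooth (isSmooth_id E)
    simpa only [MonoidalCategory.tensorHom_id] using this⟩
  associator E F G := isoMk (fun x => α_ (E.fib x) (F.fib x) (G.fib x))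
    (fun i j a b x hi hj => by
      refine ((E.smooth i.1.1 j.1 a.1.1 b.1 x hi.1.1 hj.1).mul
        ((F.smooth i.1.2 j.2.1 a.1.2 b.2.1 x hi.1.2 hj.2.1).mul
        (G.smooth i.2 j.2.2 a.2 b.2.2 x hi.2 hj.2.2))).congr isOpen_univ trivial fun y _ => ?_
      exact (covMul_elt _ _ _ _).trans (congrArg _ (covMul_elt _ _ _ _)))
    (fun i j a b x hi hj => by
      refine (((E.smooth i.1 j.1.1 a.1 b.1.1 x hi.1 hj.1.1).mul
        (F.smooth i.2.1 j.1.2 a.2.1 b.1.2 x hi.2.1 hj.1.2)).mul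
        (G.smooth i.2.2 j.2 a.2.2 b.2 x hi.2.2 hj.2)).congr isOpen_univ trivial fun y _ => ?_
      exact (covMul_elt _ _ _ _).trans (congrArg (· * _) (covMul_elt _ _ _ _)))
  leftUnitor E := isoMk (fun x => λ_ (E.fib x))
    (fun i j a b x hi hj => by
      refine (E.smooth i.2 j a.2 b x hi.2 hj).congr isOpen_univ trivial fun y _ => ?_
      exact congrArg (E.cov j b y) (one_smul ℂ (E.vec i.2 a.2 y)))
    (fun i j a b x hi hj => by
      refine (E.smooth i j.2 a b.2 x hi hj.2).congr isOpen_univ trivial fun y _ => ?_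
      exact (covMul_elt _ _ _ _).trans (one_mul _))
  rightUnitor E := isoMk (fun x => ρ_ (E.fib x))
    (fun i j a b x hi hj => by
      refine (E.smooth i.1 j a.1 b x hi.1 hj).congr isOpen_univ trivial fun y _ => ?_
      exact congrArg (E.cov j b y) (one_smul ℂ (E.vec i.1 a.1 y)))
    (fun i j a b x hi hj => by
      refine (E.smooth i j.1 a b.1 x hi hj.1).congr isOpen_univ trivial fun y _ => ?_
      exact (covMul_elt _ _ _ _).trans (mul_one _))

@[simp] theorem tensor_fib (E F : VBun U) (x : U.Pt) : (E ⊗ F).fib x = E.fib x ⊗ F.fib x := rfl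
@[simp] theorem unit_fib (x : U.Pt) : (𝟙_ (VBun U)).fib x = 𝟙_ _ := rfl
@[simp] theorem tensorHom_map {E E' F F' : VBun U} (f : E ⟶ E') (g : F ⟶ F') (x : U.Pt) :
    Hom.map (f ⊗ₘ g) x = f.map x ⊗ₘ g.map x := rfl
@[simp] theorem whiskerLeft_map (E : VBun U) {F F' : VBun U} (g : F ⟶ F') (x : U.Pt) :
    Hom.map (E ◁ g) x = E.fib x ◁ g.map x := rfl
@[simp] theorem whiskerRight_map {F F' : VBun U} (g : F ⟶ F') (E : VBun U) (x : U.Pt) :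
    Hom.map (g ▷ E) x = g.map x ▷ E.fib x := rfl
@[simp] theorem associator_hom_map (E F G : VBun U) (x : U.Pt) :
    Hom.map (α_ E F G).hom x = (α_ (E.fib x) (F.fib x) (G.fib x)).hom := rfl
@[simp] theorem associator_inv_map (E F G : VBun U) (x : U.Pt) :
    Hom.map (α_ E F G).inv x = (α_ (E.fib x) (F.fib x) (G.fib x)).inv := rfl
@[simp] theorem leftUnitor_hom_map (E : VBun U) (x : U.Pt) :
    Hom.map (λ_ E).hom x = (λ_ (E.fib x)).hom := rfl
@[simp] theorem rightUnitor_hom_map (E : VBun U) (x : U.Pt) :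
    Hom.map (ρ_ E).hom x = (ρ_ (E.fib x)).hom := rfl

instance : MonoidalCategory (VBun U) where
  tensorHom_def a b := by ext x : 1; exact MonoidalCategory.tensorHom_def _ _
  id_tensorHom_id F G := by ext x : 1; exact MonoidalCategory.id_tensorHom_id _ _
  tensorHom_comp_tensorHom _ _ _ _ := by
    ext x : 1; exact MonoidalCategory.tensorHom_comp_tensorHom _ _ _ _
  whiskerLeft_id _ _ := by ext x : 1; exact MonoidalCategory.whiskerLeft_id _ _
  id_whiskerRight _ _ := by ext x : 1; exact MonoidalCategory.id_whiskerRight _ _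
  associator_naturality _ _ _ := by
    ext x : 1; exact MonoidalCategory.associator_naturality _ _ _
  leftUnitor_naturality _ := by ext x : 1; exact MonoidalCategory.leftUnitor_naturality _
  rightUnitor_naturality _ := by ext x : 1; exact MonoidalCategory.rightUnitor_naturality _
  pentagon _ _ _ _ := by ext x : 1; exact MonoidalCategory.pentagon _ _ _ _
  triangle _ _ := by ext x : 1; exact MonoidalCategory.triangle _ _

/-- The symmetry. -/
def swapIso (E F : VBun U) : E ⊗ F ≅ F ⊗ E :=
  isoMk (fun x => β_ (E.fib x) (F.fib x))
    (fun i j a b x hi hj => by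
      refine ((F.smooth i.2 j.1 a.2 b.1 x hi.2 hj.1).mul
        (E.smooth i.1 j.2 a.1 b.2 x hi.1 hj.2)).congr isOpen_univ trivial fun y _ => ?_
      exact covMul_elt _ _ _ _)
    (fun i j a b x hi hj => by
      refine ((E.smooth i.2 j.1 a.2 b.1 x hi.2 hj.1).mul
        (F.smooth i.1 j.2 a.1 b.2 x hi.1 hj.2)).congr isOpen_univ trivial fun y _ => ?_
      exact covMul_elt _ _ _ _)

@[simp] theorem swapIso_map (E F : VBun U) (x : U.Pt) :
    Hom.map (swapIso E F).hom x = (β_ (E.fib x) (F.fib x)).hom := rfl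

instance : BraidedCategory (VBun U) where
  braiding := swapIso
  braiding_naturality_right _ _ _ _ := by
    ext x : 1; exact BraidedCategory.braiding_naturality_right _ _
  braiding_naturality_left _ _ := by
    ext x : 1; exact BraidedCategory.braiding_naturality_left _ _
  hexagon_forward _ _ _ := by ext x : 1; exact BraidedCategory.hexagon_forward _ _ _
  hexagon_reverse _ _ _ := by ext x : 1; exact BraidedCategory.hexagon_reverse _ _ _

@[simp] theorem braiding_map (E F : VBun U) (x : U.Pt) :
    Hom.map (β_ E F).hom x = (β_ (E.fib x) (F.fib x)).hom := rfl

instance : SymmetricCategory (VBun U) where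
  symmetry E F := by ext x : 1; exact SymmetricCategory.symmetry _ _

/-- Pullback of vector bundles. -/
def pullObj {V U : Cart} (f : V ⟶ U) (E : VBun U) : VBun V where
  fib x := E.fib (f.toFun x)
  ι := E.ι
  κ := E.κ
  fin := E.fin
  dom i := f.toFun ⁻¹' E.dom i
  dom_open i := (E.dom_open i).preimage (Cart.continuous_toFun f)
  cover x := E.cover (f.toFun x)
  vec i a x := E.vec i a (f.toFun x)
  cov i a x := E.cov i a (f.toFun x)
  dual i _ hx a b := E.dual i _ hx a b
  span i _ hx v := E.span i _ hx v
  smooth i j a b _ hi hj := (E.smooth i j a b _ hi hj).comp f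

/-- Pullback of vector bundles. -/
def pull {V U : Cart} (f : V ⟶ U) : VBun U ⥤ VBun V where
  obj := pullObj f
  map φ := ⟨fun x => φ.map (f.toFun x), fun i j a b x hi hj => (φ.smooth i j a b _ hi hj).comp f⟩

instance {V U : Cart} (f : V ⟶ U) : (pull f).Monoidal :=
  Functor.CoreMonoidal.toMonoidal
    { εIso := isoMk (fun _ => Iso.refl _) (isSmooth_id (unit V)) (isSmooth_id (unit V))
      μIso := fun E F => isoMk (fun _ => Iso.refl _) (isSmooth_id (pullObj f (tensor E F)))
        (isSmooth_id (pullObj f (tensor E F)))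
      μIso_hom_natural_left := fun _ _ => by
        ext : 1; exact (Category.comp_id _).trans (Category.id_comp _).symm
      μIso_hom_natural_right := fun _ _ => by
        ext : 1; exact (Category.comp_id _).trans (Category.id_comp _).symm
      associativity := fun E F G => by
        ext x : 1
        change 𝟙 (E.fib (f.toFun x) ⊗ F.fib (f.toFun x)) ▷ G.fib (f.toFun x) ≫ 𝟙 _ ≫
          (α_ (E.fib (f.toFun x)) (F.fib (f.toFun x)) (G.fib (f.toFun x))).hom =
          (α_ (E.fib (f.toFun x)) (F.fib (f.toFun x)) (G.fib (f.toFun x))).hom ≫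
          E.fib (f.toFun x) ◁ 𝟙 (F.fib (f.toFun x) ⊗ G.fib (f.toFun x)) ≫ 𝟙 _
        rw [MonoidalCategory.id_whiskerRight, MonoidalCategory.whiskerLeft_id, Category.id_comp,
          Category.id_comp, Category.id_comp, Category.comp_id]
      left_unitality := fun E => by
        ext x : 1
        change (λ_ (E.fib (f.toFun x))).hom = 𝟙 (𝟙_ _) ▷ E.fib (f.toFun x) ≫ 𝟙 _ ≫
          (λ_ (E.fib (f.toFun x))).hom
        rw [MonoidalCategory.id_whiskerRight, Category.id_comp, Category.id_comp]
      right_unitality := fun E => by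
        ext x : 1
        change (ρ_ (E.fib (f.toFun x))).hom = E.fib (f.toFun x) ◁ 𝟙 (𝟙_ _) ≫ 𝟙 _ ≫
          (ρ_ (E.fib (f.toFun x))).hom
        rw [MonoidalCategory.whiskerLeft_id, Category.id_comp, Category.id_comp] }

instance {V U : Cart} (f : V ⟶ U) : (pull f).Braided where
  braided E F := by
    ext x : 1
    change 𝟙 _ ≫ (β_ (E.fib (f.toFun x)) (F.fib (f.toFun x))).hom =
      (β_ (E.fib (f.toFun x)) (F.fib (f.toFun x))).hom ≫ 𝟙 _
    rw [Category.id_comp, Category.comp_id]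

/-- The fibre at a point. -/
def fibre (u : U.Pt) : VBun U ⥤ FGModuleCat.{0} ℂ where
  obj E := E.fib u
  map φ := φ.map u

instance (u : U.Pt) : (fibre u).Monoidal :=
  Functor.CoreMonoidal.toMonoidal
    { εIso := Iso.refl _
      μIso := fun _ _ => Iso.refl _
      μIso_hom_natural_left := fun _ _ => (Category.comp_id _).trans (Category.id_comp _).symm
      μIso_hom_natural_right := fun _ _ => (Category.comp_id _).trans (Category.id_comp _).symm
      associativity := fun E F G => by
        change 𝟙 (E.fib u ⊗ F.fib u) ▷ G.fib u ≫ 𝟙 _ ≫ (α_ (E.fib u) (F.fib u) (G.fib u)).hom =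
          (α_ (E.fib u) (F.fib u) (G.fib u)).hom ≫ E.fib u ◁ 𝟙 (F.fib u ⊗ G.fib u) ≫ 𝟙 _
        rw [MonoidalCategory.id_whiskerRight, MonoidalCategory.whiskerLeft_id, Category.id_comp,
          Category.id_comp, Category.id_comp, Category.comp_id]
      left_unitality := fun E => by
        change (λ_ (E.fib u)).hom = 𝟙 (𝟙_ _) ▷ E.fib u ≫ 𝟙 _ ≫ (λ_ (E.fib u)).hom
        rw [MonoidalCategory.id_whiskerRight, Category.id_comp, Category.id_comp]
      right_unitality := fun E => by
        change (ρ_ (E.fib u)).hom = E.fib u ◁ 𝟙 (𝟙_ _) ≫ 𝟙 _ ≫ (ρ_ (E.fib u)).hom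
        rw [MonoidalCategory.whiskerLeft_id, Category.id_comp, Category.id_comp] }

instance (u : U.Pt) : (fibre u).Braided where
  braided E F := by
    change 𝟙 _ ≫ (β_ (E.fib u) (F.fib u)).hom = (β_ (E.fib u) (F.fib u)).hom ≫ 𝟙 _
    rw [Category.id_comp, Category.comp_id]

end VBun

/-! ### Complex conjugation -/

/-- The complex conjugate of a complex vector space. -/
def ConjSpace (V : Type) : Type := V

namespace ConjSpace

instance (V : Type) [h : AddCommGroup V] : AddCommGroup (ConjSpace V) := h

/-- The identity map to the conjugate space. -/
def mk {V : Type} [AddCommGroup V] : V ≃+ ConjSpace V := AddEquiv.refl V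

instance (V : Type) [AddCommGroup V] [Module ℂ V] : Module ℂ (ConjSpace V) where
  smul c v := mk (starRingEnd ℂ c • mk.symm v)
  one_smul v := (congrArg mk (by rw [map_one, one_smul])).trans (mk.apply_symm_apply v)
  mul_smul a b v := congrArg mk (by rw [map_mul, mul_smul]; rfl)
  smul_zero a := (congrArg mk (by rw [map_zero, smul_zero])).trans (map_zero mk)
  smul_add a v w := (congrArg mk (by rw [map_add, smul_add])).trans (map_add mk _ _)
  add_smul a b v := congrArg mk (by rw [map_add, add_smul]; rfl)
  zero_smul v := (congrArg mk (by rw [map_zero, zero_smul])).trans (map_zero mk)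

section

variable {V W : Type} [AddCommGroup V] [Module ℂ V] [AddCommGroup W] [Module ℂ W]

theorem smul_mk (c : ℂ) (v : V) : c • mk v = mk (starRingEnd ℂ c • v) := rfl

theorem mk_smul (c : ℂ) (v : V) : mk (c • v) = starRingEnd ℂ c • mk v := by simp [smul_mk]

/-- A linear map, seen as a linear map of conjugate spaces. -/
def map (f : V →ₗ[ℂ] W) : ConjSpace V →ₗ[ℂ] ConjSpace W where
  toFun v := mk (f (mk.symm v))
  map_add' v w := by simp
  map_smul' c v := (congrArg mk (f.map_smul (starRingEnd ℂ c) (mk.symm v)))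

theorem map_mk (f : V →ₗ[ℂ] W) (v : V) : map f (mk v) = mk (f v) := rfl

instance [Module.Finite ℂ V] : Module.Finite ℂ (ConjSpace V) := by
  obtain ⟨s, hs⟩ := (Module.Finite.fg_top : (⊤ : Submodule ℂ V).FG)
  classical
  refine ⟨⟨s.image mk, eq_top_iff.2 fun v _ => ?_⟩⟩
  obtain ⟨v, rfl⟩ := mk.surjective v
  have hv : v ∈ Submodule.span ℂ (s : Set V) := hs ▸ trivial
  induction hv using Submodule.span_induction with
  | mem x h => exact Submodule.subset_span (by simpa using h)
  | zero => rw [map_zero]; exact Submodule.zero_mem _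
  | add x y _ _ hx hy => rw [map_add]; exact Submodule.add_mem _ (hx trivial) (hy trivial)
  | smul c x _ hx => rw [mk_smul]; exact Submodule.smul_mem _ _ (hx trivial)

/-- The conjugate of the scalars. -/
def one : ℂ ≃ₗ[ℂ] ConjSpace ℂ where
  toFun z := mk (starRingEnd ℂ z)
  map_add' x y := by simp
  map_smul' c x := by simp [smul_mk]
  invFun z := starRingEnd ℂ (mk.symm z)
  left_inv z := by simp
  right_inv z := by simp

/-- The double conjugate is the space itself. -/
def conjConj (V : Type) [AddCommGroup V] [Module ℂ V] : ConjSpace (ConjSpace V) ≃ₗ[ℂ] V where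
  toFun v := mk.symm (mk.symm v)
  map_add' _ _ := by simp
  map_smul' c v := by
    obtain ⟨v, rfl⟩ := mk.surjective v
    obtain ⟨v, rfl⟩ := mk.surjective v
    simp [smul_mk]
  invFun v := mk (mk v)
  left_inv _ := by simp
  right_inv _ := by simp

variable (V W)

/-- The comparison map `v ⊗ w ↦ v ⊗ w`. -/
def tenTo : ConjSpace V ⊗[ℂ] ConjSpace W →ₗ[ℂ] ConjSpace (V ⊗[ℂ] W) :=
  TensorProduct.lift (LinearMap.mk₂ ℂ (fun v w => mk (mk.symm v ⊗ₜ[ℂ] mk.symm w))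
    (fun _ _ _ => by simp [TensorProduct.add_tmul])
    (fun c v w => by
      obtain ⟨v, rfl⟩ := mk.surjective v
      simp [smul_mk, ← TensorProduct.smul_tmul'])
    (fun _ _ _ => by simp [TensorProduct.tmul_add])
    (fun c v w => by
      obtain ⟨w, rfl⟩ := mk.surjective w
      simp [smul_mk]))

/-- The inverse comparison map `v ⊗ w ↦ v ⊗ w`. -/
def tenFrom : V ⊗[ℂ] W →ₗ[ℂ] ConjSpace (ConjSpace V ⊗[ℂ] ConjSpace W) :=
  TensorProduct.lift (LinearMap.mk₂ ℂ (fun v w => mk (mk v ⊗ₜ[ℂ] mk w))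
    (fun _ _ _ => by simp [TensorProduct.add_tmul])
    (fun c v w => by rw [mk_smul, ← TensorProduct.smul_tmul', mk_smul, Complex.conj_conj])
    (fun _ _ _ => by simp [TensorProduct.tmul_add])
    (fun c v w => by rw [mk_smul, TensorProduct.tmul_smul, mk_smul, Complex.conj_conj]))

/-- Conjugation commutes with tensor products. -/
def ten : ConjSpace V ⊗[ℂ] ConjSpace W ≃ₗ[ℂ] ConjSpace (V ⊗[ℂ] W) :=
  { tenTo V W with
    invFun := fun x => mk.symm (tenFrom V W (mk.symm x))
    left_inv := fun x => by
      change mk.symm (tenFrom V W (mk.symm (tenTo V W x))) = x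
      induction x using TensorProduct.induction_on with
      | zero => simp
      | add x y hx hy => simp only [map_add, hx, hy]
      | tmul x y => simp [tenTo, tenFrom]
    right_inv := fun x => by
      change tenTo V W (mk.symm (tenFrom V W (mk.symm x))) = x
      obtain ⟨x, rfl⟩ := mk.surjective x
      rw [AddEquiv.symm_apply_apply]
      induction x using TensorProduct.induction_on with
      | zero => simp
      | add x y hx hy => simp only [map_add, hx, hy]
      | tmul x y => simp [tenTo, tenFrom] }

theorem ten_tmul (v : V) (w : W) : ten V W (mk v ⊗ₜ[ℂ] mk w) = mk (v ⊗ₜ[ℂ] w) := rfl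

theorem ten_symm_mk (v : V) (w : W) : (ten V W).symm (mk (v ⊗ₜ[ℂ] w)) = mk v ⊗ₜ[ℂ] mk w := by
  rw [LinearEquiv.symm_apply_eq]; rfl

end

end ConjSpace

/-- Complex conjugation of vector spaces. -/
def conjFun : FGModuleCat.{0} ℂ ⥤ FGModuleCat.{0} ℂ where
  obj V := FGModuleCat.of ℂ (ConjSpace V)
  map f := FGModuleCat.ofHom (ConjSpace.map f.hom.hom)

/-- The double conjugate of a vector space is the space itself. -/
def conjConj (V : FGModuleCat.{0} ℂ) : conjFun.obj (conjFun.obj V) ≅ V :=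
  LinearEquiv.toFGModuleCatIso (ConjSpace.conjConj V)

/-- Conjugation of the tensor unit. -/
def conjOne : 𝟙_ (FGModuleCat.{0} ℂ) ≅ conjFun.obj (𝟙_ _) :=
  LinearEquiv.toFGModuleCatIso ConjSpace.one

/-- Conjugation of a tensor product. -/
def conjTen (V W : FGModuleCat.{0} ℂ) : conjFun.obj V ⊗ conjFun.obj W ≅ conjFun.obj (V ⊗ W) :=
  LinearEquiv.toFGModuleCatIso (ConjSpace.ten V W)

instance : conjFun.Monoidal :=
  Functor.CoreMonoidal.toMonoidal
    { εIso := conjOne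
      μIso := conjTen
      μIso_hom_natural_left := fun f X => by
        ext : 1; apply TensorProduct.ext'; intro v w; rfl
      μIso_hom_natural_right := fun X f => by
        ext : 1; apply TensorProduct.ext'; intro v w; rfl
      associativity := fun X Y Z => by
        ext : 1; apply TensorProduct.ext_threefold; intro v w z; rfl
      left_unitality := fun X => by
        ext : 1; apply TensorProduct.ext'; intro v w; rfl
      right_unitality := fun X => by
        ext : 1; apply TensorProduct.ext'; intro w v; rfl }

instance : conjFun.Braided where
  braided X Y := by
    ext : 1; apply TensorProduct.ext'; intro v w; rfl

namespace VBun

variable {U : Cart}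

/-- The conjugate functional. -/
def covConj {V : FGModuleCat.{0} ℂ} (f : V →ₗ[ℂ] ℂ) : conjFun.obj V →ₗ[ℂ] ℂ :=
  (ConjSpace.one.symm.toLinearMap ∘ₗ (ConjSpace.map f : ConjSpace V →ₗ[ℂ] ConjSpace ℂ) :
    ConjSpace V →ₗ[ℂ] ℂ)

/-- An element of a space, seen as an element of the conjugate space. -/
def eltConj {V : FGModuleCat.{0} ℂ} (v : V) : conjFun.obj V := ConjSpace.mk (v : V)

theorem covConj_eltConj {V : FGModuleCat.{0} ℂ} (f : V →ₗ[ℂ] ℂ) (v : V) :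
    covConj f (eltConj v) = starRingEnd ℂ (f v) := rfl

theorem eltConj_surj {V : FGModuleCat.{0} ℂ} (w : conjFun.obj V) : ∃ v : V, eltConj v = w :=
  ⟨ConjSpace.mk.symm w, rfl⟩

theorem eltConj_smul {V : FGModuleCat.{0} ℂ} (c : ℂ) (v : V) :
    c • eltConj v = eltConj (starRingEnd ℂ c • v) := rfl

theorem eltConj_sum {V : FGModuleCat.{0} ℂ} {κ : Type} [Fintype κ] (v : κ → V) :
    ∑ a, eltConj (v a) = eltConj (∑ a, v a) :=
  (map_sum (ConjSpace.mk (V := V)) v Finset.univ).symm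

/-- The conjugate vector bundle. -/
def conjObj (E : VBun U) : VBun U where
  fib x := conjFun.obj (E.fib x)
  ι := E.ι
  κ := E.κ
  fin := E.fin
  dom := E.dom
  dom_open := E.dom_open
  cover := E.cover
  vec i a x := eltConj (E.vec i a x)
  cov i a x := covConj (E.cov i a x)
  dual i x hx a b := by
    rw [covConj_eltConj, E.dual i x hx]
    split_ifs <;> simp
  span i x hx w := by
    obtain ⟨v, rfl⟩ := eltConj_surj w
    simp only [covConj_eltConj, eltConj_smul, Complex.conj_conj, eltConj_sum]
    rw [E.span i x hx]
  smooth i j a b x hi hj := (E.smooth i j a b x hi hj).conj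

/-- Conjugation of vector bundles. -/
def conj (U : Cart) : VBun U ⥤ VBun U where
  obj := conjObj
  map φ := ⟨fun x => conjFun.map (φ.map x), fun i j a b x hi hj => (φ.smooth i j a b x hi hj).conj⟩
  map_id E := by ext x : 1; exact conjFun.map_id _
  map_comp f g := by ext x : 1; exact conjFun.map_comp _ _

/-- The double conjugate of a vector bundle is the bundle itself. -/
def conjConj (E : VBun U) : (conj U).obj ((conj U).obj E) ≅ E :=
  isoMk (fun x => _root_.conjConj (E.fib x))
    (fun i j a b x hi hj => E.smooth i j a b x hi hj)
    (fun i j a b x hi hj => (E.smooth i j a b x hi hj).conj.conj)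

theorem conjTen_hom_elt {V W : FGModuleCat.{0} ℂ} (v : V) (w : W) :
    (conjTen V W).hom.hom.hom (elt (eltConj v) (eltConj w)) = eltConj (elt v w) :=
  ConjSpace.ten_tmul (V := V) (W := W) v w

theorem conjTen_inv_elt {V W : FGModuleCat.{0} ℂ} (v : V) (w : W) :
    (conjTen V W).inv.hom.hom (eltConj (elt v w)) = elt (eltConj v) (eltConj w) :=
  ConjSpace.ten_symm_mk (V := V) (W := W) v w

/-- Conjugation of the trivial line bundle. -/
def conjUnitIso (U : Cart) : 𝟙_ (VBun U) ≅ (conj U).obj (𝟙_ (VBun U)) :=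
  isoMk (fun _ => conjOne)
    (fun _ _ _ _ x _ _ => (Cart.smoothAt_const 1 x).congr isOpen_univ trivial
      fun _ _ => Complex.conj_conj 1)
    (fun _ _ _ _ x _ _ => (Cart.smoothAt_const 1 x).congr isOpen_univ trivial
      fun _ _ => map_one (starRingEnd ℂ))

/-- Conjugation of a tensor product of vector bundles. -/
def conjTenIso (E F : VBun U) : (conj U).obj E ⊗ (conj U).obj F ≅ (conj U).obj (E ⊗ F) :=
  isoMk (fun x => conjTen (E.fib x) (F.fib x))
    (fun i j a b x hi hj => by
      refine ((tensor E F).smooth i j a b x hi hj).conj.congr isOpen_univ trivial fun y _ => ?_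
      have := conjTen_hom_elt (E.vec i.1 a.1 y) (F.vec i.2 a.2 y)
      exact (congrArg (covConj ((tensor E F).cov j b y)) this).trans (covConj_eltConj _ _))
    (fun i j a b x hi hj => by
      refine ((tensor (conjObj E) (conjObj F)).smooth i j a b x hi hj).congr isOpen_univ trivial
        fun y _ => ?_
      have := conjTen_inv_elt (E.vec i.1 a.1 y) (F.vec i.2 a.2 y)
      exact congrArg ((tensor (conjObj E) (conjObj F)).cov j b y) this)

instance : (conj U).Monoidal :=
  Functor.CoreMonoidal.toMonoidal
    { εIso := conjUnitIso U
      μIso := conjTenIso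
      μIso_hom_natural_left := fun f X => by
        ext x : 1; exact Functor.LaxMonoidal.μ_natural_left conjFun (f.map x) (X.fib x)
      μIso_hom_natural_right := fun X f => by
        ext x : 1; exact Functor.LaxMonoidal.μ_natural_right conjFun (X.fib x) (f.map x)
      associativity := fun X Y Z => by
        ext x : 1; exact Functor.LaxMonoidal.associativity conjFun (X.fib x) (Y.fib x) (Z.fib x)
      left_unitality := fun X => by
        ext x : 1; exact Functor.LaxMonoidal.left_unitality conjFun (X.fib x)
      right_unitality := fun X => by
        ext x : 1; exact Functor.LaxMonoidal.right_unitality conjFun (X.fib x) }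

instance : (conj U).Braided where
  braided E F := by
    ext x : 1; exact Functor.LaxBraided.braided (F := conjFun) (E.fib x) (F.fib x)

end VBun

end Bundles

section Geometry

open scoped ContDiff Manifold Topology

/-! ### Orientations -/

/-- `L` is invertible and carries the orientation `o` to the orientation `o'`. -/
def OrMap {k : ℕ} {E F : Type} [NormedAddCommGroup E] [NormedSpace ℝ E] [NormedAddCommGroup F]
    [NormedSpace ℝ F] (L : E →L[ℝ] F) (o : Orientation ℝ E (Fin k)) (o' : Orientation ℝ F (Fin k)) :
    Prop :=
  ∃ e : E ≃ₗ[ℝ] F, (∀ v, e v = L v) ∧ Orientation.map (Fin k) e o = o'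

namespace OrMap

variable {k : ℕ} {E F G : Type} [NormedAddCommGroup E] [NormedSpace ℝ E] [NormedAddCommGroup F]
  [NormedSpace ℝ F] [NormedAddCommGroup G] [NormedSpace ℝ G]

theorem map_map (e : E ≃ₗ[ℝ] F) (f : F ≃ₗ[ℝ] G) (o : Orientation ℝ E (Fin k)) :
    Orientation.map (Fin k) f (Orientation.map (Fin k) e o) = Orientation.map (Fin k) (e.trans f) o := by
  induction o using Module.Ray.ind with
  | _ v hv => simp only [Orientation.map_apply]; rfl

theorem refl (o : Orientation ℝ E (Fin k)) : OrMap (ContinuousLinearMap.id ℝ E) o o :=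
  ⟨LinearEquiv.refl ℝ E, fun _ => rfl, by simp⟩

theorem comp {L : E →L[ℝ] F} {M : F →L[ℝ] G} {o : Orientation ℝ E (Fin k)} {o'} {o''}
    (hM : OrMap M o' o'') (hL : OrMap L o o') : OrMap (M.comp L) o o'' := by
  obtain ⟨e, he, rfl⟩ := hL
  obtain ⟨f, hf, rfl⟩ := hM
  exact ⟨e.trans f, fun v => by simp [he, hf], (map_map e f o).symm⟩

theorem of_comp {L : E →L[ℝ] F} {M : F →L[ℝ] G} {o : Orientation ℝ E (Fin k)} {o'} {o''}
    (hM : OrMap M o' o'') (h : OrMap (M.comp L) o o'') : OrMap L o o' := by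
  obtain ⟨e, he, rfl⟩ := hM
  obtain ⟨f, hf, hfo⟩ := h
  refine ⟨f.trans e.symm, fun v => ?_, ?_⟩
  · rw [LinearEquiv.trans_apply, LinearEquiv.symm_apply_eq, hf, he]; rfl
  · rw [← map_map, hfo, map_map]; simp

theorem neg {L : E →L[ℝ] F} {o : Orientation ℝ E (Fin k)} {o'} (h : OrMap L o o') :
    OrMap L (-o) (-o') := by
  obtain ⟨e, he, rfl⟩ := h
  exact ⟨e, he, Orientation.map_neg e o⟩

theorem inverse {L : E →L[ℝ] F} {M : F →L[ℝ] E} {o : Orientation ℝ E (Fin k)} {o'}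
    (h : OrMap L o o') (hM : ∀ v, M (L v) = v) : OrMap M o' o := by
  obtain ⟨e, he, rfl⟩ := h
  refine ⟨e.symm, fun v => ?_, by rw [map_map]; simp⟩
  obtain ⟨u, rfl⟩ := e.surjective v
  rw [e.symm_apply_apply, he, hM]

end OrMap

/-- A pointwise orientation `o` of a manifold (where the tangent spaces are identified with the
model vector space by the preferred charts) is continuous: near each point some smooth map to the
model space carries it to a constant orientation. -/
def OrCont {k : ℕ} {E H M : Type} [NormedAddCommGroup E] [NormedSpace ℝ E] [TopologicalSpace H]
    (J : ModelWithCorners ℝ E H) [TopologicalSpace M] [ChartedSpace H M]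
    (o : M → Orientation ℝ E (Fin k)) : Prop :=
  ∀ p, ∃ (φ : M → E) (c : Orientation ℝ E (Fin k)), ContMDiffAt J 𝓘(ℝ, E) ∞ φ p ∧
    ∀ᶠ q in 𝓝 p, OrMap (E := E) (F := E) (mfderiv J 𝓘(ℝ, E) φ q) (o q) c

/-- The map `φ` is smooth at `p` and its differential carries `o p` to `o' (φ p)`. -/
def OrPres {k : ℕ} {E H M E' H' M' : Type} [NormedAddCommGroup E] [NormedSpace ℝ E]
    [TopologicalSpace H] (J : ModelWithCorners ℝ E H) [TopologicalSpace M] [ChartedSpace H M]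
    [NormedAddCommGroup E'] [NormedSpace ℝ E']
    [TopologicalSpace H'] (J' : ModelWithCorners ℝ E' H') [TopologicalSpace M'] [ChartedSpace H' M']
    (o : M → Orientation ℝ E (Fin k)) (o' : M' → Orientation ℝ E' (Fin k)) (φ : M → M') (p : M) :
    Prop :=
  OrMap (E := E) (F := E') (mfderiv J J' φ p) (o p) (o' (φ p))

/-! ### Objects -/

/-- The model vector space of `Y`. -/
abbrev EY (n : ℕ) : Type := EuclideanSpace ℝ (Fin n)

/-- The model of `ℝ × Y`. -/
abbrev IC (n : ℕ) [NeZero n] : ModelWithCorners ℝ (ℝ × EY n) (ModelProd ℝ (EuclideanHalfSpace n)) :=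
  𝓘(ℝ, ℝ).prod (𝓡∂ n)

/-- A compact `n`-manifold `Y` with boundary, an orientation `orT` of its stabilised tangent bundle
`ℝ ⊕ TY`, an orientation `sgn` of `ℝ` for each component of `Y`, and brane labels `lab` on the
components of the boundary (`lab y = none` for interior points `y`). -/
structure OCObj (n : ℕ) [NeZero n] (I : Type) where
  Y : Type
  [top : TopologicalSpace Y]
  [charted : ChartedSpace (EuclideanHalfSpace n) Y]
  [mfd : IsManifold (𝓡∂ n) ∞ Y]
  [t2 : T2Space Y]
  [compact : CompactSpace Y]
  orT : Y → Orientation ℝ (ℝ × EY n) (Fin (n + 1))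
  orT_cont : OrCont (IC n) (fun p : ℝ × Y => orT p.2)
  sgn : Y → ℤˣ
  sgn_cont : IsLocallyConstant sgn
  lab : Y → Option I
  lab_iff : ∀ y, lab y ≠ none ↔ (𝓡∂ n).IsBoundaryPoint y
  lab_cont : ∀ y i, lab y = some i → ∀ᶠ z in 𝓝 y, lab z = some i ∨ lab z = none

attribute [instance] OCObj.top OCObj.charted OCObj.mfd OCObj.t2 OCObj.compact

namespace OCObj

variable {n : ℕ} [NeZero n] {I : Type}

theorem orCont_neg {k : ℕ} {E H M : Type} [NormedAddCommGroup E] [NormedSpace ℝ E]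
    [TopologicalSpace H]
    {J : ModelWithCorners ℝ E H} [TopologicalSpace M] [ChartedSpace H M]
    {o : M → Orientation ℝ E (Fin k)} (h : OrCont J o) : OrCont J (fun p => -o p) := by
  intro p
  obtain ⟨φ, c, hφ, hc⟩ := h p
  exact ⟨φ, -c, hφ, hc.mono fun q hq => hq.neg⟩

/-- The opposite object: `orT` is reversed. -/
def op (X : OCObj n I) : OCObj n I :=
  { X with orT := fun y => -X.orT y, orT_cont := orCont_neg X.orT_cont }

/-- The dual object: `sgn` is reversed. -/
def dual (X : OCObj n I) : OCObj n I :=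
  { X with sgn := fun y => -X.sgn y, sgn_cont := X.sgn_cont.comp (fun s => -s) }

attribute [local instance] ChartedSpace.empty in
/-- The empty object. -/
def empty (n : ℕ) [NeZero n] (I : Type) : OCObj n I where
  Y := Empty
  orT y := y.elim
  orT_cont p := p.2.elim
  sgn y := y.elim
  sgn_cont := IsLocallyConstant.of_discrete _
  lab y := y.elim
  lab_iff y := y.elim
  lab_cont y := y.elim

theorem isBoundaryPoint_inl {M M' : Type} [TopologicalSpace M] [ChartedSpace (EuclideanHalfSpace n) M]
    [TopologicalSpace M'] [ChartedSpace (EuclideanHalfSpace n) M'] (x : M) :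
    (𝓡∂ n).IsBoundaryPoint (Sum.inl x : M ⊕ M') ↔ (𝓡∂ n).IsBoundaryPoint x := by
  refine ⟨fun h => ?_, fun h => ModelWithCorners.boundaryPoint_inl x h⟩
  rw [ModelWithCorners.isBoundaryPoint_iff_not_isInteriorPoint] at h ⊢
  exact fun h' => h (ModelWithCorners.interiorPoint_inl x h')

theorem isBoundaryPoint_inr {M M' : Type} [TopologicalSpace M] [ChartedSpace (EuclideanHalfSpace n) M]
    [TopologicalSpace M'] [ChartedSpace (EuclideanHalfSpace n) M'] (x : M') :
    (𝓡∂ n).IsBoundaryPoint (Sum.inr x : M ⊕ M') ↔ (𝓡∂ n).IsBoundaryPoint x := by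
  refine ⟨fun h => ?_, fun h => ModelWithCorners.boundaryPoint_inr x h⟩
  rw [ModelWithCorners.isBoundaryPoint_iff_not_isInteriorPoint] at h ⊢
  exact fun h' => h (ModelWithCorners.interiorPoint_inr x h')

end OCObj

theorem OrMap.mdifferentiableAt {k : ℕ} {E H M E' H' M' : Type} [NormedAddCommGroup E]
    [NormedSpace ℝ E] [Nontrivial E]
    [TopologicalSpace H] {J : ModelWithCorners ℝ E H} [TopologicalSpace M] [ChartedSpace H M]
    [NormedAddCommGroup E'] [NormedSpace ℝ E']
    [TopologicalSpace H'] {J' : ModelWithCorners ℝ E' H'} [TopologicalSpace M'] [ChartedSpace H' M']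
    {φ : M → M'} {p : M} {o : Orientation ℝ E (Fin k)} {o' : Orientation ℝ E' (Fin k)}
    (h : OrMap (E := E) (F := E') (mfderiv J J' φ p) o o') : MDifferentiableAt J J' φ p := by
  by_contra hn
  obtain ⟨e, he, -⟩ := h
  rw [mfderiv_zero_of_not_mdifferentiableAt hn] at he
  obtain ⟨v, hv⟩ := exists_ne (0 : E)
  exact hv (e.map_eq_zero_iff.1 (he v))

section Sums

variable {E H M M' E' H' N : Type} [NormedAddCommGroup E] [NormedSpace ℝ E]
  [TopologicalSpace H] {J : ModelWithCorners ℝ E H} [TopologicalSpace M] [ChartedSpace H M]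
  [TopologicalSpace M'] [ChartedSpace H M'] [IsManifold J ∞ M] [IsManifold J ∞ M']
  [NormedAddCommGroup E'] [NormedSpace ℝ E']
  [TopologicalSpace H'] {J' : ModelWithCorners ℝ E' H'} [TopologicalSpace N] [ChartedSpace H' N]

theorem hasMFDerivAt_of_inl {h : M ⊕ M' → N} {x : M} (hd : MDifferentiableAt J J' h (Sum.inl x))
    {L : E →L[ℝ] E'} (hL : HasMFDerivAt J J' (h ∘ Sum.inl) x L) :
    HasMFDerivAt J J' h (Sum.inl x) L := by
  have h1 := hd.hasMFDerivAt.comp x (hasMFDerivAt_inl (I := J) (M' := M') (q := x) (p := Sum.inl x))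
  have := hasMFDerivAt_unique h1 hL
  have h2 := hd.hasMFDerivAt
  convert h2 using 1
  rw [← this]; rfl

theorem hasMFDerivAt_of_inr {h : M ⊕ M' → N} {x : M'} (hd : MDifferentiableAt J J' h (Sum.inr x))
    {L : E →L[ℝ] E'} (hL : HasMFDerivAt J J' (h ∘ Sum.inr) x L) :
    HasMFDerivAt J J' h (Sum.inr x) L := by
  have h1 := hd.hasMFDerivAt.comp x (hasMFDerivAt_inr (I := J) (M := M) (q' := x) (p := Sum.inr x))
  have := hasMFDerivAt_unique h1 hL
  have h2 := hd.hasMFDerivAt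
  convert h2 using 1
  rw [← this]; rfl

end Sums

theorem hasMFDerivAt_prodMap {E₁ H₁ M₁ F₁ K₁ N₁ E₂ H₂ M₂ F₂ K₂ N₂ : Type}
    [NormedAddCommGroup E₁] [NormedSpace ℝ E₁] [TopologicalSpace H₁] {J₁ : ModelWithCorners ℝ E₁ H₁}
    [TopologicalSpace M₁] [ChartedSpace H₁ M₁]
    [NormedAddCommGroup F₁] [NormedSpace ℝ F₁] [TopologicalSpace K₁] {J₁' : ModelWithCorners ℝ F₁ K₁}
    [TopologicalSpace N₁] [ChartedSpace K₁ N₁]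
    [NormedAddCommGroup E₂] [NormedSpace ℝ E₂] [TopologicalSpace H₂] {J₂ : ModelWithCorners ℝ E₂ H₂}
    [TopologicalSpace M₂] [ChartedSpace H₂ M₂]
    [NormedAddCommGroup F₂] [NormedSpace ℝ F₂] [TopologicalSpace K₂] {J₂' : ModelWithCorners ℝ F₂ K₂}
    [TopologicalSpace N₂] [ChartedSpace K₂ N₂]
    {f : M₁ → N₁} {g : M₂ → N₂} {p : M₁ × M₂} {L : E₁ →L[ℝ] F₁} {L' : E₂ →L[ℝ] F₂}
    (hf : HasMFDerivAt J₁ J₁' f p.1 L) (hg : HasMFDerivAt J₂ J₂' g p.2 L') :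
    HasMFDerivAt (J₁.prod J₂) (J₁'.prod J₂') (Prod.map f g) p (L.prodMap L') := by
  have := HasMFDerivAt.prodMap hf hg
  rwa [hf.mfderiv, hg.mfderiv] at this

namespace OCObj

variable {n : ℕ} [NeZero n] {I : Type}

theorem orCont_sum {M M' : Type} [TopologicalSpace M] [ChartedSpace (EuclideanHalfSpace n) M]
    [TopologicalSpace M'] [ChartedSpace (EuclideanHalfSpace n) M'] [IsManifold (𝓡∂ n) ∞ M]
    [IsManifold (𝓡∂ n) ∞ M']
    {o : M → Orientation ℝ (ℝ × EY n) (Fin (n + 1))} {o' : M' → Orientation ℝ (ℝ × EY n) (Fin (n + 1))}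
    (h : OrCont (IC n) (fun p : ℝ × M => o p.2)) (h' : OrCont (IC n) (fun p : ℝ × M' => o' p.2)) :
    OrCont (IC n) (fun p : ℝ × (M ⊕ M') => Sum.elim o o' p.2) := by
  rintro ⟨t, y | y⟩
  · obtain ⟨φ, c, hφ, hc⟩ := h (t, y)
    let r : M ⊕ M' → M := Sum.elim id (fun _ => y)
    have hr : ContMDiff (𝓡∂ n) (𝓡∂ n) ∞ r := ContMDiff.sumElim contMDiff_id contMDiff_const
    let R : ℝ × (M ⊕ M') → ℝ × M := Prod.map id r
    have hR : ContMDiff (IC n) (IC n) ∞ R := contMDiff_id.prodMap hr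
    refine ⟨φ ∘ R, c, ContMDiffAt.comp _ (by simpa [R, r] using hφ) hR.contMDiffAt, ?_⟩
    have hemb : Topology.IsOpenEmbedding (Prod.map id Sum.inl : ℝ × M → ℝ × (M ⊕ M')) :=
      Topology.IsOpenEmbedding.id.prodMap Topology.IsOpenEmbedding.inl
    have := hemb.map_nhds_eq (t, y)
    simp only [Prod.map_apply, id_eq] at this
    rw [← this, Filter.eventually_map]
    filter_upwards [hc] with ⟨s, z⟩ hq
    have hrz : HasMFDerivAt (𝓡∂ n) (𝓡∂ n) r (Sum.inl z) (ContinuousLinearMap.id ℝ (EY n)) :=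
      hasMFDerivAt_of_inl (hr.mdifferentiable (by simp) _) (hasMFDerivAt_id z)
    have hRz := hasMFDerivAt_prodMap (p := (s, Sum.inl z)) (hasMFDerivAt_id (I := 𝓘(ℝ, ℝ)) s) hrz
    have h3 := HasMFDerivAt.comp (I' := IC n) (s, Sum.inl z)
      (g := φ) (f := R) hq.mdifferentiableAt.hasMFDerivAt hRz
    change OrMap (mfderiv (IC n) 𝓘(ℝ, ℝ × EY n) (φ ∘ R) (s, Sum.inl z)) (o z) c
    rw [h3.mfderiv]
    exact hq
  · obtain ⟨φ, c, hφ, hc⟩ := h' (t, y)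
    let r : M ⊕ M' → M' := Sum.elim (fun _ => y) id
    have hr : ContMDiff (𝓡∂ n) (𝓡∂ n) ∞ r := ContMDiff.sumElim contMDiff_const contMDiff_id
    let R : ℝ × (M ⊕ M') → ℝ × M' := Prod.map id r
    have hR : ContMDiff (IC n) (IC n) ∞ R := contMDiff_id.prodMap hr
    refine ⟨φ ∘ R, c, ContMDiffAt.comp _ (by simpa [R, r] using hφ) hR.contMDiffAt, ?_⟩
    have hemb : Topology.IsOpenEmbedding (Prod.map id Sum.inr : ℝ × M' → ℝ × (M ⊕ M')) :=
      Topology.IsOpenEmbedding.id.prodMap Topology.IsOpenEmbedding.inr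
    have := hemb.map_nhds_eq (t, y)
    simp only [Prod.map_apply, id_eq] at this
    rw [← this, Filter.eventually_map]
    filter_upwards [hc] with ⟨s, z⟩ hq
    have hrz : HasMFDerivAt (𝓡∂ n) (𝓡∂ n) r (Sum.inr z) (ContinuousLinearMap.id ℝ (EY n)) :=
      hasMFDerivAt_of_inr (hr.mdifferentiable (by simp) _) (hasMFDerivAt_id z)
    have hRz := hasMFDerivAt_prodMap (p := (s, Sum.inr z)) (hasMFDerivAt_id (I := 𝓘(ℝ, ℝ)) s) hrz
    have h3 := HasMFDerivAt.comp (I' := IC n) (s, Sum.inr z)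
      (g := φ) (f := R) hq.mdifferentiableAt.hasMFDerivAt hRz
    change OrMap (mfderiv (IC n) 𝓘(ℝ, ℝ × EY n) (φ ∘ R) (s, Sum.inr z)) (o' z) c
    rw [h3.mfderiv]
    exact hq

/-- The disjoint union of objects. -/
def sum (X X' : OCObj n I) : OCObj n I where
  Y := X.Y ⊕ X'.Y
  orT := Sum.elim X.orT X'.orT
  orT_cont := orCont_sum X.orT_cont X'.orT_cont
  sgn := Sum.elim X.sgn X'.sgn
  sgn_cont := by
    rw [IsLocallyConstant.iff_eventually_eq]
    rintro (y | y)
    · rw [← Topology.IsOpenEmbedding.inl.map_nhds_eq, Filter.eventually_map]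
      exact (X.sgn_cont.eventually_eq y)
    · rw [← Topology.IsOpenEmbedding.inr.map_nhds_eq, Filter.eventually_map]
      exact (X'.sgn_cont.eventually_eq y)
  lab := Sum.elim X.lab X'.lab
  lab_iff := by
    rintro (y | y)
    · rw [isBoundaryPoint_inl]; exact X.lab_iff y
    · rw [isBoundaryPoint_inr]; exact X'.lab_iff y
  lab_cont := by
    rintro (y | y) i h
    · rw [← Topology.IsOpenEmbedding.inl.map_nhds_eq, Filter.eventually_map]
      exact X.lab_cont y i h
    · rw [← Topology.IsOpenEmbedding.inr.map_nhds_eq, Filter.eventually_map]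
      exact X'.lab_cont y i h

end OCObj

/-! ### Bordisms -/

/-- The model vector space of `d`-dimensional manifolds with corners of index at most two. -/
abbrev ES (n : ℕ) : Type := EuclideanSpace ℝ (Fin 1) × EY n

/-- The model of `d`-dimensional manifolds with corners of index at most two: the quadrant
`[0, ∞)² × ℝ^(n-1)`. -/
abbrev IS (n : ℕ) [NeZero n] :
    ModelWithCorners ℝ (ES n) (ModelProd (EuclideanHalfSpace 1) (EuclideanHalfSpace n)) :=
  (𝓡∂ 1).prod (𝓡∂ n)

/-- A compact oriented `(n+1)`-manifold `S` with corners whose boundary is decomposed into the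
faces `∂₀ = face 0`, `∂₁ = face 1` and `∂₂ = {lab ≠ none}`, such that `∂₀` and `∂₁` are disjoint
and all corners are corners of `∂₀ ∩ ∂₂` or of `∂₁ ∩ ∂₂`. The function `lab` gives the brane
labels of the components of `∂₂`. -/
structure OCMfd (n : ℕ) [NeZero n] (I : Type) where
  S : Type
  [top : TopologicalSpace S]
  [charted : ChartedSpace (ModelProd (EuclideanHalfSpace 1) (EuclideanHalfSpace n)) S]
  [mfd : IsManifold (IS n) ∞ S]
  [t2 : T2Space S]
  [compact : CompactSpace S]
  or : S → Orientation ℝ (ES n) (Fin (n + 1))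
  or_cont : OrCont (IS n) or
  face : Fin 2 → Set S
  lab : S → Option I
  lab_cont : ∀ p i, lab p = some i → ∀ᶠ q in 𝓝 p, lab q = some i ∨ lab q = none
  corner : ∀ p, ∃ a : Fin 2, ∃ e ∈ IsManifold.maximalAtlas (IS n) ∞ S, p ∈ e.source ∧
    ∀ᶠ q in 𝓝 p, (q ∈ face a ↔ (e q).1.1 0 = 0) ∧ (∀ b, b ≠ a → q ∉ face b) ∧
      (lab q ≠ none ↔ (e q).2.1 0 = 0)

attribute [instance] OCMfd.top OCMfd.charted OCMfd.mfd OCMfd.t2 OCMfd.compact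

namespace OCObj

variable {n : ℕ} [NeZero n] {I : Type}

/-- The half cylinder `C_+ Y` (for `s = 1`) or `C_- Y` (for `s = -1`), as a subset of `ℝ × Y`. -/
def cone (X : OCObj n I) (s : ℤˣ) : Set (ℝ × X.Y) := {p | 0 ≤ (((s * X.sgn p.2 : ℤˣ) : ℤ) : ℝ) * p.1}

/-- Open neighbourhoods of `{0} × Y` in the half cylinder. -/
def IsNbhd (X : OCObj n I) (s : ℤˣ) (W : Set (ℝ × X.Y)) : Prop :=
  (∃ O : Set (ℝ × X.Y), IsOpen O ∧ W = O ∩ X.cone s) ∧ ∀ y, ((0 : ℝ), y) ∈ W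

theorem IsNbhd.inter {X : OCObj n I} {s : ℤˣ} {W W' : Set (ℝ × X.Y)} (h : X.IsNbhd s W)
    (h' : X.IsNbhd s W') : X.IsNbhd s (W ∩ W') := by
  obtain ⟨⟨O, hO, rfl⟩, h0⟩ := h
  obtain ⟨⟨O', hO', rfl⟩, h0'⟩ := h'
  refine ⟨⟨O ∩ O', hO.inter hO', ?_⟩, fun y => ⟨h0 y, h0' y⟩⟩
  ext p; simp only [Set.mem_inter_iff]; tauto

end OCObj

/-- A collar of the face `a` of `M`: an orientation and label preserving smooth open embedding `w` of
an open neighbourhood `W` of `{0} × Y` in a half cylinder, with `w ({0} × Y) = ∂ₐ`. -/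
structure Collar {n : ℕ} [NeZero n] {I : Type} (X : OCObj n I) (s : ℤˣ) (M : OCMfd n I)
    (a : Fin 2) where
  W : Set (ℝ × X.Y)
  nbhd : X.IsNbhd s W
  w : ℝ × X.Y → M.S
  smooth : ContMDiffOn (IC n) (IS n) ∞ w W
  inj : Set.InjOn w W
  inv : ∀ p ∈ W, ∃ r : M.S → ℝ × X.Y, ContMDiffAt (IS n) (IC n) ∞ r (w p) ∧
    ∀ᶠ q in 𝓝 (w p), r q ∈ W ∧ w (r q) = q
  orient : ∀ p ∈ W, p.1 ≠ 0 → OrPres (IC n) (IS n) (fun p => X.orT p.2) M.or w p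
  lab_w : ∀ p ∈ W, M.lab (w p) = X.lab p.2
  face_eq : M.face a = Set.range (fun y => w (0, y))

/-- A bordism from `X` to `X'` with collars. -/
structure Tup {n : ℕ} [NeZero n] {I : Type} (X X' : OCObj n I) where
  M : OCMfd n I
  c₀ : Collar X 1 M 0
  c₁ : Collar X' (-1) M 1
  disj : Disjoint (c₀.w '' c₀.W) (c₁.w '' c₁.W)

section Op

variable {n : ℕ} [NeZero n] {I : Type}

/-- Orientation reversal. -/
def OCMfd.op (M : OCMfd n I) : OCMfd n I :=
  { M with or := fun p => -M.or p, or_cont := OCObj.orCont_neg M.or_cont }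

/-- Orientation reversal. -/
def Collar.op {X : OCObj n I} {s : ℤˣ} {M : OCMfd n I} {a : Fin 2} (c : Collar X s M a) :
    Collar X.op s M.op a :=
  { W := c.W
    nbhd := c.nbhd
    w := c.w
    smooth := c.smooth
    inj := c.inj
    inv := c.inv
    orient := fun p hp h => (c.orient p hp h).neg
    lab_w := c.lab_w
    face_eq := c.face_eq }

/-- The opposite bordism. -/
def Tup.op {X X' : OCObj n I} (T : Tup X X') : Tup X.op X'.op where
  M := T.M.op
  c₀ := T.c₀.op
  c₁ := T.c₁.op
  disj := T.disj

end Op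

/-! ### Cylinders -/

section LocalDiffeo

variable {E H M M' E' H' N : Type} [NormedAddCommGroup E] [NormedSpace ℝ E]
  [TopologicalSpace H] {J : ModelWithCorners ℝ E H} [TopologicalSpace M] [ChartedSpace H M]
  [TopologicalSpace M'] [ChartedSpace H M']
  [NormedAddCommGroup E'] [NormedSpace ℝ E']
  [TopologicalSpace H'] {J' : ModelWithCorners ℝ E' H'} [TopologicalSpace N] [ChartedSpace H' N]

/-- The inclusion of the first summand as a partial diffeomorphism. -/
def inlPD (J : ModelWithCorners ℝ E H) (M' : Type) [TopologicalSpace M'] [ChartedSpace H M'] (x : M) :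
    PartialDiffeomorph J J M (M ⊕ M') ∞ where
  toFun := Sum.inl
  invFun := Sum.elim id (fun _ => x)
  source := Set.univ
  target := Set.range Sum.inl
  map_source' y _ := ⟨y, rfl⟩
  map_target' _ _ := trivial
  left_inv' _ _ := rfl
  right_inv' := by rintro _ ⟨y, rfl⟩; rfl
  open_source := isOpen_univ
  open_target := isOpen_range_inl
  contMDiffOn_toFun := ContMDiff.inl.contMDiffOn
  contMDiffOn_invFun := (ContMDiff.sumElim contMDiff_id contMDiff_const).contMDiffOn

/-- The inclusion of the second summand as a partial diffeomorphism. -/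
def inrPD (J : ModelWithCorners ℝ E H) (M : Type) [TopologicalSpace M] [ChartedSpace H M] (x : M') :
    PartialDiffeomorph J J M' (M ⊕ M') ∞ where
  toFun := Sum.inr
  invFun := Sum.elim (fun _ => x) id
  source := Set.univ
  target := Set.range Sum.inr
  map_source' y _ := ⟨y, rfl⟩
  map_target' _ _ := trivial
  left_inv' _ _ := rfl
  right_inv' := by rintro _ ⟨y, rfl⟩; rfl
  open_source := isOpen_univ
  open_target := isOpen_range_inr
  contMDiffOn_toFun := ContMDiff.inr.contMDiffOn
  contMDiffOn_invFun := (ContMDiff.sumElim contMDiff_const contMDiff_id).contMDiffOn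

theorem isLocalDiffeomorph_inl : IsLocalDiffeomorph J J ∞ (Sum.inl : M → M ⊕ M') :=
  fun x => ⟨inlPD J M' x, trivial, fun _ _ => rfl⟩

theorem isLocalDiffeomorph_inr : IsLocalDiffeomorph J J ∞ (Sum.inr : M' → M ⊕ M') :=
  fun x => ⟨inrPD J M x, trivial, fun _ _ => rfl⟩

theorem isLocalDiffeomorph_sumElim {f : M → N} {g : M' → N} (hf : IsLocalDiffeomorph J J' ∞ f)
    (hg : IsLocalDiffeomorph J J' ∞ g) : IsLocalDiffeomorph J J' ∞ (Sum.elim f g) := by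
  rintro (x | x)
  · obtain ⟨Φ, hx, hΦ⟩ := hf x
    refine ⟨(inlPD J M' x).symm.trans Φ, ⟨⟨x, rfl⟩, hx⟩, ?_⟩
    rintro _ ⟨⟨y, rfl⟩, hy⟩
    exact hΦ hy
  · obtain ⟨Φ, hx, hΦ⟩ := hg x
    refine ⟨(inrPD J M x).symm.trans Φ, ⟨⟨x, rfl⟩, hx⟩, ?_⟩
    rintro _ ⟨⟨y, rfl⟩, hy⟩
    exact hΦ hy

end LocalDiffeo

/-- The cylinder `[0, 1]`. -/
abbrev Int01 : Type := Set.Icc (0 : ℝ) 1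

/-- The differential of the inclusion `[0, 1] → ℝ`. -/
def valD (σ : Int01) : EuclideanSpace ℝ (Fin 1) →L[ℝ] ℝ :=
  mfderiv (𝓡∂ 1) 𝓘(ℝ, ℝ) (Subtype.val : Int01 → ℝ) σ

theorem hasMFDerivAt_val (σ : Int01) :
    HasMFDerivAt (𝓡∂ 1) 𝓘(ℝ, ℝ) (Subtype.val : Int01 → ℝ) σ (valD σ) :=
  ((contMDiff_subtypeVal_Icc (n := 1) σ).mdifferentiableAt one_ne_zero).hasMFDerivAt

/-- The differential of the inclusion `[0, 1] → ℝ` is an isomorphism. -/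
def valE (σ : Int01) : EuclideanSpace ℝ (Fin 1) ≃ₗ[ℝ] ℝ :=
  LinearMap.linearEquivOfInjective (valD σ).toLinearMap (by
    have hs : Function.Surjective (valD σ).toLinearMap := fun c => by
      refine ⟨c • (1 : TangentSpace (𝓡∂ 1) σ), ?_⟩
      have := mfderiv_subtypeVal_Icc_one (x := 0) (y := 1) σ
      change valD σ (c • (1 : TangentSpace (𝓡∂ 1) σ)) = c
      have h1 : valD σ (1 : TangentSpace (𝓡∂ 1) σ) = (1 : ℝ) := this
      refine ((valD σ).map_smul c (1 : TangentSpace (𝓡∂ 1) σ)).trans ?_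
      rw [h1]; simp
    exact (LinearMap.injective_iff_surjective_of_finrank_eq_finrank (by simp)).2 hs) (by simp)

theorem valE_apply (σ : Int01) (v : EuclideanSpace ℝ (Fin 1)) : valE σ v = valD σ v := rfl

namespace OCObj

variable {n : ℕ} [NeZero n] {I : Type} (B : OCObj n I)

/-- The orientation of `[0, 1] × Y` induced by the inclusion into `ℝ × Y`. -/
def cylOr (p : Int01 × B.Y) : Orientation ℝ (ES n) (Fin (n + 1)) :=
  Orientation.map (Fin (n + 1)) ((valE p.1).prodCongr (LinearEquiv.refl ℝ (EY n))).symm (B.orT p.2)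

/-- The inclusion `[0, 1] × Y → ℝ × Y`. -/
def cylIncl (p : Int01 × B.Y) : ℝ × B.Y := Prod.map Subtype.val id p

theorem hasMFDerivAt_cylIncl (p : Int01 × B.Y) : HasMFDerivAt (IS n) (IC n) B.cylIncl p
    ((valD p.1).prodMap (ContinuousLinearMap.id ℝ (EY n))) :=
  hasMFDerivAt_prodMap (hasMFDerivAt_val p.1) (hasMFDerivAt_id p.2)

theorem contMDiff_cylIncl : ContMDiff (IS n) (IC n) ∞ B.cylIncl :=
  contMDiff_subtypeVal_Icc.prodMap contMDiff_id

theorem orMap_cylIncl (p : Int01 × B.Y) :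
    OrMap ((valD p.1).prodMap (ContinuousLinearMap.id ℝ (EY n))) (B.cylOr p) (B.orT p.2) :=
  ⟨(valE p.1).prodCongr (LinearEquiv.refl ℝ (EY n)), fun _ => rfl, by
    rw [cylOr, OrMap.map_map, LinearEquiv.symm_trans_self, Orientation.map_refl]; rfl⟩

theorem cylOr_cont : OrCont (IS n) B.cylOr := by
  intro p
  obtain ⟨ψ, c, hψ, hc⟩ := B.orT_cont (B.cylIncl p)
  let e : ℝ ≃L[ℝ] EuclideanSpace ℝ (Fin 1) := (PiLp.equivOfUnique 2 ℝ (fun (_ : Fin 1) ↦ ℝ)).symm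
  let L : (ℝ × EY n) ≃L[ℝ] ES n := e.prodCongr (ContinuousLinearEquiv.refl ℝ (EY n))
  refine ⟨L ∘ ψ ∘ B.cylIncl, Orientation.map (Fin (n + 1)) L.toLinearEquiv c,
    L.contDiff.contMDiff.contMDiffAt.comp p (hψ.comp p B.contMDiff_cylIncl.contMDiffAt), ?_⟩
  filter_upwards [B.contMDiff_cylIncl.continuous.continuousAt.eventually hc] with q hq
  have h1 := HasMFDerivAt.comp (I' := IC n) q (g := ψ) (f := B.cylIncl)
    hq.mdifferentiableAt.hasMFDerivAt (B.hasMFDerivAt_cylIncl q)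
  have h2 : HasMFDerivAt 𝓘(ℝ, ℝ × EY n) 𝓘(ℝ, ES n) L (ψ (B.cylIncl q)) (L : (ℝ × EY n) →L[ℝ] ES n) :=
    L.hasFDerivAt.hasMFDerivAt
  have h3 := HasMFDerivAt.comp (I' := 𝓘(ℝ, ℝ × EY n)) q h2 h1
  rw [h3.mfderiv]
  exact OrMap.comp (o' := c) ⟨L.toLinearEquiv, fun _ => rfl, rfl⟩ (hq.comp (B.orMap_cylIncl q))

theorem chart_lab (z z' : B.Y) (h : z' ∈ (chartAt (EuclideanHalfSpace n) z).source) :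
    B.lab z' ≠ none ↔ ((chartAt (EuclideanHalfSpace n) z) z').1 0 = 0 := by
  have hi := ModelWithCorners.isInteriorPoint_iff_of_mem_atlas (I := 𝓡∂ n) (n := ∞) (by simp)
    (chart_mem_atlas (EuclideanHalfSpace n) z) h
  have h2 : (𝓡∂ n).IsInteriorPoint z' ↔
      (chartAt (EuclideanHalfSpace n) z).extend (𝓡∂ n) z' ∈ interior (Set.range (𝓡∂ n)) := by
    rw [hi]
    exact ⟨fun h' => interior_mono (OpenPartialHomeomorph.extend_target_subset_range _) h',
      fun h' => OpenPartialHomeomorph.mem_interior_extend_target _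
        (by simpa using (chartAt (EuclideanHalfSpace n) z).map_source h) h'⟩
  rw [B.lab_iff, ModelWithCorners.isBoundaryPoint_iff_not_isInteriorPoint, h2,
    interior_range_modelWithCornersEuclideanHalfSpace]
  have h3 := ((chartAt (EuclideanHalfSpace n) z) z').2
  simp only [Set.mem_ofPred_eq, OpenPartialHomeomorph.extend_coe, Function.comp_apply,
    modelWithCornersEuclideanHalfSpace_toFun, not_lt]
  exact ⟨fun h => le_antisymm h h3, fun h => h.le⟩

end OCObj

/-- `u • o` for a sign `u`. -/
def signOr {k : ℕ} {E : Type} [NormedAddCommGroup E] [NormedSpace ℝ E] (u : ℤˣ)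
    (o : Orientation ℝ E (Fin k)) : Orientation ℝ E (Fin k) := if u = 1 then o else -o

/-- The sign `1` at the end `{0}` and `-1` at the end `{1}` of `[0, 1]`. -/
def endSign (b : Bool) : ℤˣ := if b then -1 else 1

/-- The end point `0` (for `b = false`) or `1` (for `b = true`) of `[0, 1]`. -/
def endPt (b : Bool) : Int01 := if b then ⊤ else ⊥

/-- An identification of `X` with a part of the two ends of the cylinder `[0, 1] × B`: the point `y`
is placed at the end `pos y` over the point `φ y` of `B`, where `φ` respects the preferred charts
to first order. The collar coordinate then has to run in the direction `dir y`. -/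
structure CylEnd {n : ℕ} [NeZero n] {I : Type} (X B : OCObj n I) (s : ℤˣ) where
  φ : X.Y → B.Y
  ld : IsLocalDiffeomorph (𝓡∂ n) (𝓡∂ n) ∞ φ
  der : ∀ y, HasMFDerivAt (𝓡∂ n) (𝓡∂ n) φ y (ContinuousLinearMap.id ℝ (EY n))
  pos : X.Y → Bool
  pos_cont : IsLocallyConstant pos
  inj : ∀ y y', φ y = φ y' → pos y = pos y' → y = y'
  lab_eq : ∀ y, B.lab (φ y) = X.lab y
  or_eq : ∀ y, signOr (s * X.sgn y * endSign (pos y)) (B.orT (φ y)) = X.orT y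

theorem orMap_sign {n : ℕ} (u : ℤˣ) (o : Orientation ℝ (ℝ × EY n) (Fin (n + 1))) :
    OrMap ((((u : ℤ) : ℝ) • ContinuousLinearMap.id ℝ ℝ).prodMap (ContinuousLinearMap.id ℝ (EY n)))
      (signOr u o) o := by
  obtain rfl | rfl := Int.units_eq_one_or u
  · exact ⟨LinearEquiv.refl ℝ _, fun v => by simp, by simp [signOr]⟩
  · let e : (ℝ × EY n) ≃ₗ[ℝ] (ℝ × EY n) := (LinearEquiv.neg ℝ).prodCongr (LinearEquiv.refl ℝ (EY n))
    refine ⟨e, fun v => Prod.ext (by simp [e]) (by simp [e]), ?_⟩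
    have hdet : LinearMap.det (e : (ℝ × EY n) →ₗ[ℝ] (ℝ × EY n)) < 0 := by
      have : (e : (ℝ × EY n) →ₗ[ℝ] (ℝ × EY n)) =
          (-LinearMap.id : ℝ →ₗ[ℝ] ℝ).prodMap (LinearMap.id : EY n →ₗ[ℝ] EY n) := by
        ext v <;> simp [e]
      rw [this, LinearMap.det_prodMap]
      simp
    have hc : Fintype.card (Fin (n + 1)) = Module.finrank ℝ (ℝ × EY n) := by
      simp [add_comm]
    have := (Orientation.map_eq_neg_iff_det_neg (-o) e hc).2 hdet
    rw [signOr, if_neg (by decide)]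
    exact this.trans (neg_neg (show Module.Ray ℝ _ from o))

namespace CylEnd

variable {n : ℕ} [NeZero n] {I : Type} {X B : OCObj n I} {s : ℤˣ} (e : CylEnd X B s)

/-- The direction of the collar. -/
def dir (y : X.Y) : ℤˣ := s * X.sgn y * endSign (e.pos y)

/-- The affine collar `(t, y) ↦ (pos y + dir y * t, φ y)` in `ℝ × B`. -/
def aff (p : ℝ × X.Y) : ℝ × B.Y := ((endPt (e.pos p.2) : ℝ) + ((e.dir p.2 : ℤ) : ℝ) * p.1, e.φ p.2)

/-- The collar. -/
def w (p : ℝ × X.Y) : Int01 × B.Y := (Set.projIcc 0 1 zero_le_one (e.aff p).1, (e.aff p).2)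

variable (X s) in
/-- The collar neighbourhood. -/
def W : Set (ℝ × X.Y) := {p | |p.1| < 1 / 2} ∩ X.cone s

variable (X s) in
theorem nbhd : X.IsNbhd s (W X s) :=
  ⟨⟨_, isOpen_lt (by fun_prop) (by fun_prop), rfl⟩, fun y => ⟨by simp, by simp [OCObj.cone]⟩⟩

theorem dir_mul {p : ℝ × X.Y} (hp : p ∈ W X s) : ((e.dir p.2 : ℤ) : ℝ) * p.1 =
    ((endSign (e.pos p.2) : ℤ) : ℝ) * |p.1| := by
  have h := hp.2
  simp only [OCObj.cone, Set.mem_ofPred_eq] at h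
  have : |p.1| = (((s * X.sgn p.2 : ℤˣ) : ℤ) : ℝ) * p.1 := by
    obtain h' | h' := Int.units_eq_one_or (s * X.sgn p.2)
    · rw [h'] at h ⊢; simp only [Units.val_one, Int.cast_one, one_mul] at h ⊢; exact abs_of_nonneg h
    · rw [h'] at h ⊢
      simp only [Units.val_neg, Units.val_one, Int.cast_neg, Int.cast_one, neg_mul, one_mul] at h ⊢
      exact abs_of_nonpos (by linarith)
  rw [this, dir]
  push_cast
  ring

theorem aff_mem {p : ℝ × X.Y} (hp : p ∈ W X s) : (e.aff p).1 ∈ Set.Icc (0 : ℝ) 1 := by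
  have h1 : |p.1| < 1 / 2 := hp.1
  have h2 := abs_nonneg p.1
  simp only [aff, e.dir_mul hp]
  cases e.pos p.2 <;> simp [endSign, endPt] <;> linarith

theorem w_val {p : ℝ × X.Y} (hp : p ∈ W X s) : ((e.w p).1 : ℝ) = (e.aff p).1 := by
  simp [w, Set.projIcc_of_mem _ (e.aff_mem hp)]

theorem cylIncl_w {p : ℝ × X.Y} (hp : p ∈ W X s) : B.cylIncl (e.w p) = e.aff p :=
  Prod.ext (e.w_val hp) rfl

theorem w_zero (y : X.Y) : e.w (0, y) = (endPt (e.pos y), e.φ y) := by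
  simp [w, aff]

theorem eventually_const (y : X.Y) :
    ∀ᶠ z in 𝓝 y, e.pos z = e.pos y ∧ e.dir z = e.dir y ∧ X.sgn z = X.sgn y := by
  filter_upwards [e.pos_cont.eventually_eq y, X.sgn_cont.eventually_eq y] with z h1 h2
  exact ⟨h1, by simp [dir, h1, h2], h2⟩

theorem aff_smooth : ContMDiff (IC n) (IC n) ∞ e.aff := by
  intro p
  have h : ContMDiffAt (IC n) (IC n) ∞
      (fun q : ℝ × X.Y => ((endPt (e.pos p.2) : ℝ) + ((e.dir p.2 : ℤ) : ℝ) * q.1, e.φ q.2)) p := by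
    refine ContMDiffAt.prodMk ?_ ((e.ld.contMDiff p.2).comp p contMDiffAt_snd)
    have h1 : ContMDiffAt 𝓘(ℝ, ℝ) 𝓘(ℝ, ℝ) ∞
        (fun t : ℝ => (endPt (e.pos p.2) : ℝ) + ((e.dir p.2 : ℤ) : ℝ) * t) p.1 :=
      ContDiffAt.contMDiffAt (by fun_prop)
    exact h1.comp p contMDiffAt_fst
  refine h.congr_of_eventuallyEq ?_
  have := (continuous_snd (X := ℝ)).continuousAt.eventually (e.eventually_const p.2)
  filter_upwards [this] with q hq
  simp [aff, hq.1, hq.2.1]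

theorem w_smooth : ContMDiffOn (IC n) (IS n) ∞ e.w (W X s) := by
  refine ContMDiffOn.prodMk ?_ (contMDiff_snd.comp e.aff_smooth).contMDiffOn
  exact contMDiffOn_projIcc.comp (contMDiff_fst.comp e.aff_smooth).contMDiffOn
    (fun p hp => e.aff_mem hp)

theorem units_sq (u : ℤˣ) : ((u : ℤ) : ℝ) * ((u : ℤ) : ℝ) = 1 := by
  obtain rfl | rfl := Int.units_eq_one_or u <;> simp

theorem w_inj : Set.InjOn e.w (W X s) := by
  intro p hp p' hp' h
  have h1 : (e.aff p).1 = (e.aff p').1 := by rw [← e.w_val hp, ← e.w_val hp', h]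
  have h2 : e.φ p.2 = e.φ p'.2 := congrArg Prod.snd h
  have hpos : e.pos p.2 = e.pos p'.2 := by
    have a1 : |p.1| < 1 / 2 := hp.1
    have a2 : |p'.1| < 1 / 2 := hp'.1
    simp only [aff, e.dir_mul hp, e.dir_mul hp'] at h1
    cases h3 : e.pos p.2 <;> cases h4 : e.pos p'.2 <;> simp [h3, h4, endSign, endPt] at h1 ⊢ <;> linarith
  have hy := e.inj _ _ h2 hpos
  refine Prod.ext ?_ hy
  simp only [aff, hy, add_right_inj] at h1
  exact mul_left_cancel₀ (by intro h0; have := units_sq (e.dir p'.2); simp [h0] at this) h1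

theorem w_inv (p : ℝ × X.Y) (hp : p ∈ W X s) : ∃ r : Int01 × B.Y → ℝ × X.Y,
    ContMDiffAt (IS n) (IC n) ∞ r (e.w p) ∧ ∀ᶠ q in 𝓝 (e.w p), r q ∈ W X s ∧ e.w (r q) = q := by
  obtain ⟨ψ, T, hT, htgt, hback, hsm, hright⟩ : ∃ (ψ : B.Y → X.Y) (T : Set B.Y), IsOpen T ∧
      e.φ p.2 ∈ T ∧ ψ (e.φ p.2) = p.2 ∧ ContMDiffAt (𝓡∂ n) (𝓡∂ n) ∞ ψ (e.w p).2 ∧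
      ∀ z ∈ T, e.φ (ψ z) = z := by
    obtain ⟨Φ, hΦ, hφ⟩ := e.ld p.2
    have htgt : e.φ p.2 ∈ Φ.target := by rw [hφ hΦ]; exact Φ.map_source hΦ
    refine ⟨Φ.invFun, Φ.target, Φ.open_target, htgt, by rw [hφ hΦ]; exact Φ.left_inv hΦ,
      Φ.contMDiffOn_invFun.contMDiffAt (Φ.open_target.mem_nhds htgt), fun z hz => ?_⟩
    exact (hφ (Φ.map_target hz)).trans (Φ.right_inv hz)
  let P : ℝ := endPt (e.pos p.2)
  let D : ℝ := ((e.dir p.2 : ℤ) : ℝ)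
  let r : Int01 × B.Y → ℝ × X.Y := fun q => (D * ((q.1 : ℝ) - P), ψ q.2)
  have hr1 : ContMDiffAt (IS n) 𝓘(ℝ, ℝ) ∞ (fun q : Int01 × B.Y => D * ((q.1 : ℝ) - P)) (e.w p) := by
    have h1 : ContMDiff 𝓘(ℝ, ℝ) 𝓘(ℝ, ℝ) ∞ (fun t : ℝ => D * (t - P)) :=
      ContDiff.contMDiff (by fun_prop)
    exact (h1.comp (contMDiff_subtypeVal_Icc.comp contMDiff_fst)).contMDiffAt
  refine ⟨r, hr1.prodMk (hsm.comp (e.w p) contMDiffAt_snd), ?_⟩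
  have hc2 : ContinuousAt (fun q : Int01 × B.Y => ψ q.2) (e.w p) :=
    hsm.continuousAt.comp continuousAt_snd
  have hev1 : ∀ᶠ q : Int01 × B.Y in 𝓝 (e.w p), q.2 ∈ T :=
    continuousAt_snd.eventually (hT.mem_nhds htgt)
  have hev2 : ∀ᶠ q : Int01 × B.Y in 𝓝 (e.w p), e.pos (ψ q.2) = e.pos p.2 ∧
      e.dir (ψ q.2) = e.dir p.2 ∧ X.sgn (ψ q.2) = X.sgn p.2 := by
    have h := e.eventually_const p.2
    rw [← hback] at h
    have h' := Filter.Tendsto.eventually (f := fun q : Int01 × B.Y => ψ q.2) hc2 h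
    simpa only [hback] using h'
  have hev3 : ∀ᶠ q : Int01 × B.Y in 𝓝 (e.w p), |D * ((q.1 : ℝ) - P)| < 1 / 2 := by
    refine (hr1.continuousAt.abs).eventually_lt continuousAt_const ?_
    have h1 : |p.1| < 1 / 2 := hp.1
    rw [e.w_val hp]
    have : D * ((e.aff p).1 - P) = p.1 := by
      simp only [aff, P, D, add_sub_cancel_left, ← mul_assoc, units_sq, one_mul]
    rw [this]; exact h1
  filter_upwards [hev1, hev2, hev3] with q h1 h2 h3
  have hDP : P + D * (D * ((q.1 : ℝ) - P)) = q.1 := by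
    rw [← mul_assoc, units_sq]; ring
  constructor
  · refine ⟨h3, ?_⟩
    change 0 ≤ (((s * X.sgn (ψ q.2) : ℤˣ) : ℤ) : ℝ) * (D * ((q.1 : ℝ) - P))
    rw [h2.2.2]
    have : (((s * X.sgn p.2 : ℤˣ) : ℤ) : ℝ) * (D * ((q.1 : ℝ) - P)) =
        ((endSign (e.pos p.2) : ℤ) : ℝ) * ((q.1 : ℝ) - P) := by
      have h4 : D = (((s * X.sgn p.2 : ℤˣ) : ℤ) : ℝ) * ((endSign (e.pos p.2) : ℤ) : ℝ) := by
        simp only [D, dir]; push_cast; ring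
      rw [h4, ← mul_assoc, ← mul_assoc, units_sq, one_mul]
    rw [this]
    have a := q.1.2.1
    have b := q.1.2.2
    simp only [P]
    cases e.pos p.2 <;> simp [endSign, endPt] <;> linarith
  · have hfst : (e.aff (r q)).1 = q.1 := by
      simp only [aff, r, h2.1, h2.2.1]; exact hDP
    refine Prod.ext ?_ ?_
    · simp only [w, hfst, Set.projIcc_val]
    · exact hright _ h1

theorem w_orient (p : ℝ × X.Y) (hp : p ∈ W X s) (h0 : p.1 ≠ 0) :
    OrPres (IC n) (IS n) (fun p => X.orT p.2) B.cylOr e.w p := by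
  have hW : W X s ∈ 𝓝 p := by
    have h1 : ∀ᶠ q : ℝ × X.Y in 𝓝 p, |q.1| < 1 / 2 :=
      ContinuousAt.eventually_lt (by fun_prop) continuousAt_const hp.1
    have h2 : ∀ᶠ q : ℝ × X.Y in 𝓝 p, X.sgn q.2 = X.sgn p.2 :=
      continuousAt_snd.eventually (X.sgn_cont.eventually_eq p.2)
    have h3 : 0 < (((s * X.sgn p.2 : ℤˣ) : ℤ) : ℝ) * p.1 := by
      refine lt_of_le_of_ne hp.2 (Ne.symm (mul_ne_zero ?_ h0))
      intro h; have := units_sq (s * X.sgn p.2); rw [h] at this; simp at this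
    have h4 : ∀ᶠ q : ℝ × X.Y in 𝓝 p, 0 < (((s * X.sgn p.2 : ℤˣ) : ℤ) : ℝ) * q.1 :=
      ContinuousAt.eventually_lt continuousAt_const (by fun_prop) h3
    filter_upwards [h1, h2, h4] with q a b c
    exact ⟨a, by rw [OCObj.cone, Set.mem_ofPred_eq, b]; exact c.le⟩
  have hw : HasMFDerivAt (IC n) (IS n) e.w p (mfderiv (IC n) (IS n) e.w p) :=
    ((e.w_smooth.contMDiffAt hW).mdifferentiableAt (by simp)).hasMFDerivAt
  have h1 := HasMFDerivAt.comp (I' := IS n) p (B.hasMFDerivAt_cylIncl (e.w p)) hw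
  have haff : HasMFDerivAt (IC n) (IC n) e.aff p
      ((((e.dir p.2 : ℤ) : ℝ) • ContinuousLinearMap.id ℝ ℝ).prodMap
        (ContinuousLinearMap.id ℝ (EY n))) := by
    have h2 : HasMFDerivAt 𝓘(ℝ, ℝ) 𝓘(ℝ, ℝ)
        (fun t : ℝ => (endPt (e.pos p.2) : ℝ) + ((e.dir p.2 : ℤ) : ℝ) * t) p.1
        (((e.dir p.2 : ℤ) : ℝ) • ContinuousLinearMap.id ℝ ℝ) :=
      HasFDerivAt.hasMFDerivAt
        (((hasFDerivAt_id p.1).const_mul ((e.dir p.2 : ℤ) : ℝ)).const_add _)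
    refine (hasMFDerivAt_prodMap h2 (e.der p.2)).congr_of_eventuallyEq ?_
    have := (continuous_snd (X := ℝ)).continuousAt.eventually (e.eventually_const p.2)
    filter_upwards [this] with q hq
    refine Prod.ext ?_ rfl
    simp [aff, hq.1, hq.2.1]
  have h3 : HasMFDerivAt (IC n) (IC n) e.aff p _ := h1.congr_of_eventuallyEq
    (by filter_upwards [hW] with q hq; exact (e.cylIncl_w hq).symm)
  have h4 := hasMFDerivAt_unique h3 haff
  have h5 : OrMap (E := ℝ × EY n) (F := ℝ × EY n)
      ((((e.dir p.2 : ℤ) : ℝ) • ContinuousLinearMap.id ℝ ℝ).prodMap (ContinuousLinearMap.id ℝ (EY n)))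
      (X.orT p.2) (B.orT (e.φ p.2)) := by
    have := orMap_sign (n := n) (e.dir p.2) (B.orT (e.φ p.2))
    rwa [dir, e.or_eq] at this
  refine OrMap.of_comp (E := ℝ × EY n) (F := ES n) (L := mfderiv (IC n) (IS n) e.w p)
    (B.orMap_cylIncl (e.w p)) ?_
  exact Eq.subst (motive := fun L => OrMap (E := ℝ × EY n) (F := ℝ × EY n) L (X.orT p.2)
    (B.orT (e.φ p.2))) h4.symm h5

end CylEnd

theorem endPt_inj {b b' : Bool} (h : endPt b = endPt b') : b = b' := by
  cases b <;> cases b' <;> simp [endPt] at h ⊢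

theorem endPt_of_ne {b b' : Bool} (h : endPt b ≠ endPt (!b')) : b = b' := by
  cases b <;> cases b' <;> simp at h ⊢

theorem chart_int (σ : Int01) : ∃ b : Bool, ∀ᶠ τ in 𝓝 σ, τ ≠ endPt (!b) ∧
    (((chartAt (EuclideanHalfSpace 1) σ) τ).1 0 = 0 ↔ τ = endPt b) := by
  by_cases h : (σ : ℝ) < 1
  · refine ⟨false, ?_⟩
    rw [Icc_chartedSpaceChartAt_of_le_top h]
    filter_upwards [continuous_subtype_val.continuousAt.eventually (gt_mem_nhds h)] with τ hτ
    refine ⟨fun h' => by rw [h'] at hτ; simp [endPt] at hτ, ?_⟩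
    rw [IccLeftChart_apply, Subtype.ext_iff]
    simp [endPt]
  · refine ⟨true, ?_⟩
    have h1 : (1 : ℝ) ≤ σ := not_lt.1 h
    rw [Icc_chartedSpaceChartAt_of_top_le h1]
    have h2 : (0 : ℝ) < σ := by linarith
    filter_upwards [continuous_subtype_val.continuousAt.eventually (lt_mem_nhds h2)] with τ hτ
    refine ⟨fun h' => by rw [h'] at hτ; simp [endPt] at hτ, ?_⟩
    rw [IccRightChart_apply, Subtype.ext_iff]
    simp only [endPt, if_true, Set.Icc.coe_top]
    rw [sub_eq_zero, eq_comm]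

namespace CylEnd

variable {n : ℕ} [NeZero n] {I : Type} {X B : OCObj n I} {s : ℤˣ} (e : CylEnd X B s)

theorem near (y : X.Y) : ∀ᶠ z in 𝓝 (e.φ y), ∃ y', e.pos y' = e.pos y ∧ e.φ y' = z := by
  refine e.ld.isOpenMap.nhds_le y ?_
  rw [Filter.mem_map]
  filter_upwards [e.pos_cont.eventually_eq y] with z hz
  exact ⟨z, hz, rfl⟩

/-- The face at which the collar is attached. -/
def face : Set (Int01 × B.Y) := Set.range (fun y => e.w (0, y))

theorem mem_face_iff {b : Bool} {q : Int01 × B.Y} (hq : q.1 ≠ endPt (!b)) :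
    q ∈ e.face ↔ q.1 = endPt b ∧ ∃ y, e.pos y = b ∧ e.φ y = q.2 := by
  constructor
  · rintro ⟨y, rfl⟩
    simp only [w_zero] at hq ⊢
    have hb := endPt_of_ne hq
    exact ⟨by rw [hb], y, hb, rfl⟩
  · rintro ⟨h, y, h1, h2⟩
    exact ⟨y, (e.w_zero y).trans (Prod.ext (by rw [h1, h]) h2)⟩

end CylEnd

/-- A cylinder `[0, 1] × B` whose two ends are identified with the disjoint union of `X` and `X'`. -/
structure Cyl {n : ℕ} [NeZero n] {I : Type} (X X' : OCObj n I) where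
  B : OCObj n I
  inn : CylEnd X B 1
  out : CylEnd X' B (-1)
  cover : ∀ b z, (∃ y, inn.pos y = b ∧ inn.φ y = z) ∨ (∃ y, out.pos y = b ∧ out.φ y = z)
  excl : ∀ y y', inn.pos y = out.pos y' → inn.φ y ≠ out.φ y'

namespace Cyl

variable {n : ℕ} [NeZero n] {I : Type} {X X' : OCObj n I} (C : Cyl X X')

/-- The underlying manifold of a cylinder. -/
def mfd : OCMfd n I where
  S := Int01 × C.B.Y
  or := C.B.cylOr
  or_cont := C.B.cylOr_cont
  face a := if a = 0 then C.inn.face else C.out.face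
  lab p := C.B.lab p.2
  lab_cont p i h := continuousAt_snd.eventually (C.B.lab_cont p.2 i h)
  corner := by
    intro p
    obtain ⟨b, hb⟩ := chart_int p.1
    have hb' : ∀ᶠ q : Int01 × C.B.Y in 𝓝 p, q.1 ≠ endPt (!b) ∧
      (((chartAt (EuclideanHalfSpace 1) p.1) q.1).1 0 = 0 ↔ q.1 = endPt b) :=
      continuousAt_fst.eventually hb
    have hl : ∀ᶠ q : Int01 × C.B.Y in 𝓝 p, q.2 ∈ (chartAt (EuclideanHalfSpace n) p.2).source :=
      continuousAt_snd.eventually ((chartAt (EuclideanHalfSpace n) p.2).open_source.mem_nhds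
        (mem_chart_source _ p.2))
    have hmem : chartAt (ModelProd (EuclideanHalfSpace 1) (EuclideanHalfSpace n)) p ∈
        IsManifold.maximalAtlas (IS n) ∞ (Int01 × C.B.Y) := IsManifold.chart_mem_maximalAtlas p
    obtain ⟨y, h1, h2⟩ | ⟨y, h1, h2⟩ := C.cover b p.2
    · refine ⟨0, _, hmem, mem_chart_source _ p, ?_⟩
      have hn := C.inn.near y
      rw [h2, h1] at hn
      filter_upwards [hb', hl, continuousAt_snd.eventually hn] with q hq hq' hq''
      refine ⟨?_, ?_, C.B.chart_lab p.2 q.2 hq'⟩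
      · rw [if_pos rfl, C.inn.mem_face_iff hq.1]
        exact ⟨fun h => hq.2.2 h.1, fun h => ⟨hq.2.1 h, hq''⟩⟩
      · intro a ha
        rw [if_neg ha, C.out.mem_face_iff hq.1]
        rintro ⟨-, y', h3, h4⟩
        obtain ⟨y'', h5, h6⟩ := hq''
        exact C.excl y'' y' (h5.trans h3.symm) (h6.trans h4.symm)
    · refine ⟨1, _, hmem, mem_chart_source _ p, ?_⟩
      have hn := C.out.near y
      rw [h2, h1] at hn
      filter_upwards [hb', hl, continuousAt_snd.eventually hn] with q hq hq' hq''
      refine ⟨?_, ?_, C.B.chart_lab p.2 q.2 hq'⟩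
      · rw [if_neg (by decide), C.out.mem_face_iff hq.1]
        exact ⟨fun h => hq.2.2 h.1, fun h => ⟨hq.2.1 h, hq''⟩⟩
      · intro a ha
        have ha' : a = 0 := by omega
        rw [if_pos ha', C.inn.mem_face_iff hq.1]
        rintro ⟨-, y', h3, h4⟩
        obtain ⟨y'', h5, h6⟩ := hq''
        exact C.excl y' y'' (h3.trans h5.symm) (h4.trans h6.symm)

/-- The collar of an end. -/
def collar {Z : OCObj n I} {s : ℤˣ} (e : CylEnd Z C.B s) (a : Fin 2) (h : C.mfd.face a = e.face) :
    Collar Z s C.mfd a where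
  W := CylEnd.W Z s
  nbhd := CylEnd.nbhd Z s
  w := e.w
  smooth := e.w_smooth
  inj := e.w_inj
  inv := e.w_inv
  orient := e.w_orient
  lab_w p _ := e.lab_eq p.2
  face_eq := h

/-- The bordism given by a cylinder. -/
def tup : Tup X X' where
  M := C.mfd
  c₀ := C.collar C.inn 0 (by simp [mfd])
  c₁ := C.collar C.out 1 (by simp [mfd])
  disj := by
    rw [Set.disjoint_left]
    rintro _ ⟨p, hp, rfl⟩ ⟨p', hp', h⟩
    replace h : C.out.w p' = C.inn.w p := h
    replace hp : p ∈ CylEnd.W X 1 := hp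
    replace hp' : p' ∈ CylEnd.W X' (-1) := hp'
    have h1 : (C.out.aff p').1 = (C.inn.aff p).1 := by
      rw [← C.out.w_val hp', ← C.inn.w_val hp]; rw [h]
    have h2 : C.out.φ p'.2 = C.inn.φ p.2 := congrArg Prod.snd h
    refine C.excl p.2 p'.2 ?_ h2.symm
    have a1 : |p.1| < 1 / 2 := hp.1
    have a2 : |p'.1| < 1 / 2 := hp'.1
    simp only [CylEnd.aff, C.out.dir_mul hp', C.inn.dir_mul hp] at h1
    cases h3 : C.inn.pos p.2 <;> cases h4 : C.out.pos p'.2 <;>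
      simp [h3, h4, endSign, endPt] at h1 ⊢ <;> linarith

end Cyl

/-! ### Standard cylinders -/

section Tr

variable (n : ℕ) [NeZero n]

/-- Local diffeomorphisms which respect the preferred charts to first order. -/
def IsTr {M N : Type} [TopologicalSpace M] [ChartedSpace (EuclideanHalfSpace n) M]
    [TopologicalSpace N] [ChartedSpace (EuclideanHalfSpace n) N] (φ : M → N) : Prop :=
  IsLocalDiffeomorph (𝓡∂ n) (𝓡∂ n) ∞ φ ∧
    ∀ y, HasMFDerivAt (𝓡∂ n) (𝓡∂ n) φ y (ContinuousLinearMap.id ℝ (EY n))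

variable {n}

variable {M N K : Type} [TopologicalSpace M] [ChartedSpace (EuclideanHalfSpace n) M]
  [TopologicalSpace N] [ChartedSpace (EuclideanHalfSpace n) N]
  [TopologicalSpace K] [ChartedSpace (EuclideanHalfSpace n) K]

theorem IsTr.id : IsTr n (id : M → M) :=
  ⟨(Diffeomorph.refl (𝓡∂ n) M ∞).isLocalDiffeomorph, fun y => hasMFDerivAt_id y⟩

theorem IsTr.inl : IsTr n (Sum.inl : M → M ⊕ N) :=
  ⟨isLocalDiffeomorph_inl, fun y => hasMFDerivAt_inl (p := Sum.inl y)⟩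

theorem IsTr.inr : IsTr n (Sum.inr : N → M ⊕ N) :=
  ⟨isLocalDiffeomorph_inr, fun y => hasMFDerivAt_inr (p := Sum.inr y)⟩

theorem IsTr.comp {g : N → K} {f : M → N} (hg : IsTr n g) (hf : IsTr n f) : IsTr n (g ∘ f) :=
  ⟨fun y => IsLocalDiffeomorphAt.comp (hf := hf.1 y) (hg := hg.1 (f y)), fun y =>
    HasMFDerivAt.comp (I' := 𝓡∂ n) y (hg.2 (f y)) (hf.2 y)⟩

theorem IsTr.sumElim [IsManifold (𝓡∂ n) ∞ M] [IsManifold (𝓡∂ n) ∞ N] {f : M → K} {g : N → K} (hf : IsTr n f) (hg : IsTr n g) : IsTr n (Sum.elim f g) := by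
  have h := isLocalDiffeomorph_sumElim hf.1 hg.1
  refine ⟨h, ?_⟩
  rintro (y | y)
  · exact hasMFDerivAt_of_inl ((h _).mdifferentiableAt (by simp)) (hf.2 y)
  · exact hasMFDerivAt_of_inr ((h _).mdifferentiableAt (by simp)) (hg.2 y)

theorem IsTr.of_isEmpty [IsEmpty M] (f : M → N) : IsTr n f :=
  ⟨fun y => isEmptyElim y, fun y => isEmptyElim y⟩

end Tr

instance {n : ℕ} [NeZero n] {I : Type} : IsEmpty (OCObj.empty n I).Y := inferInstanceAs (IsEmpty Empty)

theorem endSign_inj {b b' : Bool} : endSign b = endSign b' ↔ b = b' := by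
  cases b <;> cases b' <;> simp [endSign, eq_comm, show ¬((1 : ℤˣ) = -1) by decide]

theorem endSign_decide (u : ℤˣ) : endSign (decide (u = -1)) = u := by
  obtain rfl | rfl := Int.units_eq_one_or u <;> simp [endSign, show ¬((1 : ℤˣ) = -1) by decide]

theorem decide_iff (u : ℤˣ) (b : Bool) : decide (u = -1) = b ↔ u = endSign b := by
  rw [← endSign_inj, endSign_decide]

theorem decide_eq (u v : ℤˣ) : decide (u = -1) = decide (v = -1) ↔ u = v := by
  rw [← endSign_inj, endSign_decide, endSign_decide]

namespace CylEnd

variable {n : ℕ} [NeZero n] {I : Type} {X B : OCObj n I} {s : ℤˣ}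

/-- The end of a cylinder where all collars run in the direction `u`. -/
def of (u : ℤˣ) (φ : X.Y → B.Y) (hφ : IsTr n φ)
    (inj : ∀ y y', φ y = φ y' → X.sgn y = X.sgn y' → y = y')
    (lab_eq : ∀ y, B.lab (φ y) = X.lab y) (or_eq : ∀ y, signOr u (B.orT (φ y)) = X.orT y) :
    CylEnd X B s where
  φ := φ
  ld := hφ.1
  der := hφ.2
  pos y := decide (u * s * X.sgn y = -1)
  pos_cont := X.sgn_cont.comp (fun v => decide (u * s * v = -1))
  inj y y' h h' := inj y y' h (by
    have := congrArg endSign h'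
    rw [endSign_decide, endSign_decide] at this
    exact mul_left_cancel this)
  lab_eq := lab_eq
  or_eq y := by
    rw [endSign_decide, ← or_eq y]
    congr 1
    have h1 := Int.units_mul_self s
    have h2 := Int.units_mul_self (X.sgn y)
    have h3 : s * X.sgn y * (u * s * X.sgn y) = u * (s * s) * (X.sgn y * X.sgn y) := by
      ac_rfl
    rw [h3, h1, h2, mul_one, mul_one]

end CylEnd

theorem units_eq_or (a b : ℤˣ) : a = b ∨ a = -b := by
  obtain rfl | rfl := Int.units_eq_one_or a <;> obtain rfl | rfl := Int.units_eq_one_or b <;> simp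

theorem units_ne_neg (a : ℤˣ) : a ≠ -a := by
  obtain rfl | rfl := Int.units_eq_one_or a <;> decide

/-- A diffeomorphism `φ` of objects which respects all data. -/
structure ObjIso {n : ℕ} [NeZero n] {I : Type} (X X' : OCObj n I) where
  φ : X.Y → X'.Y
  tr : IsTr n φ
  bij : Function.Bijective φ
  lab_eq : ∀ y, X'.lab (φ y) = X.lab y
  or_eq : ∀ y, X'.orT (φ y) = X.orT y
  sgn_eq : ∀ y, X'.sgn (φ y) = X.sgn y

namespace Cyl

variable {n : ℕ} [NeZero n] {I : Type}

/-- The mapping cylinder of a diffeomorphism. -/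
def map {X X' : OCObj n I} (f : ObjIso X X') : Cyl X X' where
  B := X'
  inn := CylEnd.of 1 f.φ f.tr (fun _ _ h _ => f.bij.1 h) f.lab_eq (fun y => f.or_eq y)
  out := CylEnd.of 1 id IsTr.id (fun _ _ h _ => h) (fun _ => rfl) (fun _ => rfl)
  cover b z := by
    obtain ⟨y, rfl⟩ := f.bij.2 z
    obtain h | h := units_eq_or (X.sgn y) (endSign b)
    · exact Or.inl ⟨y, (decide_iff (1 * 1 * X.sgn y) b).2 (by simpa using h), rfl⟩
    · exact Or.inr ⟨f.φ y, (decide_iff (1 * (-1) * X'.sgn (f.φ y)) b).2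
        (by rw [f.sgn_eq, h]; simp), rfl⟩
  excl y y' h := by
    have h' := (decide_eq (1 * 1 * X.sgn y) (1 * (-1) * X'.sgn y')).1 h
    rintro (rfl : f.φ y = y')
    rw [f.sgn_eq] at h'
    simp at h'

/-- The evaluation bordism `X^∨ ⊔ X → ∅`. -/
def ev (X : OCObj n I) : Cyl (X.dual.sum X) (OCObj.empty n I) where
  B := X
  inn := CylEnd.of 1 (Sum.elim id id) (IsTr.sumElim IsTr.id IsTr.id)
    (by
      rintro (y | y) (y' | y') h h'
      · exact congrArg Sum.inl h
      · obtain rfl : y = y' := h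
        exact (units_ne_neg (X.sgn y) (Eq.symm h')).elim
      · obtain rfl : y = y' := h
        exact (units_ne_neg (X.sgn y) h').elim
      · exact congrArg Sum.inr h)
    (by rintro (y | y) <;> rfl) (by rintro (y | y) <;> rfl)
  out := CylEnd.of 1 (fun y => isEmptyElim y) (IsTr.of_isEmpty _) (fun y => isEmptyElim y)
    (fun y => isEmptyElim y) (fun y => isEmptyElim y)
  cover b z := by
    left
    obtain h | h := units_eq_or (X.sgn z) (endSign b)
    · exact ⟨Sum.inr z, (decide_iff (1 * 1 * X.sgn z) b).2 (by simpa using h), rfl⟩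
    · exact ⟨Sum.inl z, (decide_iff (1 * 1 * (-X.sgn z)) b).2 (by rw [h]; simp), rfl⟩
  excl _ y' := isEmptyElim y'

/-- The hermitean bordism from the opposite of `X` to the dual of `X`. -/
def flat (X : OCObj n I) : Cyl X.op X.dual where
  B := X
  inn := CylEnd.of (-1) id IsTr.id (fun _ _ h _ => h) (fun _ => rfl)
    (fun y => by rw [signOr, if_neg (by decide)]; rfl)
  out := CylEnd.of 1 id IsTr.id (fun _ _ h _ => h) (fun _ => rfl) (fun _ => rfl)
  cover b z := by
    obtain h | h := units_eq_or (X.sgn z) (endSign b)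
    · exact Or.inr ⟨z, (decide_iff (1 * (-1) * (-X.sgn z)) b).2 (by rw [h]; simp), rfl⟩
    · exact Or.inl ⟨z, (decide_iff (-1 * 1 * X.sgn z) b).2 (by rw [h]; simp), rfl⟩
  excl y y' h := by
    have h' := (decide_eq (-1 * 1 * X.sgn y) (1 * (-1) * (-X.sgn y'))).1 h
    rintro (rfl : y = y')
    exact units_ne_neg (X.sgn y) (by simpa using h'.symm)

end Cyl

namespace ObjIso

variable {n : ℕ} [NeZero n] {I : Type}

/-- The identity. -/
def refl (X : OCObj n I) : ObjIso X X :=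
  ⟨id, IsTr.id, Function.bijective_id, fun _ => rfl, fun _ => rfl, fun _ => rfl⟩

/-- The associator. -/
def assoc (X Y Z : OCObj n I) : ObjIso ((X.sum Y).sum Z) (X.sum (Y.sum Z)) where
  φ := Sum.elim (Sum.elim Sum.inl (Sum.inr ∘ Sum.inl)) (Sum.inr ∘ Sum.inr)
  tr := IsTr.sumElim (IsTr.sumElim IsTr.inl (IsTr.inr.comp IsTr.inl)) (IsTr.inr.comp IsTr.inr)
  bij := (Equiv.sumAssoc X.Y Y.Y Z.Y).bijective
  lab_eq := by rintro ((y | y) | y) <;> rfl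
  or_eq := by rintro ((y | y) | y) <;> rfl
  sgn_eq := by rintro ((y | y) | y) <;> rfl

/-- The left unitor. -/
def lunit (X : OCObj n I) : ObjIso ((OCObj.empty n I).sum X) X where
  φ := Sum.elim (fun y => isEmptyElim y) id
  tr := IsTr.sumElim (IsTr.of_isEmpty _) IsTr.id
  bij := by
    refine ⟨?_, fun y => ⟨Sum.inr y, rfl⟩⟩
    rintro (y | y) (y' | y') h
    exacts [isEmptyElim y, isEmptyElim y, isEmptyElim y', congrArg Sum.inr h]
  lab_eq := by rintro (y | y); exacts [isEmptyElim y, rfl]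
  or_eq := by rintro (y | y); exacts [isEmptyElim y, rfl]
  sgn_eq := by rintro (y | y); exacts [isEmptyElim y, rfl]

/-- The right unitor. -/
def runit (X : OCObj n I) : ObjIso (X.sum (OCObj.empty n I)) X where
  φ := Sum.elim id (fun y => isEmptyElim y)
  tr := IsTr.sumElim IsTr.id (IsTr.of_isEmpty _)
  bij := by
    refine ⟨?_, fun y => ⟨Sum.inl y, rfl⟩⟩
    rintro (y | y) (y' | y') h
    exacts [congrArg Sum.inl h, isEmptyElim y', isEmptyElim y, isEmptyElim y]
  lab_eq := by rintro (y | y); exacts [rfl, isEmptyElim y]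
  or_eq := by rintro (y | y); exacts [rfl, isEmptyElim y]
  sgn_eq := by rintro (y | y); exacts [rfl, isEmptyElim y]

/-- The symmetry. -/
def swap (X Y : OCObj n I) : ObjIso (X.sum Y) (Y.sum X) where
  φ := Sum.elim Sum.inr Sum.inl
  tr := IsTr.sumElim IsTr.inr IsTr.inl
  bij := (Equiv.sumComm X.Y Y.Y).bijective
  lab_eq := by rintro (y | y) <;> rfl
  or_eq := by rintro (y | y) <;> rfl
  sgn_eq := by rintro (y | y) <;> rfl

/-- Opposites and disjoint unions. -/
def opTen (X Y : OCObj n I) : ObjIso (X.op.sum Y.op) (X.sum Y).op where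
  φ := id
  tr := IsTr.id (M := X.Y ⊕ Y.Y)
  bij := Function.bijective_id
  lab_eq _ := rfl
  or_eq := by rintro (y | y) <;> rfl
  sgn_eq _ := rfl

/-- Opposites and the empty object. -/
def opOne (n : ℕ) [NeZero n] (I : Type) : ObjIso (OCObj.empty n I) (OCObj.empty n I).op where
  φ := id
  tr := IsTr.id (M := (OCObj.empty n I).Y)
  bij := Function.bijective_id
  lab_eq _ := rfl
  or_eq y := isEmptyElim y
  sgn_eq _ := rfl

/-- Double opposites. -/
def opOp (X : OCObj n I) : ObjIso X.op.op X where
  φ := id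
  tr := IsTr.id (M := X.Y)
  bij := Function.bijective_id
  lab_eq _ := rfl
  or_eq y := (neg_neg (show Module.Ray ℝ _ from X.orT y)).symm
  sgn_eq _ := rfl

end ObjIso

/-! ### Smooth families of bordisms in the one-point target space -/

/-- An object over `U` for the one-point target space: `tgt` is the (necessarily unique) family of
maps to the target. -/
structure BObj (n : ℕ) [NeZero n] (I : Type) (U : Cart) where
  base : OCObj n I
  tgt : U.Pt → base.Y → Unit

/-- A bordism over `U` for the one-point target space: `sig` is the (necessarily unique) family of
maps to the target; it is constant along the collars. -/
structure BTup {n : ℕ} [NeZero n] {I : Type} {U : Cart} (X X' : BObj n I U) where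
  tup : Tup X.base X'.base
  sig : U.Pt → tup.M.S → Unit
  sit₀ : ∀ u, ∀ p ∈ tup.c₀.W, sig u (tup.c₀.w p) = X.tgt u p.2
  sit₁ : ∀ u, ∀ p ∈ tup.c₁.W, sig u (tup.c₁.w p) = X'.tgt u p.2

/-- Smoothness of a family of maps parametrised by a cartesian space. -/
def FamSmooth {n : ℕ} [NeZero n] {I : Type} {U : Cart} {M M' : OCMfd n I} (Ψ : U.Pt → M.S → M'.S) :
    Prop :=
  ContMDiff (𝓘(ℝ, EuclideanSpace ℝ (Fin U.dim)).prod (IS n)) (IS n) ∞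
    (fun p : EuclideanSpace ℝ (Fin U.dim) × M.S => Ψ (U.chart p.1) p.2)

/-- The collars `c` and `c'` correspond under all the maps `Ψ u` on a common refinement. -/
def CollarAgree {n : ℕ} [NeZero n] {I : Type} {X : OCObj n I} {s : ℤˣ} {M M' : OCMfd n I}
    {a a' : Fin 2} (c : Collar X s M a) (c' : Collar X s M' a') {A : Type} (Ψ : A → M.S → M'.S) :
    Prop :=
  ∃ V, X.IsNbhd s V ∧ V ⊆ c.W ∧ V ⊆ c'.W ∧ ∀ u, ∀ p ∈ V, Ψ u (c.w p) = c'.w p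

namespace BTup

variable {n : ℕ} [NeZero n] {I : Type} {U V : Cart}

/-- Equivalence of bordisms over `U`. -/
def Rel {X X' : BObj n I U} (f g : BTup X X') : Prop :=
  ∃ (Ψ : U.Pt → f.tup.M.S → g.tup.M.S) (Ψ' : U.Pt → g.tup.M.S → f.tup.M.S),
    (∀ u p, Ψ' u (Ψ u p) = p) ∧ (∀ u q, Ψ u (Ψ' u q) = q) ∧ FamSmooth Ψ ∧ FamSmooth Ψ' ∧
    (∀ u p, OrPres (IS n) (IS n) f.tup.M.or g.tup.M.or (Ψ u) p) ∧
    (∀ u p, g.tup.M.lab (Ψ u p) = f.tup.M.lab p) ∧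
    (∀ u p, g.sig u (Ψ u p) = f.sig u p) ∧
    CollarAgree f.tup.c₀ g.tup.c₀ Ψ ∧ CollarAgree f.tup.c₁ g.tup.c₁ Ψ

end BTup

section Fam

variable {n : ℕ} [NeZero n] {I : Type} {U V : Cart} {M M' M'' : OCMfd n I}

theorem FamSmooth.refl : FamSmooth (U := U) (fun _ (p : M.S) => p) := contMDiff_snd

theorem FamSmooth.comp {Ψ : U.Pt → M.S → M'.S} {Ψ' : U.Pt → M'.S → M''.S} (h' : FamSmooth Ψ')
    (h : FamSmooth Ψ) : FamSmooth (fun u p => Ψ' u (Ψ u p)) :=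
  ContMDiff.comp (I' := 𝓘(ℝ, EuclideanSpace ℝ (Fin U.dim)).prod (IS n)) h' (contMDiff_fst.prodMk h)

theorem FamSmooth.pull (g : V ⟶ U) {Ψ : U.Pt → M.S → M'.S} (h : FamSmooth Ψ) :
    FamSmooth (fun v p => Ψ (Cart.Hom.toFun g v) p) := by
  have h1 : ContMDiff (𝓘(ℝ, EuclideanSpace ℝ (Fin V.dim)).prod (IS n))
      (𝓘(ℝ, EuclideanSpace ℝ (Fin U.dim)).prod (IS n)) ∞
      (Prod.map (fun x => U.chart.symm (Cart.Hom.toFun g (V.chart x))) (id : M.S → M.S)) :=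
    (Cart.Hom.smooth g).contMDiff.prodMap contMDiff_id
  have h2 := ContMDiff.comp h h1
  simpa [FamSmooth, Function.comp_def] using h2

theorem FamSmooth.fibre {Ψ : U.Pt → M.S → M'.S} (h : FamSmooth Ψ) (u : U.Pt) :
    ContMDiff (IS n) (IS n) ∞ (Ψ u) := by
  have h1 : ContMDiff (IS n) (𝓘(ℝ, EuclideanSpace ℝ (Fin U.dim)).prod (IS n)) ∞
      (fun p : M.S => (U.chart.symm u, p)) := contMDiff_const.prodMk contMDiff_id
  have h2 := ContMDiff.comp h h1
  simpa [FamSmooth, Function.comp_def] using h2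

theorem CollarAgree.refl {X : OCObj n I} {s : ℤˣ} {a : Fin 2} (c : Collar X s M a) {A : Type} :
    CollarAgree c c (fun (_ : A) p => p) :=
  ⟨c.W, c.nbhd, subset_rfl, subset_rfl, fun _ _ _ => rfl⟩

theorem CollarAgree.symm {X : OCObj n I} {s : ℤˣ} {a a' : Fin 2} {c : Collar X s M a}
    {c' : Collar X s M' a'} {A : Type} {Ψ : A → M.S → M'.S} {Ψ' : A → M'.S → M.S}
    (h : CollarAgree c c' Ψ) (hl : ∀ u p, Ψ' u (Ψ u p) = p) : CollarAgree c' c Ψ' := by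
  obtain ⟨V, h1, h2, h3, h4⟩ := h
  exact ⟨V, h1, h3, h2, fun u p hp => by rw [← h4 u p hp, hl]⟩

theorem CollarAgree.trans {X : OCObj n I} {s : ℤˣ} {a a' a'' : Fin 2} {c : Collar X s M a}
    {c' : Collar X s M' a'} {c'' : Collar X s M'' a''} {A : Type} {Ψ : A → M.S → M'.S}
    {Ψ' : A → M'.S → M''.S}
    (h : CollarAgree c c' Ψ) (h' : CollarAgree c' c'' Ψ') :
    CollarAgree c c'' (fun u p => Ψ' u (Ψ u p)) := by
  obtain ⟨V, h1, h2, h3, h4⟩ := h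
  obtain ⟨V', h1', h2', h3', h4'⟩ := h'
  exact ⟨V ∩ V', h1.inter h1', fun p hp => h2 hp.1, fun p hp => h3' hp.2, fun u p hp =>
    (congrArg (Ψ' u) (h4 u p hp.1)).trans (h4' u p hp.2)⟩

end Fam

namespace BTup

variable {n : ℕ} [NeZero n] {I : Type} {U V : Cart}

theorem Rel.refl {X X' : BObj n I U} (f : BTup X X') : Rel f f := by
  refine ⟨fun _ p => p, fun _ p => p, fun _ _ => rfl, fun _ _ => rfl, FamSmooth.refl, FamSmooth.refl,
    fun _ p => ?_, fun _ _ => rfl, fun _ _ => rfl, CollarAgree.refl _, CollarAgree.refl _⟩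
  have := (hasMFDerivAt_id (I := IS n) p).mfderiv
  change OrMap (E := ES n) (F := ES n) (mfderiv (IS n) (IS n) id p) _ _
  rw [this]
  exact OrMap.refl _

theorem Rel.symm {X X' : BObj n I U} {f g : BTup X X'} (h : Rel f g) : Rel g f := by
  obtain ⟨Ψ, Ψ', h1, h2, h3, h4, h5, h6, h7, h8, h9⟩ := h
  refine ⟨Ψ', Ψ, h2, h1, h4, h3, fun u q => ?_, fun u q => ?_, fun _ _ => rfl, h8.symm h1, h9.symm h1⟩
  · obtain ⟨p, rfl⟩ : ∃ p, Ψ u p = q := ⟨Ψ' u q, h2 u q⟩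
    have d2 : MDifferentiableAt (IS n) (IS n) (Ψ u) p := (h3.fibre u).mdifferentiable (by simp) _
    have d3 : MDifferentiableAt (IS n) (IS n) (Ψ' u) (Ψ u p) :=
      (h4.fibre u).mdifferentiable (by simp) _
    have c := HasMFDerivAt.comp (I' := IS n) p d3.hasMFDerivAt d2.hasMFDerivAt
    have c' : HasMFDerivAt (IS n) (IS n) id p _ := c.congr_of_eventuallyEq
      (Filter.Eventually.of_forall fun p => (h1 u p).symm)
    have e := hasMFDerivAt_unique c' (hasMFDerivAt_id _)
    have := OrMap.inverse (h5 u p) (M := mfderiv (IS n) (IS n) (Ψ' u) (Ψ u p))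
      (fun v => congrArg (fun L : ES n →L[ℝ] ES n => L v) e)
    rw [OrPres, h1]
    exact this
  · rw [← h6 u, h2]

theorem Rel.trans {X X' : BObj n I U} {f g k : BTup X X'} (h : Rel f g) (h' : Rel g k) :
    Rel f k := by
  obtain ⟨Ψ, Ψ', h1, h2, h3, h4, h5, h6, h7, h8, h9⟩ := h
  obtain ⟨Φ, Φ', k1, k2, k3, k4, k5, k6, k7, k8, k9⟩ := h'
  refine ⟨fun u p => Φ u (Ψ u p), fun u p => Ψ' u (Φ' u p), fun u p => by simp [k1, h1],
    fun u p => by simp [k2, h2], k3.comp h3, h4.comp k4, fun u p => ?_, fun u p => by rw [k6, h6],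
    fun _ _ => rfl, h8.trans k8, h9.trans k9⟩
  have d1 : MDifferentiableAt (IS n) (IS n) (Ψ u) p := (h3.fibre u).mdifferentiable (by simp) p
  have d2 : MDifferentiableAt (IS n) (IS n) (Φ u) (Ψ u p) := (k3.fibre u).mdifferentiable (by simp) _
  have c := HasMFDerivAt.comp (I' := IS n) p d2.hasMFDerivAt d1.hasMFDerivAt
  change OrMap (E := ES n) (F := ES n) (mfderiv (IS n) (IS n) (Φ u ∘ Ψ u) p) _ _
  rw [c.mfderiv]
  exact (k5 u (Ψ u p)).comp (h5 u p)

instance setoid (X X' : BObj n I U) : Setoid (BTup X X') := ⟨Rel, Rel.refl, Rel.symm, Rel.trans⟩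

end BTup

/-! ### The bordism categories -/

namespace BObj

variable {n : ℕ} [NeZero n] {I : Type} {U V : Cart}

/-- Pullback along a map of cartesian spaces. -/
def pull (g : V ⟶ U) (X : BObj n I U) : BObj n I V := ⟨X.base, fun v => X.tgt (Cart.Hom.toFun g v)⟩

/-- Disjoint union. -/
def ten (X Y : BObj n I U) : BObj n I U := ⟨X.base.sum Y.base, fun u => Sum.elim (X.tgt u) (Y.tgt u)⟩

/-- The empty object. -/
def one (n : ℕ) [NeZero n] (I : Type) (U : Cart) : BObj n I U :=
  ⟨OCObj.empty n I, fun _ y => isEmptyElim y⟩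

instance (n : ℕ) [NeZero n] (I : Type) (U : Cart) : IsEmpty (one n I U).base.Y :=
  inferInstanceAs (IsEmpty Empty)

/-- The opposite object. -/
def op (X : BObj n I U) : BObj n I U := ⟨X.base.op, X.tgt⟩

/-- The dual object. -/
def dual (X : BObj n I U) : BObj n I U := ⟨X.base.dual, X.tgt⟩

/-- Objects with `∂Y = ∅`. -/
def IsClosed (X : BObj n I U) : Prop := ∀ y, ¬ (𝓡∂ n).IsBoundaryPoint (y : X.base.Y)

end BObj

namespace BTup

variable {n : ℕ} [NeZero n] {I : Type} {U V : Cart}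

/-- Pullback along a map of cartesian spaces. -/
def pull (g : V ⟶ U) {X X' : BObj n I U} (f : BTup X X') : BTup (X.pull g) (X'.pull g) where
  tup := f.tup
  sig v := f.sig (Cart.Hom.toFun g v)
  sit₀ v := f.sit₀ (Cart.Hom.toFun g v)
  sit₁ v := f.sit₁ (Cart.Hom.toFun g v)

theorem Rel.pull (g : V ⟶ U) {X X' : BObj n I U} {f f' : BTup X X'} (h : Rel f f') :
    Rel (f.pull g) (f'.pull g) := by
  obtain ⟨Ψ, Ψ', h1, h2, h3, h4, h5, h6, h7, ⟨W, a, b, c, h8⟩, ⟨W', a', b', c', h9⟩⟩ := h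
  exact ⟨fun v => Ψ (Cart.Hom.toFun g v), fun v => Ψ' (Cart.Hom.toFun g v), fun _ => h1 _,
    fun _ => h2 _, h3.pull g, h4.pull g, fun _ => h5 _, fun _ => h6 _, fun _ => h7 _,
    ⟨W, a, b, c, fun _ => h8 _⟩, ⟨W', a', b', c', fun _ => h9 _⟩⟩

/-- The opposite bordism. -/
def op {X X' : BObj n I U} (f : BTup X X') : BTup X.op X'.op where
  tup := f.tup.op
  sig := f.sig
  sit₀ := f.sit₀
  sit₁ := f.sit₁

theorem Rel.op {X X' : BObj n I U} {f f' : BTup X X'} (h : Rel f f') : Rel f.op f'.op := by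
  obtain ⟨Ψ, Ψ', h1, h2, h3, h4, h5, h6, h7, h8, h9⟩ := h
  exact ⟨Ψ, Ψ', h1, h2, h3, h4, fun u p => (h5 u p).neg, h6, h7, h8, h9⟩

/-- A cylinder, with the map to the target which is constant in the direction of `[0, 1]`. -/
def cyl {X X' : BObj n I U} (C : Cyl X.base X'.base) (t : U.Pt → C.B.Y → Unit)
    (h₀ : ∀ u y, t u (C.inn.φ y) = X.tgt u y) (h₁ : ∀ u y, t u (C.out.φ y) = X'.tgt u y) :
    BTup X X' where
  tup := C.tup
  sig u p := t u p.2
  sit₀ u p _ := h₀ u p.2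
  sit₁ u p _ := h₁ u p.2

/-- The bordism `h` is obtained by gluing `f` and `g` along their collars: `h` is the union of the
images of `j` and `j'`, which intersect in `Y`; near `Y`, the smooth structure of `h` is the one
for which the union `c` of the two collars of `Y` is a local diffeomorphism. -/
def IsGluing {X Y Z : BObj n I U} (f : BTup X Y) (g : BTup Y Z) (h : BTup X Z) : Prop :=
  ∃ (j : f.tup.M.S → h.tup.M.S) (j' : g.tup.M.S → h.tup.M.S),
    Function.Injective j ∧ Function.Injective j' ∧ Set.range j ∪ Set.range j' = Set.univ ∧
    (∀ p p', j p = j' p' ↔ ∃ y, p = f.tup.c₁.w (0, y) ∧ p' = g.tup.c₀.w (0, y)) ∧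
    (∀ p, p ∉ f.tup.M.face 1 → IsLocalDiffeomorphAt (IS n) (IS n) ∞ j p ∧
      OrPres (IS n) (IS n) f.tup.M.or h.tup.M.or j p) ∧
    (∀ p, p ∉ g.tup.M.face 0 → IsLocalDiffeomorphAt (IS n) (IS n) ∞ j' p ∧
      OrPres (IS n) (IS n) g.tup.M.or h.tup.M.or j' p) ∧
    (∃ (V : Set (ℝ × Y.base.Y)) (c : ℝ × Y.base.Y → h.tup.M.S),
      IsOpen V ∧ V ∩ Y.base.cone (-1) ⊆ f.tup.c₁.W ∧ V ∩ Y.base.cone 1 ⊆ g.tup.c₀.W ∧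
      (∀ y, ((0 : ℝ), y) ∈ V) ∧
      (∀ p ∈ V ∩ Y.base.cone (-1), c p = j (f.tup.c₁.w p)) ∧
      (∀ p ∈ V ∩ Y.base.cone 1, c p = j' (g.tup.c₀.w p)) ∧
      ∀ y, IsLocalDiffeomorphAt (IC n) (IS n) ∞ c (0, y)) ∧
    (∀ p, h.tup.M.lab (j p) = f.tup.M.lab p) ∧ (∀ p, h.tup.M.lab (j' p) = g.tup.M.lab p) ∧
    h.tup.M.face 0 = j '' f.tup.M.face 0 ∧ h.tup.M.face 1 = j' '' g.tup.M.face 1 ∧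
    CollarAgree f.tup.c₀ h.tup.c₀ (fun _ : Unit => j) ∧
    CollarAgree g.tup.c₁ h.tup.c₁ (fun _ : Unit => j') ∧
    (∀ u p, h.sig u (j p) = f.sig u p) ∧ (∀ u p, h.sig u (j' p) = g.sig u p)

/-- The bordism `h` is the disjoint union of `f` and `g`. -/
def IsDisjUnion {X X' Y Y' : BObj n I U} (f : BTup X X') (g : BTup Y Y')
    (h : BTup (X.ten Y) (X'.ten Y')) : Prop :=
  ∃ (j : f.tup.M.S → h.tup.M.S) (j' : g.tup.M.S → h.tup.M.S),
    Function.Injective j ∧ Function.Injective j' ∧ Set.range j ∪ Set.range j' = Set.univ ∧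
    Disjoint (Set.range j) (Set.range j') ∧
    (∀ p, IsLocalDiffeomorphAt (IS n) (IS n) ∞ j p ∧
      OrPres (IS n) (IS n) f.tup.M.or h.tup.M.or j p) ∧
    (∀ p, IsLocalDiffeomorphAt (IS n) (IS n) ∞ j' p ∧
      OrPres (IS n) (IS n) g.tup.M.or h.tup.M.or j' p) ∧
    (∀ p, h.tup.M.lab (j p) = f.tup.M.lab p) ∧ (∀ p, h.tup.M.lab (j' p) = g.tup.M.lab p) ∧
    (∀ a, h.tup.M.face a = j '' f.tup.M.face a ∪ j' '' g.tup.M.face a) ∧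
    (∃ V, X.base.IsNbhd 1 V ∧ V ⊆ f.tup.c₀.W ∧ ∀ p ∈ V, (p.1, Sum.inl p.2) ∈ h.tup.c₀.W ∧
      h.tup.c₀.w (p.1, Sum.inl p.2) = j (f.tup.c₀.w p)) ∧
    (∃ V, Y.base.IsNbhd 1 V ∧ V ⊆ g.tup.c₀.W ∧ ∀ p ∈ V, (p.1, Sum.inr p.2) ∈ h.tup.c₀.W ∧
      h.tup.c₀.w (p.1, Sum.inr p.2) = j' (g.tup.c₀.w p)) ∧
    (∃ V, X'.base.IsNbhd (-1) V ∧ V ⊆ f.tup.c₁.W ∧ ∀ p ∈ V, (p.1, Sum.inl p.2) ∈ h.tup.c₁.W ∧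
      h.tup.c₁.w (p.1, Sum.inl p.2) = j (f.tup.c₁.w p)) ∧
    (∃ V, Y'.base.IsNbhd (-1) V ∧ V ⊆ g.tup.c₁.W ∧ ∀ p ∈ V, (p.1, Sum.inr p.2) ∈ h.tup.c₁.W ∧
      h.tup.c₁.w (p.1, Sum.inr p.2) = j' (g.tup.c₁.w p)) ∧
    (∀ u p, h.sig u (j p) = f.sig u p) ∧ (∀ u p, h.sig u (j' p) = g.sig u p)

end BTup

/-- Morphisms of the bordism category over `U`: equivalence classes of bordisms. -/
def BHom {n : ℕ} [NeZero n] {I : Type} {U : Cart} (X X' : BObj n I U) : Type 1 :=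
  Quotient (BTup.setoid X X')

namespace BHom

variable {n : ℕ} [NeZero n] {I : Type} {U V : Cart}

/-- The class of a bordism. -/
def mk {X X' : BObj n I U} (f : BTup X X') : BHom X X' := Quotient.mk _ f

/-- Pullback along a map of cartesian spaces. -/
def pull (g : V ⟶ U) {X X' : BObj n I U} (F : BHom X X') : BHom (X.pull g) (X'.pull g) :=
  Quotient.map (BTup.pull g) (fun _ _ h => BTup.Rel.pull g h) F

/-- The opposite of a morphism. -/
def op {X X' : BObj n I U} (F : BHom X X') : BHom X.op X'.op :=
  Quotient.map BTup.op (fun _ _ h => BTup.Rel.op h) F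

/-- The mapping cylinder of a diffeomorphism which respects the maps to the target. -/
def ofIso {X X' : BObj n I U} (e : ObjIso X.base X'.base) (h : ∀ u y, X'.tgt u (e.φ y) = X.tgt u y) :
    BHom X X' :=
  mk (BTup.cyl (Cyl.map e) X'.tgt h fun _ _ => rfl)

/-- Comparison of opposites and disjoint unions. -/
def opTen (X Y : BObj n I U) : BHom (X.op.ten Y.op) (X.ten Y).op :=
  ofIso (ObjIso.opTen X.base Y.base) fun _ _ => rfl

/-- Comparison of opposites and the empty object. -/
def opOne (n : ℕ) [NeZero n] (I : Type) (U : Cart) : BHom (BObj.one n I U) (BObj.one n I U).op :=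
  ofIso (ObjIso.opOne n I) fun _ _ => rfl

/-- The double opposite of `X` is `X`. -/
def opOp (X : BObj n I U) : BHom X.op.op X := ofIso (ObjIso.opOp X.base) fun _ _ => rfl

/-- The evaluation `X^∨ ⊔ X → ∅`. -/
def ev (X : BObj n I U) : BHom (X.dual.ten X) (BObj.one n I U) :=
  mk (BTup.cyl (Cyl.ev X.base) X.tgt (by rintro u (y | y) <;> rfl) (fun _ y => isEmptyElim y))

/-- The canonical hermitean structure from the opposite of `X` to the dual of `X`. -/
def flat (X : BObj n I U) : BHom X.op X.dual :=
  mk (BTup.cyl (Cyl.flat X.base) X.tgt (fun _ _ => rfl) (fun _ _ => rfl))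

/-- Morphisms without brane boundary: `∂₂ = ∅`. -/
def NoBrane {X X' : BObj n I U} (F : BHom X X') : Prop :=
  ∃ f : BTup X X', F = mk f ∧ ∀ p, f.tup.M.lab p = none

end BHom

/-- The symmetric monoidal category of open-closed bordisms in dimension `n + 1` over the cartesian
space `U`, for the one-point target space with brane labels `I`. -/
def bord (n : ℕ) [NeZero n] (I : Type) (U : Cart) : SMData.{1} where
  Ob := BObj n I U
  Hom := BHom
  Comp F G H := ∃ f g h, F = BHom.mk f ∧ G = BHom.mk g ∧ H = BHom.mk h ∧ BTup.IsGluing f g h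
  idn X := BHom.ofIso (ObjIso.refl X.base) fun _ _ => rfl
  ten := BObj.ten
  TenHom F G H := ∃ f g h, F = BHom.mk f ∧ G = BHom.mk g ∧ H = BHom.mk h ∧ BTup.IsDisjUnion f g h
  one := BObj.one n I U
  assoc X Y Z := BHom.ofIso (ObjIso.assoc X.base Y.base Z.base) (by rintro u ((y | y) | y) <;> rfl)
  lunit X := BHom.ofIso (ObjIso.lunit X.base) (by rintro u (y | y); exacts [isEmptyElim y, rfl])
  runit X := BHom.ofIso (ObjIso.runit X.base) (by rintro u (y | y); exacts [rfl, isEmptyElim y])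
  swap X Y := BHom.ofIso (ObjIso.swap X.base Y.base) (by rintro u (y | y) <;> rfl)

end Geometry

section FieldTheories

open scoped TensorProduct

section Pull

variable {n : ℕ} [NeZero n] {I : Type} {U V : Cart}

theorem BTup.IsGluing.pull (g : V ⟶ U) {X Y Z : BObj n I U} {f : BTup X Y} {f' : BTup Y Z}
    {h : BTup X Z} (H : BTup.IsGluing f f' h) : BTup.IsGluing (f.pull g) (f'.pull g) (h.pull g) := by
  obtain ⟨j, j', h1, h2, h3, h4, h5, h6, h7, h8, h9, h10, h11, h12, h13, h14, h15⟩ := H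
  exact ⟨j, j', h1, h2, h3, h4, h5, h6, h7, h8, h9, h10, h11, h12, h13, fun _ => h14 _, fun _ => h15 _⟩

theorem BTup.IsDisjUnion.pull (g : V ⟶ U) {X X' Y Y' : BObj n I U} {f : BTup X X'} {f' : BTup Y Y'}
    {h : BTup (X.ten Y) (X'.ten Y')} (H : BTup.IsDisjUnion f f' h) :
    BTup.IsDisjUnion (f.pull g) (f'.pull g) (h.pull g : BTup ((X.pull g).ten (Y.pull g)) _) := by
  obtain ⟨j, j', h1, h2, h3, h4, h5, h6, h7, h8, h9, h10, h11, h12, h13, h14, h15⟩ := H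
  exact ⟨j, j', h1, h2, h3, h4, h5, h6, h7, h8, h9, h10, h11, h12, h13, fun _ => h14 _, fun _ => h15 _⟩

theorem bord_comp_pull (g : V ⟶ U) {X Y Z : BObj n I U} {F : BHom X Y} {G : BHom Y Z} {H : BHom X Z}
    (h : (bord n I U).Comp F G H) : (bord n I V).Comp (F.pull g) (G.pull g) (H.pull g) := by
  obtain ⟨f, f', k, rfl, rfl, rfl, h⟩ := h
  exact ⟨f.pull g, f'.pull g, k.pull g, rfl, rfl, rfl, h.pull g⟩

theorem bord_ten_pull (g : V ⟶ U) {X X' Y Y' : BObj n I U} {F : BHom X X'} {G : BHom Y Y'}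
    {H : BHom (X.ten Y) (X'.ten Y')}
    (h : (bord n I U).TenHom F G H) : (bord n I V).TenHom (F.pull g) (G.pull g)
      (H.pull g : BHom ((X.pull g).ten (Y.pull g)) ((X'.pull g).ten (Y'.pull g))) := by
  obtain ⟨f, f', k, rfl, rfl, rfl, h⟩ := h
  exact ⟨f.pull g, f'.pull g, k.pull g, rfl, rfl, rfl, h.pull g⟩

variable {D : Type u₁} [Category.{v₁} D] [MonoidalCategory D] [SymmetricCategory D]

/-- Precomposition with the pullback of bordisms along `g`. -/
def preObj (g : V ⟶ U) (F : SMFun (bord n I V) D) : SMFun (bord n I U) D where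
  obj X := F.obj (BObj.pull g X)
  map f := F.map (BHom.pull g f)
  map_idn X := F.map_idn (BObj.pull g X)
  map_comp _ _ _ H := F.map_comp _ _ _ (bord_comp_pull g H)
  mapOne := F.mapOne
  mapTen X Y := F.mapTen (BObj.pull g X) (BObj.pull g Y)
  μ_nat _ _ _ H := F.μ_nat _ _ _ (bord_ten_pull g H)
  μ_assoc X Y Z := F.μ_assoc (BObj.pull g X) (BObj.pull g Y) (BObj.pull g Z)
  μ_lunit X := F.μ_lunit (BObj.pull g X)
  μ_runit X := F.μ_runit (BObj.pull g X)
  μ_swap X Y := F.μ_swap (BObj.pull g X) (BObj.pull g Y)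

variable (n I D) in
/-- Precomposition with the pullback of bordisms along `g`. -/
def pre (g : V ⟶ U) : SMFun (bord n I V) D ⥤ SMFun (bord n I U) D where
  obj := preObj g
  map a :=
    { app := fun X => a.app (BObj.pull g X)
      nat := fun f => a.nat (BHom.pull g f)
      app_one := a.app_one
      app_ten := fun X Y => a.app_ten (BObj.pull g X) (BObj.pull g Y) }
  map_id _ := rfl
  map_comp _ _ := rfl

instance (g : V ⟶ U) : (pre n I D g).Monoidal :=
  Functor.CoreMonoidal.toMonoidal
    { εIso := SMFun.isoMk (fun _ => Iso.refl (𝟙_ D)) (fun _ => rfl) (Category.comp_id (𝟙 (𝟙_ D)))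
        (fun _ _ => by
          change (λ_ (𝟙_ D)).hom ≫ 𝟙 (𝟙_ D) = (𝟙 (𝟙_ D) ⊗ₘ 𝟙 (𝟙_ D)) ≫ (λ_ (𝟙_ D)).hom
          simp)
      μIso := fun F G => SMFun.isoMk (fun X => Iso.refl (F.obj (BObj.pull g X) ⊗ G.obj (BObj.pull g X)))
        (fun f => (Category.comp_id _).trans (Category.id_comp _).symm)
        (Category.comp_id _)
        (fun X Y => by
          change (((pre n I D g).obj F ⊗ (pre n I D g).obj G).mapTen X Y).hom ≫ 𝟙 _ =
            (𝟙 _ ⊗ₘ 𝟙 _) ≫ (((pre n I D g).obj F ⊗ (pre n I D g).obj G).mapTen X Y).hom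
          rw [Category.comp_id, MonoidalCategory.id_tensorHom_id, Category.id_comp])
      μIso_hom_natural_left := fun a G => by
        ext X; exact (Category.comp_id _).trans (Category.id_comp _).symm
      μIso_hom_natural_right := fun F b => by
        ext X; exact (Category.comp_id _).trans (Category.id_comp _).symm
      associativity := fun F G H => by
        ext X
        change 𝟙 (F.obj (BObj.pull g X) ⊗ G.obj (BObj.pull g X)) ▷ H.obj (BObj.pull g X) ≫ 𝟙 _ ≫
          (α_ (F.obj (BObj.pull g X)) (G.obj (BObj.pull g X)) (H.obj (BObj.pull g X))).hom =
          (α_ (F.obj (BObj.pull g X)) (G.obj (BObj.pull g X)) (H.obj (BObj.pull g X))).hom ≫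
          F.obj (BObj.pull g X) ◁ 𝟙 (G.obj (BObj.pull g X) ⊗ H.obj (BObj.pull g X)) ≫ 𝟙 _
        simp
      left_unitality := fun F => by
        ext X
        change (λ_ (F.obj (BObj.pull g X))).hom = 𝟙 (𝟙_ D) ▷ F.obj (BObj.pull g X) ≫ 𝟙 _ ≫
          (λ_ (F.obj (BObj.pull g X))).hom
        simp
      right_unitality := fun F => by
        ext X
        change (ρ_ (F.obj (BObj.pull g X))).hom = F.obj (BObj.pull g X) ◁ 𝟙 (𝟙_ D) ≫ 𝟙 _ ≫
          (ρ_ (F.obj (BObj.pull g X))).hom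
        simp }

instance (g : V ⟶ U) : (pre n I D g).Braided where
  braided F G := by
    ext X
    change 𝟙 _ ≫ (β_ (F.obj (BObj.pull g X)) (G.obj (BObj.pull g X))).hom =
      (β_ (F.obj (BObj.pull g X)) (G.obj (BObj.pull g X))).hom ≫ 𝟙 _
    simp

end Pull

/-! ### Field theories -/

section OCFFT

variable (n : ℕ) [NeZero n] (I : Type)

/-- The category of open-closed topological field theories of dimension `n + 1` with brane labels
`I`: symmetric monoidal functors from the bordism category over the point to vector spaces. -/
abbrev OCTQFT : Type 1 := SMFun (bord n I Cart.pt) (FGModuleCat.{0} ℂ)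

/-- Families of field theories over all cartesian spaces. -/
abbrev Fam : Type 1 := ∀ U : Cart, SMFun (bord n I U) (VBun U)

/-- Pairs of cartesian spaces with a map between them. -/
structure CartMap where
  src : Cart
  dst : Cart
  map : src ⟶ dst

/-- Symmetric monoidal functors from bordisms over the target to bundles over the source of `g`. -/
abbrev Val (g : CartMap) : Type 1 := SMFun (bord n I g.dst) (VBun g.src)

/-- The functors `Y ↦ Z_V (g^* Y)`. -/
abbrev preAll : Fam n I ⥤ ∀ g : CartMap, Val n I g :=
  Functor.pi' fun g => Pi.eval (fun U : Cart => SMFun (bord n I U) (VBun U)) g.src ⋙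
    pre n I (VBun g.src) g.map

/-- The functors `Y ↦ g^* (Z_U Y)`. -/
abbrev postAll : Fam n I ⥤ ∀ g : CartMap, Val n I g :=
  Functor.pi' fun g => Pi.eval (fun U : Cart => SMFun (bord n I U) (VBun U)) g.dst ⋙
    SMFun.post (bord n I g.dst) (VBun.pull g.map)

/-- Families of symmetric monoidal functors `Z_U` with monoidal natural isomorphisms
`Z_V (g^* Y) ≅ g^* (Z_U Y)`, for all `g : V ⟶ U`. -/
abbrev PreOCFFT : Type 1 := IsoIns (preAll n I) (postAll n I)

end OCFFT

namespace PreOCFFT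

variable {n : ℕ} [NeZero n] {I : Type}

/-- The component `Z_V (g^* Y)_v ⟶ Z_U (Y)_(g v)` of the isomorphism `Z_V (g^* Y) ≅ g^* (Z_U Y)`. -/
def cmp (Z : PreOCFFT n I) {V U : Cart} (g : V ⟶ U) (Y : BObj n I U) (v : V.Pt) :
    ((Z.obj V).obj (Y.pull g)).fib v ⟶ ((Z.obj U).obj Y).fib (Cart.Hom.toFun g v) :=
  VBun.Hom.map (SMFun.Hom.app (Z.iso.hom ⟨V, U, g⟩) Y) v

theorem cmp_tensor (Z Z' : PreOCFFT n I) {V U : Cart} (g : V ⟶ U) (Y : BObj n I U) (v : V.Pt) :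
    cmp (Z ⊗ Z') g Y v = cmp Z g Y v ⊗ₘ cmp Z' g Y v := by
  change (𝟙 _ ≫ 𝟙 _) ≫ (cmp Z g Y v ⊗ₘ cmp Z' g Y v) ≫ 𝟙 _ ≫ 𝟙 _ = _
  simp

theorem cmp_unit {V U : Cart} (g : V ⟶ U) (Y : BObj n I U) (v : V.Pt) :
    cmp (𝟙_ (PreOCFFT n I)) g Y v = 𝟙 (𝟙_ (FGModuleCat.{0} ℂ)) := by
  change (𝟙 _ ≫ 𝟙 _) ≫ 𝟙 (𝟙_ (FGModuleCat.{0} ℂ)) ≫ 𝟙 _ = _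
  simp

variable (n I) in
/-- The isomorphisms `Z_V (g^* Y) ≅ g^* (Z_U Y)` are coherent: `Z` is a morphism of presheaves of
symmetric monoidal categories. -/
def IsCoherent : ObjectProperty (PreOCFFT n I) := fun Z =>
  (∀ (U : Cart) (Y : BObj n I U) (u : U.Pt), cmp Z (𝟙 U) Y u = 𝟙 (((Z.obj U).obj Y).fib u)) ∧
  ∀ (W V U : Cart) (h : W ⟶ V) (g : V ⟶ U) (Y : BObj n I U) (w : W.Pt),
    cmp Z (h ≫ g) Y w = cmp Z h (Y.pull g) w ≫ cmp Z g Y (Cart.Hom.toFun h w)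

instance : (IsCoherent n I).IsMonoidal where
  prop_unit := by
    refine ⟨fun U Y u => cmp_unit _ _ _, fun W V U h g Y w => ?_⟩
    rw [cmp_unit, cmp_unit, cmp_unit]
    exact (Category.comp_id (𝟙 (𝟙_ (FGModuleCat.{0} ℂ)))).symm
  prop_tensor Z Z' hZ hZ' := by
    refine ⟨fun U Y u => ?_, fun W V U h g Y w => ?_⟩
    · rw [cmp_tensor, hZ.1, hZ'.1]
      exact MonoidalCategory.id_tensorHom_id _ _
    · rw [cmp_tensor, cmp_tensor, cmp_tensor, hZ.2, hZ'.2]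
      exact (MonoidalCategory.tensorHom_comp_tensorHom _ _ _ _).symm

end PreOCFFT

/-- The category of smooth open-closed functorial field theories of dimension `n + 1` on the
one-point target space with brane labels `I`: morphisms of presheaves of symmetric monoidal
categories from bordisms to vector bundles, and their 2-morphisms. -/
abbrev OCFFT (n : ℕ) [NeZero n] (I : Type) : Type 1 := (PreOCFFT.IsCoherent n I).FullSubcategory

/-- Evaluation at the one-point space. -/
abbrev evPt (n : ℕ) [NeZero n] (I : Type) : OCFFT n I ⥤ OCTQFT n I :=
  ((PreOCFFT.IsCoherent n I).ι ⋙ IsoIns.forget (preAll n I) (postAll n I)) ⋙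
    Pi.eval (fun U : Cart => SMFun (bord n I U) (VBun U)) Cart.pt ⋙
    SMFun.post (bord n I Cart.pt) (VBun.fibre Cart.star)

/-- A symmetric monoidal functor is a symmetric monoidal equivalence if and only if the underlying
functor is an equivalence of categories. -/
def IsSymMonEquivalence {C : Type u₁} [Category.{v₁} C] [MonoidalCategory C] [SymmetricCategory C]
    {D : Type u₂} [Category.{v₂} D] [MonoidalCategory D] [SymmetricCategory D] (K : C ⥤ D)
    [K.Braided] : Prop :=
  K.IsEquivalence

/-! ### Restriction to full subcategories -/

section Restrict

variable {C : Type u₁} [Category.{v₁} C] {D : Type u₂} [Category.{v₂} D]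

/-- The restriction of a functor to full subcategories. -/
def restrict (K : C ⥤ D) (P : ObjectProperty C) (Q : ObjectProperty D)
    (h : ∀ X, P X → Q (K.obj X)) : P.FullSubcategory ⥤ Q.FullSubcategory :=
  Q.lift (P.ι ⋙ K) fun X => h X.obj X.property

variable [MonoidalCategory C] [SymmetricCategory C] [MonoidalCategory D] [SymmetricCategory D]
  (K : C ⥤ D) [K.Braided] (P : ObjectProperty C) (Q : ObjectProperty D)
  [P.IsMonoidal] [Q.IsMonoidal] (h : ∀ X, P X → Q (K.obj X))

instance : (restrict K P Q h).Monoidal :=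
  Functor.CoreMonoidal.toMonoidal
    { εIso := Q.isoMk (Functor.Monoidal.εIso K)
      μIso := fun X Y => Q.isoMk (Functor.Monoidal.μIso K X.obj Y.obj)
      μIso_hom_natural_left := fun f X => by
        ext; exact Functor.LaxMonoidal.μ_natural_left K f.hom X.obj
      μIso_hom_natural_right := fun X f => by
        ext; exact Functor.LaxMonoidal.μ_natural_right K X.obj f.hom
      associativity := fun X Y Z => by
        ext; exact Functor.LaxMonoidal.associativity K X.obj Y.obj Z.obj
      left_unitality := fun X => by
        ext; exact Functor.LaxMonoidal.left_unitality K X.obj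
      right_unitality := fun X => by
        ext; exact Functor.LaxMonoidal.right_unitality K X.obj }

instance : (restrict K P Q h).Braided where
  braided X Y := by
    ext; exact Functor.LaxBraided.braided (F := K) X.obj Y.obj

end Restrict

/-! ### Reflection structures -/

section Reflection

variable {n : ℕ} [NeZero n] {I : Type} {U : Cart}
  {D : Type u₁} [Category.{v₁} D] [MonoidalCategory D] [SymmetricCategory D]

/-- Let `K` be an involution of `D`, with `K² ≅ id` given by `κ`. The isomorphisms `α` form a
homotopy fixed point structure on `F`: a monoidal natural isomorphism `F ∘ op ≅ K ∘ F` which is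
compatible with `op² ≅ id` and `K² ≅ id`. -/
def IsReflection (F : SMFun (bord n I U) D) (K : D ⥤ D) [K.Braided]
    (κ : ∀ X, K.obj (K.obj X) ≅ X) (α : ∀ Y : BObj n I U, F.obj Y.op ≅ K.obj (F.obj Y)) : Prop :=
  (∀ (Y Y' : BObj n I U) (f : BHom Y Y'),
    F.map (BHom.op f) ≫ (α Y').hom = (α Y).hom ≫ K.map (F.map f)) ∧
  F.mapOne.hom ≫ F.map (BHom.opOne n I U) ≫ (α (BObj.one n I U)).hom =
    Functor.LaxMonoidal.ε K ≫ K.map F.mapOne.hom ∧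
  (∀ Y Y' : BObj n I U, (F.mapTen Y.op Y'.op).hom ≫ F.map (BHom.opTen Y Y') ≫ (α (Y.ten Y')).hom =
    ((α Y).hom ⊗ₘ (α Y').hom) ≫ Functor.LaxMonoidal.μ K _ _ ≫ K.map (F.mapTen Y Y').hom) ∧
  ∀ Y : BObj n I U, (α Y.op).hom ≫ K.map (α Y).hom ≫ (κ (F.obj Y)).hom = F.map (BHom.opOp Y)

/-- The hermitean pairing on `F Y` induced by the canonical hermitean structure of `Y`. -/
def hermPairing (F : SMFun (bord n I U) D) (K : D ⥤ D)
    (α : ∀ Y : BObj n I U, F.obj Y.op ≅ K.obj (F.obj Y)) (Y : BObj n I U) :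
    K.obj (F.obj Y) ⊗ F.obj Y ⟶ 𝟙_ D :=
  (((α Y).inv ≫ F.map (BHom.flat Y)) ▷ F.obj Y) ≫ (F.mapTen Y.dual Y).hom ≫ F.map (BHom.ev Y) ≫
    F.mapOne.inv

/-- A sesquilinear form is positive definite. -/
def IsPosDef {V : FGModuleCat.{0} ℂ} (h : conjFun.obj V ⊗ V ⟶ 𝟙_ (FGModuleCat.{0} ℂ)) : Prop :=
  ∀ v : V, v ≠ 0 → ∃ r : ℝ, 0 < r ∧ h.hom.hom (VBun.elt (VBun.eltConj v) v) = (r : ℂ)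

end Reflection

/-- Evaluation of field theories at an object. -/
def evalB {n : ℕ} [NeZero n] {I : Type} {U : Cart} (D : Type u₁) [Category.{v₁} D]
    [MonoidalCategory D] [SymmetricCategory D] (Y : BObj n I U) : SMFun (bord n I U) D ⥤ D :=
  SMFun.evalAt (B := bord n I U) D Y

instance {n : ℕ} [NeZero n] {I : Type} {U : Cart} (D : Type u₁) [Category.{v₁} D]
    [MonoidalCategory D] [SymmetricCategory D] (Y : BObj n I U) : (evalB D Y).Monoidal :=
  SMFun.instMonoidalEvalAt (B := bord n I U) (D := D) Y

instance {n : ℕ} [NeZero n] {I : Type} {U : Cart} (D : Type u₁) [Category.{v₁} D]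
    [MonoidalCategory D] [SymmetricCategory D] (Y : BObj n I U) : (evalB D Y).Braided :=
  SMFun.instBraidedEvalAt (B := bord n I U) (D := D) Y

section ReflectionCategories

variable (n : ℕ) [NeZero n] (I : Type)

/-- The functor `Z ↦ (Z (op Y))_Y`. -/
def topOp : OCTQFT n I ⥤ (BObj n I Cart.pt → FGModuleCat.{0} ℂ) :=
  Functor.pi' fun Y => evalB (FGModuleCat.{0} ℂ) Y.op

/-- The functor sending `Z` to the conjugates of `Z Y`, for all `Y`. -/
def topConj : OCTQFT n I ⥤ (BObj n I Cart.pt → FGModuleCat.{0} ℂ) :=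
  Functor.pi' fun Y => evalB (FGModuleCat.{0} ℂ) Y ⋙ conjFun

instance : (topOp n I).Braided := inferInstanceAs
  (Functor.pi' fun Y : BObj n I Cart.pt => evalB (FGModuleCat.{0} ℂ) Y.op).Braided

instance : (topConj n I).Braided := inferInstanceAs
  (Functor.pi' fun Y : BObj n I Cart.pt => evalB (FGModuleCat.{0} ℂ) Y ⋙ conjFun).Braided

/-- Pairs of an OCTQFT `Z` and isomorphisms `α_Y` from `Z (op Y)` to the conjugate of `Z Y`; the
morphisms are the monoidal natural transformations which intertwine these isomorphisms. -/
abbrev PreRefTQFT : Type 1 := IsoIns (topOp n I) (topConj n I)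

/-- The value of a smooth field theory on `U`. -/
abbrev valAt (U : Cart) : OCFFT n I ⥤ SMFun (bord n I U) (VBun U) :=
  ((PreOCFFT.IsCoherent n I).ι ⋙ IsoIns.forget (preAll n I) (postAll n I)) ⋙
    Pi.eval (fun U : Cart => SMFun (bord n I U) (VBun U)) U

/-- Pairs of a cartesian space `U` and an object over `U`. -/
structure CartObj where
  space : Cart
  obj : BObj n I space

/-- The functor `Z ↦ (Z_U (op Y))_(U, Y)`. -/
def fftOp : OCFFT n I ⥤ ∀ A : CartObj n I, VBun A.space :=
  Functor.pi' fun A => valAt n I A.space ⋙ evalB (VBun A.space) A.obj.op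

/-- The functor sending `Z` to the conjugates of `Z_U Y`, for all `U` and `Y`. -/
def fftConj : OCFFT n I ⥤ ∀ A : CartObj n I, VBun A.space :=
  Functor.pi' fun A => valAt n I A.space ⋙ evalB (VBun A.space) A.obj ⋙ VBun.conj A.space

instance : (fftOp n I).Braided := inferInstanceAs
  (Functor.pi' fun A : CartObj n I => valAt n I A.space ⋙ evalB (VBun A.space) A.obj.op).Braided

instance : (fftConj n I).Braided := inferInstanceAs
  (Functor.pi' fun A : CartObj n I =>
    valAt n I A.space ⋙ evalB (VBun A.space) A.obj ⋙ VBun.conj A.space).Braided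

/-- Pairs of a smooth OCFFT `Z` and isomorphisms `α_{U, Y}` from `Z_U (op Y)` to the conjugate of
`Z_U Y`; the morphisms are the morphisms of OCFFTs which intertwine these isomorphisms. -/
abbrev PreRefFFT : Type 1 := IsoIns (fftOp n I) (fftConj n I)

instance : SymmetricCategory (PreRefFFT n I) :=
  IsoIns.instSymmetricCategory (P := fftOp n I) (Q := fftConj n I)

variable {n I}

/-- The isomorphism `Z (op Y) ≅ conj (Z Y)`. -/
def PreRefTQFT.α (Z : PreRefTQFT n I) (Y : BObj n I Cart.pt) :
    Z.obj.obj Y.op ≅ conjFun.obj (Z.obj.obj Y) :=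
  (Pi.eval (fun _ : BObj n I Cart.pt => FGModuleCat.{0} ℂ) Y).mapIso Z.iso

/-- The isomorphism `Z_U (op Y) ≅ conj (Z_U Y)`. -/
def PreRefFFT.α (Z : PreRefFFT n I) (U : Cart) (Y : BObj n I U) :
    ((valAt n I U).obj Z.obj).obj Y.op ≅ (VBun.conj U).obj (((valAt n I U).obj Z.obj).obj Y) :=
  (Pi.eval (fun A : CartObj n I => VBun A.space) ⟨U, Y⟩).mapIso Z.iso

variable (n I)

/-- Reflection-positive OCTQFTs. -/
def IsRPTQFT : ObjectProperty (PreRefTQFT n I) := fun Z =>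
  IsReflection Z.obj conjFun conjConj Z.α ∧ ∀ Y, IsPosDef (hermPairing Z.obj conjFun Z.α Y)

/-- Reflection-positive smooth OCFFTs: the isomorphisms `α` form a reflection structure over each
cartesian space, they are compatible with pullbacks, and the induced hermitean structures on the
vector bundles `Z_U Y` are positive definite. -/
def IsRPFFT : ObjectProperty (PreRefFFT n I) := fun Z =>
  (∀ U, IsReflection ((valAt n I U).obj Z.obj) (VBun.conj U) VBun.conjConj (Z.α U)) ∧
  (∀ (V U : Cart) (g : V ⟶ U) (Y : BObj n I U) (v : V.Pt),
    PreOCFFT.cmp Z.obj.obj g Y.op v ≫ VBun.Hom.map (Z.α U Y).hom (Cart.Hom.toFun g v) =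
      VBun.Hom.map (Z.α V (Y.pull g)).hom v ≫ conjFun.map (PreOCFFT.cmp Z.obj.obj g Y v)) ∧
  ∀ (U : Cart) (Y : BObj n I U) (u : U.Pt), IsPosDef (V := (((valAt n I U).obj Z.obj).obj Y).fib u)
    (VBun.Hom.map (hermPairing ((valAt n I U).obj Z.obj) (VBun.conj U) (Z.α U) Y) u)

/-- Invertible OCTQFTs. -/
def IsInvTQFT : ObjectProperty (OCTQFT n I) := fun Z =>
  (∀ Y : BObj n I Cart.pt, Y.IsClosed → Module.finrank ℂ (Z.obj Y) = 1) ∧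
  ∀ (Y Y' : BObj n I Cart.pt) (F : BHom Y Y'), F.NoBrane → IsIso (Z.map F)

/-- Invertible smooth OCFFTs. -/
def IsInvFFT : ObjectProperty (OCFFT n I) := fun Z => ∀ U : Cart,
  (∀ Y : BObj n I U, Y.IsClosed → ∀ u, Module.finrank ℂ ((((valAt n I U).obj Z).obj Y).fib u) = 1) ∧
  ∀ (Y Y' : BObj n I U) (F : BHom Y Y'), F.NoBrane → IsIso (((valAt n I U).obj Z).map F)

/-- Invertible reflection-positive OCTQFTs. -/
def IsInvRPTQFT : ObjectProperty (PreRefTQFT n I) := fun Z => IsRPTQFT n I Z ∧ IsInvTQFT n I Z.obj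

/-- Invertible reflection-positive smooth OCFFTs. -/
def IsInvRPFFT : ObjectProperty (PreRefFFT n I) := fun Z => IsRPFFT n I Z ∧ IsInvFFT n I Z.obj

/-- Evaluation at the one-point space, for theories with reflection structures. -/
def evRef : PreRefFFT n I ⥤ PreRefTQFT n I where
  obj Z := ⟨(evPt n I).obj Z.obj, Pi.isoMk fun Y => (VBun.fibre Cart.star).mapIso (Z.α Cart.pt Y)⟩
  map {Z Z'} f := ⟨(evPt n I).map f.hom, by
    funext Y
    have := congrFun f.w ⟨Cart.pt, Y⟩
    exact congrArg (fun k => VBun.Hom.map k Cart.star) this⟩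
  map_id Z := by ext : 1; exact (evPt n I).map_id _
  map_comp f g := by ext : 1; exact (evPt n I).map_comp _ _

end ReflectionCategories

section EvRef

variable (n : ℕ) [NeZero n] (I : Type)

theorem evRef_unit_w (Y : BObj n I Cart.pt) :
    SMFun.Hom.app (Functor.LaxMonoidal.ε (evPt n I)) Y.op ≫
      (PreRefTQFT.α ((evRef n I).obj (𝟙_ (PreRefFFT n I))) Y).hom =
    (PreRefTQFT.α (𝟙_ (PreRefTQFT n I)) Y).hom ≫
      conjFun.map (SMFun.Hom.app (Functor.LaxMonoidal.ε (evPt n I)) Y) := by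
  ext : 1; ext; rfl

theorem evRef_ten_w (X X' : PreRefFFT n I) (Y : BObj n I Cart.pt) :
    SMFun.Hom.app (Functor.LaxMonoidal.μ (evPt n I) X.obj X'.obj) Y.op ≫
      (PreRefTQFT.α ((evRef n I).obj (X ⊗ X')) Y).hom =
    (PreRefTQFT.α ((evRef n I).obj X ⊗ (evRef n I).obj X') Y).hom ≫
      conjFun.map (SMFun.Hom.app (Functor.LaxMonoidal.μ (evPt n I) X.obj X'.obj) Y) := by
  ext : 1; apply TensorProduct.ext'; intro v w; rfl

instance : (evRef n I).Monoidal :=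
  Functor.CoreMonoidal.toMonoidal
    { εIso := IsoIns.isoMk (Functor.Monoidal.εIso (evPt n I)) (by
        funext Y; exact evRef_unit_w n I Y)
      μIso := fun X X' => IsoIns.isoMk (Functor.Monoidal.μIso (evPt n I) X.obj X'.obj) (by
        funext Y; exact evRef_ten_w n I X X' Y)
      μIso_hom_natural_left := fun f X => by
        ext : 1; exact Functor.LaxMonoidal.μ_natural_left (evPt n I) f.hom X.obj
      μIso_hom_natural_right := fun X f => by
        ext : 1; exact Functor.LaxMonoidal.μ_natural_right (evPt n I) X.obj f.hom
      associativity := fun X Y Z => by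
        ext : 1; exact Functor.LaxMonoidal.associativity (evPt n I) X.obj Y.obj Z.obj
      left_unitality := fun X => by
        ext : 1; exact Functor.LaxMonoidal.left_unitality (evPt n I) X.obj
      right_unitality := fun X => by
        ext : 1; exact Functor.LaxMonoidal.right_unitality (evPt n I) X.obj }

instance : (evRef n I).Braided where
  braided X Y := by
    ext : 1; exact (inferInstance : (evPt n I).Braided).toLaxBraided.braided X.obj Y.obj

end EvRef

/-- The functor `K` restricts to an equivalence of symmetric monoidal categories between the full
symmetric monoidal subcategories given by `P` and `Q`. -/
def RestrictsToEquivalence {C : Type u₁} [Category.{v₁} C] [MonoidalCategory C]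
    [SymmetricCategory C] {D : Type u₂} [Category.{v₂} D] [MonoidalCategory D] [SymmetricCategory D]
    (K : C ⥤ D) [K.Braided] (P : ObjectProperty C) (Q : ObjectProperty D) : Prop :=
  ∃ (_ : P.IsMonoidal) (_ : Q.IsMonoidal) (h : ∀ X, P X → Q (K.obj X)),
    IsSymMonEquivalence (restrict K P Q h)

end FieldTheories

end

/-!
The target of the bordisms is a point, so an object or a bordism over `U` carries no data which vary
with `U`. Forgetting `U` (`BObj.atPt`, `BHom.atPt`) is a strict inverse of the pullback along the
collapse map `U ⟶ pt`: an equivalence of bordisms over `U` restricts to one over a point of `U`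
(`BTup.Rel.atPt`), and the pullback of an equivalence is one. This identifies the bordisms over all
cartesian spaces with those over the point, compatibly with composition and disjoint union.

A topological theory `F` extends to the smooth theory `constFFT F`, whose bundles are constant with
fibres the values of `F` and whose comparison isomorphisms are identities. Thus evaluation at the
point is essentially surjective. For a general smooth theory `Z`, the comparison isomorphism of
the collapse map of `U` identifies the bundle of `Y` over `U` fibrewise with the value of `Z` at `Y`
over the point. A morphism of smooth theories commutes with these identifications, so it is
determined by its value over the point (`PreOCFFT.comp_eq`); conversely conjugation by them extends
a transformation over the point to all `U`, and the cocycle condition for the comparison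
isomorphisms makes the result compatible with pullbacks (`extend`).

Invertibility and reflection positivity are conditions on the fibres which hold for `Z` over the
point, and for a constant extension if they hold for the original theory. Morphisms extended from
the point intertwine the reflections since the comparison isomorphisms do (`evRef_full`). It remains
that these classes of theories are closed under tensor products. For positivity, the pairing of
`Z ⊗ Z'` is the tensor product of the two pairings (`hermPairing_tensor`), a positive definite
sesquilinear form is an inner product by polarization (`innerCore`), and the tensor product of inner
products is an inner product (`tensor_posDef`).
-/

noncomputable section

open CategoryTheory MonoidalCategory

/-! ### Pullback of bordisms along maps of cartesian spaces -/

namespace Cart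

/-- A map from the one-point space, i.e. a choice of a point of `U`. -/
def point (U : Cart) : pt ⟶ U := Hom.mk (fun _ => U.chart 0) (by simpa using contDiff_const)

instance : Subsingleton pt.Pt :=
  ⟨fun _ _ => Subtype.ext (Subsingleton.elim (α := EuclideanSpace ℝ (Fin 0)) _ _)⟩

theorem smoothAt_of_const {U : Cart} {g : U.Pt → ℂ} (h : ∀ y y', g y = g y') (x : U.Pt) :
    SmoothAt g x :=
  (smoothAt_const (g x) x).congr isOpen_univ trivial fun _ _ => h _ _

end Cart

section Restriction

variable {n : ℕ} [NeZero n] {I : Type} {U V : Cart}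

/-- The object over the point underlying an object over `U`. The map to the target is written as a
constant function: then `X.atPt.pull U.collapse` and `X` agree definitionally, by the `η`-rule for
`Unit`, which would fail for the pullback of `X` along a point of `U`. -/
def BObj.atPt (X : BObj n I U) : BObj n I Cart.pt := ⟨X.base, fun _ _ => ()⟩

/-- The bordism over the point underlying a bordism over `U`. -/
def BTup.atPt {X X' : BObj n I U} (f : BTup X X') : BTup X.atPt X'.atPt :=
  ⟨f.tup, fun _ _ => (), fun _ _ _ => rfl, fun _ _ _ => rfl⟩

/-- An equivalence of bordisms over `U` restricts to an equivalence over any point of `U`. -/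
theorem BTup.Rel.atPt {X X' : BObj n I U} {f f' : BTup X X'} (h : Rel f f') :
    Rel f.atPt f'.atPt := by
  obtain ⟨Ψ, Ψ', h1, h2, h3, h4, h5, h6, h7, ⟨W, a, b, c, h8⟩, ⟨W', a', b', c', h9⟩⟩ :=
    h.pull U.point
  exact ⟨Ψ, Ψ', h1, h2, h3, h4, h5, h6, fun _ _ => rfl, ⟨W, a, b, c, h8⟩, ⟨W', a', b', c', h9⟩⟩

/-- The morphism over the point underlying a morphism over `U`. -/
def BHom.atPt {X X' : BObj n I U} (F : BHom X X') : BHom X.atPt X'.atPt :=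
  Quotient.map BTup.atPt (fun _ _ h => BTup.Rel.atPt h) F

theorem BHom.atPt_pull (g : V ⟶ U) {X X' : BObj n I U} (F : BHom X X') :
    BHom.atPt (BHom.pull g F) = BHom.atPt F := by
  induction F using Quotient.ind; rfl

theorem BHom.atPt_eq {X X' : BObj n I Cart.pt} (F : BHom X X') : BHom.atPt F = F := by
  induction F using Quotient.ind; rfl

/-- Passing to the point and pulling back along the collapse map are mutually inverse, strictly, by
this lemma, `BHom.atPt_pull` and `BHom.atPt_eq`: with target a point, a bordism over `U` carries no
data which varies with `U`. -/
theorem BHom.pull_atPt (U : Cart) {X X' : BObj n I U} (F : BHom X X') :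
    BHom.pull U.collapse (BHom.atPt F) = F := by
  induction F using Quotient.ind; rfl

theorem BHom.atPt_op {X X' : BObj n I U} (F : BHom X X') :
    BHom.atPt (BHom.op F) = BHom.op (BHom.atPt F) := by
  induction F using Quotient.ind; rfl

theorem BHom.NoBrane.atPt {X X' : BObj n I U} {F : BHom X X'} (h : F.NoBrane) :
    (BHom.atPt F).NoBrane := by
  obtain ⟨f, rfl, hf⟩ := h
  exact ⟨f.atPt, rfl, hf⟩

theorem BObj.pull_collapse_bijective (n : ℕ) [NeZero n] (I : Type) (U : Cart) :
    Function.Bijective (fun X : BObj n I Cart.pt => X.pull U.collapse) :=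
  ⟨fun X X' h => congrArg (BObj.atPt (U := U)) (show X.pull U.collapse = X'.pull U.collapse from h),
    fun X => ⟨X.atPt, rfl⟩⟩

theorem BHom.pull_collapse_bijective (U : Cart) (X X' : BObj n I Cart.pt) :
    Function.Bijective (fun F : BHom X X' => F.pull U.collapse) := by
  refine ⟨fun F F' h => ?_, fun F => ?_⟩
  swap
  · exact ⟨BHom.atPt (X := X.pull U.collapse) (X' := X'.pull U.collapse) F,
      BHom.pull_atPt (X := X.pull U.collapse) (X' := X'.pull U.collapse) U F⟩
  have := congrArg BHom.atPt (show F.pull U.collapse = F'.pull U.collapse from h)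
  exact (BHom.atPt_eq F).symm.trans ((BHom.atPt_pull U.collapse F).symm.trans
    (this.trans ((BHom.atPt_pull U.collapse F').trans (BHom.atPt_eq F'))))

theorem BTup.IsGluing.atPt {X Y Z : BObj n I U} {f : BTup X Y} {f' : BTup Y Z}
    {h : BTup X Z} (H : BTup.IsGluing f f' h) : BTup.IsGluing f.atPt f'.atPt h.atPt := by
  obtain ⟨j, j', h1, h2, h3, h4, h5, h6, h7, h8, h9, h10, h11, h12, h13, -, -⟩ := H
  exact ⟨j, j', h1, h2, h3, h4, h5, h6, h7, h8, h9, h10, h11, h12, h13, fun _ _ => rfl,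
    fun _ _ => rfl⟩

theorem BTup.IsDisjUnion.atPt {X X' Y Y' : BObj n I U} {f : BTup X X'} {f' : BTup Y Y'}
    {h : BTup (X.ten Y) (X'.ten Y')} (H : BTup.IsDisjUnion f f' h) :
    BTup.IsDisjUnion f.atPt f'.atPt (h.atPt : BTup (X.atPt.ten Y.atPt) (X'.atPt.ten Y'.atPt)) := by
  obtain ⟨j, j', h1, h2, h3, h4, h5, h6, h7, h8, h9, h10, h11, h12, h13, -, -⟩ := H
  exact ⟨j, j', h1, h2, h3, h4, h5, h6, h7, h8, h9, h10, h11, h12, h13, fun _ _ => rfl,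
    fun _ _ => rfl⟩

theorem bord_comp_atPt {X Y Z : BObj n I U} {F : BHom X Y} {G : BHom Y Z} {H : BHom X Z}
    (h : (bord n I U).Comp F G H) : (bord n I Cart.pt).Comp F.atPt G.atPt H.atPt := by
  obtain ⟨f, f', k, rfl, rfl, rfl, h⟩ := h
  exact ⟨f.atPt, f'.atPt, k.atPt, rfl, rfl, rfl, h.atPt⟩

theorem bord_ten_atPt {X X' Y Y' : BObj n I U} {F : BHom X X'} {G : BHom Y Y'}
    {H : BHom (X.ten Y) (X'.ten Y')} (h : (bord n I U).TenHom F G H) :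
    (bord n I Cart.pt).TenHom F.atPt G.atPt
      (H.atPt : BHom (X.atPt.ten Y.atPt) (X'.atPt.ten Y'.atPt)) := by
  obtain ⟨f, f', k, rfl, rfl, rfl, h⟩ := h
  exact ⟨f.atPt, f'.atPt, k.atPt, rfl, rfl, rfl, h.atPt⟩

variable {D : Type u₁} [Category.{v₁} D] [MonoidalCategory D] [SymmetricCategory D]

variable (U) in
/-- Precomposition with the passage from bordisms over `U` to bordisms over the point. -/
def preAtPt (F : SMFun (bord n I Cart.pt) D) : SMFun (bord n I U) D where
  obj X := F.obj (BObj.atPt X)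
  map f := F.map (BHom.atPt f)
  map_idn X := F.map_idn (BObj.atPt X)
  map_comp _ _ _ H := F.map_comp _ _ _ (bord_comp_atPt H)
  mapOne := F.mapOne
  mapTen X Y := F.mapTen (BObj.atPt X) (BObj.atPt Y)
  μ_nat _ _ _ H := F.μ_nat _ _ _ (bord_ten_atPt H)
  μ_assoc X Y Z := F.μ_assoc (BObj.atPt X) (BObj.atPt Y) (BObj.atPt Z)
  μ_lunit X := F.μ_lunit (BObj.atPt X)
  μ_runit X := F.μ_runit (BObj.atPt X)
  μ_swap X Y := F.μ_swap (BObj.atPt X) (BObj.atPt Y)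

end Restriction

/-! ### Constant vector bundles -/

namespace VBun

open Functor.LaxMonoidal

/-- The constant vector bundle with fibre `E`, with one global frame. -/
def constObj (U : Cart) (E : FGModuleCat.{0} ℂ) : VBun U where
  fib _ := E
  ι := Unit
  κ _ := Fin (Module.finrank ℂ E)
  fin _ := inferInstance
  dom _ := Set.univ
  dom_open _ := isOpen_univ
  cover _ := ⟨(), trivial⟩
  vec _ a _ := Module.finBasis ℂ E a
  cov _ a _ := (Module.finBasis ℂ E).coord a
  dual _ _ _ a b := by
    rw [Module.Basis.coord_apply, Module.Basis.repr_self, Finsupp.single_apply]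
    split_ifs with h h' h' <;> first | rfl | exact absurd (Eq.symm ‹_›) ‹_›
  span _ _ _ v := (Module.finBasis ℂ E).sum_repr v
  smooth _ _ _ _ x _ _ := Cart.smoothAt_of_const (fun _ _ => rfl) x

/-- The functor which sends a vector space to the constant vector bundle. -/
def const (U : Cart) : FGModuleCat.{0} ℂ ⥤ VBun U where
  obj := constObj U
  map f := ⟨fun _ => f, fun _ _ _ _ x _ _ => Cart.smoothAt_of_const (fun _ _ => rfl) x⟩

instance (U : Cart) : (const U).Monoidal :=
  Functor.CoreMonoidal.toMonoidal
    { εIso := isoMk (fun _ => Iso.refl _)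
        (fun _ _ _ _ x _ _ => Cart.smoothAt_of_const (fun _ _ => rfl) x)
        (fun _ _ _ _ x _ _ => Cart.smoothAt_of_const (fun _ _ => rfl) x)
      μIso := fun E F => isoMk (fun _ => Iso.refl (E ⊗ F))
        (fun _ _ _ _ x _ _ => Cart.smoothAt_of_const (fun _ _ => rfl) x)
        (fun _ _ _ _ x _ _ => Cart.smoothAt_of_const (fun _ _ => rfl) x)
      μIso_hom_natural_left := fun f X => by
        ext x : 1; exact (Category.comp_id (f ▷ X)).trans (Category.id_comp (f ▷ X)).symm
      μIso_hom_natural_right := fun X f => by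
        ext x : 1; exact (Category.comp_id (X ◁ f)).trans (Category.id_comp (X ◁ f)).symm
      associativity := fun E F G => by
        ext x : 1
        change 𝟙 (E ⊗ F) ▷ G ≫ 𝟙 _ ≫ (α_ E F G).hom = (α_ E F G).hom ≫ E ◁ 𝟙 (F ⊗ G) ≫ 𝟙 _
        simp
      left_unitality := fun E => by
        ext x : 1
        change (λ_ E).hom = 𝟙 (𝟙_ _) ▷ E ≫ 𝟙 _ ≫ (λ_ E).hom
        simp
      right_unitality := fun E => by
        ext x : 1
        change (ρ_ E).hom = E ◁ 𝟙 (𝟙_ _) ≫ 𝟙 _ ≫ (ρ_ E).hom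
        simp }

instance (U : Cart) : (const U).Braided where
  braided E F := by
    ext x : 1
    change 𝟙 _ ≫ (β_ E F).hom = (β_ E F).hom ≫ 𝟙 _
    simp

/-- Every fibrewise linear map of vector bundles over the one-point space is smooth. -/
theorem isSmooth_pt {E F : VBun Cart.pt} (φ : ∀ x, E.fib x ⟶ F.fib x) : IsSmooth φ :=
  fun _ _ _ _ x _ _ => Cart.smoothAt_of_const (fun y y' => by rw [Subsingleton.elim y y']) x

end VBun

/-! ### The constant extension of a topological field theory -/

section Extension

variable {n : ℕ} [NeZero n] {I : Type}

/-- The field theory over `U` whose bundles are constant with fibres given by `F`. -/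
def constExt (F : OCTQFT n I) (U : Cart) : SMFun (bord n I U) (VBun U) :=
  preAtPt U ((SMFun.post (bord n I Cart.pt) (VBun.const U)).obj F)

/-- The compatibility of the constant extensions with pullbacks, given by the identity maps of the
fibres. -/
def constExtIso (F : OCTQFT n I) {V U : Cart} (g : V ⟶ U) :
    (pre n I (VBun V) g).obj (constExt F V) ≅
      (SMFun.post (bord n I U) (VBun.pull g)).obj (constExt F U) :=
  SMFun.isoMk (fun Y => VBun.isoMk (fun _ => Iso.refl (F.obj (BObj.atPt Y)))
      (fun _ _ _ _ x _ _ => Cart.smoothAt_of_const (fun _ _ => rfl) x)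
      (fun _ _ _ _ x _ _ => Cart.smoothAt_of_const (fun _ _ => rfl) x))
    (fun {X Y} f => by
      ext x : 1
      change F.map (BHom.atPt (BHom.pull g f)) ≫ 𝟙 (F.obj (BObj.atPt Y)) =
        𝟙 (F.obj (BObj.atPt X)) ≫ F.map (BHom.atPt f)
      exact (Category.comp_id _).trans
        ((congrArg F.map (BHom.atPt_pull g f)).trans (Category.id_comp _).symm))
    (by
      ext x : 1
      change (𝟙 _ ≫ F.mapOne.hom) ≫ 𝟙 _ = 𝟙 _ ≫ (𝟙 _ ≫ F.mapOne.hom)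
      simp)
    (fun X Y => by
      ext x : 1
      change (𝟙 _ ≫ (F.mapTen (BObj.atPt X) (BObj.atPt Y)).hom) ≫ 𝟙 _ =
        (𝟙 _ ⊗ₘ 𝟙 _) ≫ 𝟙 _ ≫ (𝟙 _ ≫ (F.mapTen (BObj.atPt X) (BObj.atPt Y)).hom)
      simp)

/-- The smooth field theory whose bundles are constant with fibres given by `F`. -/
def constFFT (F : OCTQFT n I) : OCFFT n I :=
  ⟨⟨constExt F, Pi.isoMk fun g => constExtIso F g.map⟩,
    fun _ _ _ => rfl, fun _ _ _ _ _ Y _ => (Category.comp_id (𝟙 (F.obj (BObj.atPt Y)))).symm⟩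

/-- The value on the point of the constant extension of `F` is `F`. -/
def evPtConstFFT (F : OCTQFT n I) : (evPt n I).obj (constFFT F) ≅ F :=
  SMFun.isoMk (fun Y => Iso.refl (F.obj Y))
    (fun {X Y} f => by
      change F.map (BHom.atPt f) ≫ 𝟙 (F.obj Y) = 𝟙 (F.obj X) ≫ F.map f
      exact (Category.comp_id _).trans
        ((congrArg F.map (BHom.atPt_eq f)).trans (Category.id_comp _).symm))
    (by
      change (𝟙 _ ≫ 𝟙 _ ≫ F.mapOne.hom) ≫ 𝟙 _ = F.mapOne.hom
      simp)
    (fun X Y => by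
      change (𝟙 _ ≫ 𝟙 _ ≫ (F.mapTen X Y).hom) ≫ 𝟙 _ = (𝟙 _ ⊗ₘ 𝟙 _) ≫ (F.mapTen X Y).hom
      simp)

end Extension

/-! ### Evaluation at the point is an equivalence -/

section OverPoint

variable {n : ℕ} [NeZero n] {I : Type}

theorem VBun.hom_ext_pt {E F : VBun Cart.pt} {f g : E ⟶ F}
    (h : VBun.Hom.map f Cart.star = VBun.Hom.map g Cart.star) : f = g := by
  ext x : 1
  obtain rfl := Subsingleton.elim Cart.star x
  exact h

/-- The morphism of vector bundles over the point with a given value on the fibre. -/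
def VBun.ofStar {E F : VBun Cart.pt} (φ : E.fib Cart.star ⟶ F.fib Cart.star) : E ⟶ F :=
  VBun.Hom.mk (fun x => Subsingleton.elim Cart.star x ▸ φ) (VBun.isSmooth_pt _)

/-- Passing to the fibre over the point is full. -/
def liftFibre {F G : SMFun (bord n I Cart.pt) (VBun Cart.pt)}
    (b : (SMFun.post (bord n I Cart.pt) (VBun.fibre Cart.star)).obj F ⟶
      (SMFun.post (bord n I Cart.pt) (VBun.fibre Cart.star)).obj G) : F ⟶ G where
  app Y := VBun.ofStar (SMFun.Hom.app b Y)
  nat f := VBun.hom_ext_pt (b.nat f)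
  app_one := VBun.hom_ext_pt (by
    have := b.app_one
    exact (cancel_epi (𝟙 (𝟙_ (FGModuleCat.{0} ℂ)))).1 ((Category.assoc _ _ _).symm.trans this))
  app_ten X Y := VBun.hom_ext_pt (by
    have := b.app_ten X Y
    refine (cancel_epi (𝟙 ((F.obj X).fib Cart.star ⊗ (F.obj Y).fib Cart.star))).1
      ((Category.assoc _ _ _).symm.trans (this.trans ?_))
    refine (congrArg ((SMFun.Hom.app b X ⊗ₘ SMFun.Hom.app b Y) ≫ ·) (Category.id_comp _)).trans ?_
    exact (Category.id_comp _).symm)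

/-- Precomposition with the pullback along the collapse map is full. -/
def liftPre {D : Type u₁} [Category.{v₁} D] [MonoidalCategory D] [SymmetricCategory D] {U : Cart}
    {F G : SMFun (bord n I U) D}
    (a : (pre n I D U.collapse).obj F ⟶ (pre n I D U.collapse).obj G) : F ⟶ G where
  app Y := SMFun.Hom.app a (BObj.atPt Y)
  nat {X Y} f := by
    have h : F.map (BHom.pull U.collapse (BHom.atPt f)) ≫ SMFun.Hom.app a (BObj.atPt Y) =
      SMFun.Hom.app a (BObj.atPt X) ≫ G.map (BHom.pull U.collapse (BHom.atPt f)) :=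
      a.nat (BHom.atPt f)
    exact (congrArg (F.map · ≫ _) (BHom.pull_atPt U f)).symm.trans
      (h.trans (congrArg (_ ≫ G.map ·) (BHom.pull_atPt U f)))
  app_one := a.app_one
  app_ten X Y := a.app_ten (BObj.atPt X) (BObj.atPt Y)

end OverPoint

namespace PreOCFFT

variable {n : ℕ} [NeZero n] {I : Type} {U V : Cart}

/-- The inverse of `PreOCFFT.cmp`. -/
def cmpInv (Z : PreOCFFT n I) (g : V ⟶ U) (Y : BObj n I U) (v : V.Pt) :
    ((Z.obj U).obj Y).fib (Cart.Hom.toFun g v) ⟶ ((Z.obj V).obj (Y.pull g)).fib v :=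
  VBun.Hom.map (SMFun.Hom.app (Z.iso.inv ⟨V, U, g⟩) Y) v

theorem cmp_cmpInv (Z : PreOCFFT n I) (g : V ⟶ U) (Y : BObj n I U) (v : V.Pt) :
    cmp Z g Y v ≫ cmpInv Z g Y v = 𝟙 _ :=
  congrArg (fun k => VBun.Hom.map (SMFun.Hom.app (k ⟨V, U, g⟩) Y) v) Z.iso.hom_inv_id

theorem cmpInv_cmp (Z : PreOCFFT n I) (g : V ⟶ U) (Y : BObj n I U) (v : V.Pt) :
    cmpInv Z g Y v ≫ cmp Z g Y v = 𝟙 _ :=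
  congrArg (fun k => VBun.Hom.map (SMFun.Hom.app (k ⟨V, U, g⟩) Y) v) Z.iso.inv_hom_id

/-- The comparison maps of a morphism of presheaves satisfy the cocycle condition, here for a map
followed by a collapse map. -/
theorem cmp_collapse {Z : PreOCFFT n I} (hZ : IsCoherent n I Z) (g : V ⟶ U) (Y : BObj n I U)
    (v : V.Pt) : cmp Z V.collapse Y.atPt v =
      cmp Z g Y v ≫ cmp Z U.collapse Y.atPt (Cart.Hom.toFun g v) :=
  hZ.2 V U Cart.pt g U.collapse Y.atPt v

/-- Over the point, the comparison map for the collapse map is an idempotent isomorphism. -/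
theorem cmp_collapse_pt {Z : PreOCFFT n I} (hZ : IsCoherent n I Z) (Y : BObj n I Cart.pt) :
    cmp Z Cart.pt.collapse Y.atPt Cart.star = 𝟙 (((Z.obj Cart.pt).obj Y).fib Cart.star) := by
  have h := cmp_collapse hZ Cart.pt.collapse Y.atPt Cart.star
  have h' := cmp_cmpInv Z Cart.pt.collapse Y.atPt Cart.star
  have h2 := congrArg (cmpInv Z Cart.pt.collapse Y.atPt Cart.star ≫ ·) h
  have h3 := cmpInv_cmp Z Cart.pt.collapse Y.atPt Cart.star
  refine Eq.symm (h3.symm.trans (h2.trans ?_))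
  refine (Category.assoc _ _ _).symm.trans ?_
  exact (congrArg (· ≫ _) h3).trans (Category.id_comp _)

/-- The value of a morphism of field theories on a fibre. -/
def comp {Z Z' : PreOCFFT n I} (a : Z ⟶ Z') (U : Cart) (Y : BObj n I U) (u : U.Pt) :
    ((Z.obj U).obj Y).fib u ⟶ ((Z'.obj U).obj Y).fib u :=
  VBun.Hom.map (SMFun.Hom.app (IsoIns.Hom.hom a U) Y) u

theorem comp_cmp {Z Z' : PreOCFFT n I} (a : Z ⟶ Z') (g : V ⟶ U) (Y : BObj n I U) (v : V.Pt) :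
    comp a V (Y.pull g) v ≫ cmp Z' g Y v = cmp Z g Y v ≫ comp a U Y (Cart.Hom.toFun g v) :=
  congrArg (fun k => VBun.Hom.map (SMFun.Hom.app (k ⟨V, U, g⟩) Y) v) a.w

/-- A morphism of field theories is determined by its values over the point. -/
theorem comp_eq {Z Z' : PreOCFFT n I} (a : Z ⟶ Z') (U : Cart) (Y : BObj n I U) (u : U.Pt) :
    comp a U Y u = cmp Z U.collapse Y.atPt u ≫ comp a Cart.pt Y.atPt Cart.star ≫
      cmpInv Z' U.collapse Y.atPt u := by
  have h := congrArg (· ≫ cmpInv Z' U.collapse Y.atPt u) (comp_cmp a U.collapse Y.atPt u)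
  refine Eq.trans ?_ (h.trans (Category.assoc _ _ _))
  refine Eq.trans ?_ (Category.assoc _ _ _).symm
  exact ((congrArg (comp a U Y u ≫ ·) (cmp_cmpInv Z' U.collapse Y.atPt u)).trans
    (Category.comp_id _)).symm

theorem hom_ext_comp {Z Z' : PreOCFFT n I} {a a' : Z ⟶ Z'}
    (h : ∀ U Y u, comp a U Y u = comp a' U Y u) : a = a' := by
  refine IsoIns.Hom.ext ?_
  funext U
  refine SMFun.hom_ext fun Y => ?_
  exact VBun.hom_ext fun u => h U Y u

end PreOCFFT

/-- The naturality of conjugates: if `r` and `r'` factor through `p` and `p'`, then conjugating `b`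
by `r` and by `q` is compatible with `p` and `p'`. -/
theorem conjugate_comp {C : Type u₁} [Category.{v₁} C] {X Y Z X' Y' Z' : C} {p : X ⟶ Y} {q : Y ⟶ Z}
    {r : X ⟶ Z} (h : r = p ≫ q) {p' : X' ⟶ Y'} {q' : Y' ⟶ Z'} {r' : X' ⟶ Z'} (h' : r' = p' ≫ q')
    {s : Z' ⟶ X'} (hs : s ≫ r' = 𝟙 Z') {t : Z' ⟶ Y'} (ht : q' ≫ t = 𝟙 Y') (b : Z ⟶ Z') :
    (r ≫ b ≫ s) ≫ p' = p ≫ q ≫ b ≫ t := by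
  have e : s ≫ p' = t := by
    rw [← Category.comp_id p', ← ht, ← Category.assoc, ← Category.assoc, Category.assoc s, ← h', hs,
      Category.id_comp]
  rw [h, Category.assoc, Category.assoc, Category.assoc, e]

section EvPt

open PreOCFFT

variable {n : ℕ} [NeZero n] {I : Type}

/-- The value over `U` of the extension of a morphism between the values over the point: it is
conjugated by the comparison isomorphisms for the collapse map. -/
def extendAt {Z Z' : PreOCFFT n I} (b : Z.obj Cart.pt ⟶ Z'.obj Cart.pt) (U : Cart) :
    Z.obj U ⟶ Z'.obj U :=
  liftPre (Z.iso.hom ⟨U, Cart.pt, U.collapse⟩ ≫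
    (SMFun.post (bord n I Cart.pt) (VBun.pull U.collapse)).map b ≫
      Z'.iso.inv ⟨U, Cart.pt, U.collapse⟩)

/-- The extension of a morphism between the values over the point to a morphism of smooth field
theories. -/
def extend {Z Z' : PreOCFFT n I} (hZ : IsCoherent n I Z) (hZ' : IsCoherent n I Z')
    (b : Z.obj Cart.pt ⟶ Z'.obj Cart.pt) : Z ⟶ Z' where
  hom U := extendAt b U
  w := by
    funext g
    obtain ⟨V, U, g⟩ := g
    -- The comparison maps of `g` relate the comparison maps of the collapse maps of `V` and `U`.
    refine SMFun.hom_ext fun Y => ?_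
    refine VBun.hom_ext fun v => ?_
    exact conjugate_comp (cmp_collapse hZ g Y v) (cmp_collapse hZ' g Y v)
      (cmpInv_cmp Z' V.collapse Y.atPt v) (cmp_cmpInv Z' U.collapse Y.atPt (Cart.Hom.toFun g v))
      (VBun.Hom.map (SMFun.Hom.app b Y.atPt) Cart.star)

instance : (evPt n I).Faithful where
  map_injective {Z Z'} a a' h := by
    refine ObjectProperty.hom_ext _ (hom_ext_comp fun U Y u => ?_)
    rw [comp_eq, comp_eq a'.hom]
    have := congrArg (fun k => SMFun.Hom.app k Y.atPt) h
    exact congrArg (fun k => _ ≫ k ≫ _) this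

instance : (evPt n I).Full where
  map_surjective {Z Z'} b := by
    refine ⟨ObjectProperty.homMk (extend Z.property Z'.property (liftFibre b)), ?_⟩
    refine SMFun.hom_ext fun Y => ?_
    have h := congrArg (· ≫ cmpInv Z'.obj Cart.pt.collapse Y.atPt Cart.star)
      (cmp_collapse_pt Z'.property Y)
    have h' : 𝟙 (((Z'.obj.obj Cart.pt).obj Y).fib Cart.star) =
        cmpInv Z'.obj Cart.pt.collapse Y.atPt Cart.star :=
      (cmp_cmpInv Z'.obj Cart.pt.collapse Y.atPt Cart.star).symm.trans
        (h.trans (Category.id_comp _))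
    have h2 := cmp_collapse_pt Z.property Y
    exact (congrArg (· ≫ SMFun.Hom.app b Y ≫ _) h2).trans ((Category.id_comp _).trans
      ((congrArg (SMFun.Hom.app b Y ≫ ·) h'.symm).trans (Category.comp_id _)))

instance : (evPt n I).EssSurj where
  mem_essImage F := ⟨constFFT F, ⟨evPtConstFFT F⟩⟩

theorem isEquivalence_evPt : (evPt n I).IsEquivalence where

end EvPt

/-! ### Restriction to full subcategories -/

section RestrictEquivalence

variable {C : Type u₁} [Category.{v₁} C] {D : Type u₂} [Category.{v₂} D]
  [MonoidalCategory C] [SymmetricCategory C] [MonoidalCategory D] [SymmetricCategory D]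

/-- A criterion for a functor to restrict to an equivalence, in which fullness is only required
between objects of the subcategory, and preimages of objects only up to isomorphism. -/
theorem restrictsToEquivalence_of (K : C ⥤ D) [K.Braided] (P : ObjectProperty C)
    (Q : ObjectProperty D) [hP : P.IsMonoidal] [hQ : Q.IsMonoidal] [K.Faithful]
    (h : ∀ X, P X → Q (K.obj X))
    (full : ∀ X X', P X → P X' → ∀ b : K.obj X ⟶ K.obj X', ∃ a, K.map a = b)
    (surj : ∀ Y, Q Y → ∃ X, P X ∧ Nonempty (K.obj X ≅ Y)) : RestrictsToEquivalence K P Q := by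
  refine ⟨hP, hQ, h, ?_⟩
  have : (restrict K P Q h).Faithful :=
    ⟨fun e => ObjectProperty.hom_ext _ (K.map_injective (congrArg (·.hom) e))⟩
  have : (restrict K P Q h).Full := ⟨fun {X X'} b => by
    obtain ⟨a, ha⟩ := full X.obj X'.obj X.property X'.property b.hom
    exact ⟨ObjectProperty.homMk a, ObjectProperty.hom_ext _ ha⟩⟩
  have : (restrict K P Q h).EssSurj := ⟨fun Y => by
    obtain ⟨X, hX, ⟨e⟩⟩ := surj Y.obj Y.property
    exact ⟨⟨X, hX⟩, ⟨Q.isoMk e⟩⟩⟩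
  exact Functor.IsEquivalence.mk

end RestrictEquivalence

/-! ### Invertible theories -/

section Invertible

variable (n : ℕ) [NeZero n] (I : Type)

theorem finrank_tensor_eq_one {V W : FGModuleCat.{0} ℂ} (hV : Module.finrank ℂ V = 1)
    (hW : Module.finrank ℂ W = 1) : Module.finrank ℂ (V ⊗ W : FGModuleCat.{0} ℂ) = 1 := by
  refine (Module.finrank_tensorProduct (R := ℂ) (S := ℂ) (M := V) (M' := W)).trans ?_
  rw [hV, hW]

theorem isIso_tensorHom {D : Type u₁} [Category.{v₁} D] [MonoidalCategory D] {X X' Y Y' : D}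
    {f : X ⟶ X'} {g : Y ⟶ Y'} (hf : IsIso f) (hg : IsIso g) : IsIso (f ⊗ₘ g) := inferInstance

instance : (IsInvTQFT n I).IsMonoidal where
  prop_unit := ⟨fun _ _ => Module.finrank_self ℂ, fun _ _ _ _ =>
    inferInstanceAs (IsIso (𝟙 (𝟙_ (FGModuleCat.{0} ℂ))))⟩
  prop_tensor _ _ hZ hZ' := ⟨fun Y hY => finrank_tensor_eq_one (hZ.1 Y hY) (hZ'.1 Y hY),
    fun Y Y' F hF => isIso_tensorHom (hZ.2 Y Y' F hF) (hZ'.2 Y Y' F hF)⟩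

instance : (IsInvFFT n I).IsMonoidal where
  prop_unit := fun U => ⟨fun _ _ _ => Module.finrank_self ℂ, fun _ _ _ _ =>
    inferInstanceAs (IsIso (𝟙 (𝟙_ (VBun U))))⟩
  prop_tensor _ _ hZ hZ' := fun U =>
    ⟨fun Y hY u => finrank_tensor_eq_one ((hZ U).1 Y hY u) ((hZ' U).1 Y hY u),
      fun Y Y' F hF => isIso_tensorHom ((hZ U).2 Y Y' F hF) ((hZ' U).2 Y Y' F hF)⟩

variable {n I}

theorem isInvTQFT_evPt {Z : OCFFT n I} (hZ : IsInvFFT n I Z) : IsInvTQFT n I ((evPt n I).obj Z) :=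
  ⟨fun Y hY => (hZ Cart.pt).1 Y hY Cart.star, fun Y Y' F hF => by
    have := (hZ Cart.pt).2 Y Y' F hF
    exact inferInstanceAs
      (IsIso ((VBun.fibre Cart.star).map (((valAt n I Cart.pt).obj Z).map F)))⟩

theorem isInvFFT_constFFT {F : OCTQFT n I} (hF : IsInvTQFT n I F) : IsInvFFT n I (constFFT F) :=
  fun U => ⟨fun Y hY _ => hF.1 Y.atPt hY, fun Y Y' f hf => by
    have := hF.2 Y.atPt Y'.atPt (BHom.atPt f) hf.atPt
    exact inferInstanceAs (IsIso ((VBun.const U).map (F.map (BHom.atPt f))))⟩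

variable (n I) in
theorem restrictsToEquivalence_inv :
    RestrictsToEquivalence (evPt n I) (IsInvFFT n I) (IsInvTQFT n I) :=
  restrictsToEquivalence_of _ _ _ (fun _ => isInvTQFT_evPt)
    (fun _ _ _ _ b => (evPt n I).map_surjective b)
    fun F hF => ⟨constFFT F, isInvFFT_constFFT hF, ⟨evPtConstFFT F⟩⟩

end Invertible

/-! ### Tensor products of reflection structures -/

section ReflectionTensor

open Functor.LaxMonoidal Functor.Monoidal

variable {n : ℕ} [NeZero n] {I : Type} {U : Cart}
  {D : Type u₁} [Category.{v₁} D] [MonoidalCategory D] [SymmetricCategory D]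
  {K : D ⥤ D} [K.Braided] {κ : ∀ X, K.obj (K.obj X) ≅ X}

/-- The coherence identity behind the compatibility of the tensor product of two reflection
structures with the empty object. -/
theorem tensorHom_map_ε {X Y : D} (f : 𝟙_ D ⟶ X) (g : 𝟙_ D ⟶ Y) :
    (λ_ (𝟙_ D)).inv ≫ ((ε K ≫ K.map f) ⊗ₘ (ε K ≫ K.map g)) ≫ μ K X Y =
      ε K ≫ K.map ((λ_ (𝟙_ D)).inv ≫ (f ⊗ₘ g)) := by
  rw [← MonoidalCategory.tensorHom_comp_tensorHom, Category.assoc, μ_natural,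
    K.map_comp, MonoidalCategory.tensorHom_def', Category.assoc,
    ← MonoidalCategory.leftUnitor_inv_naturality_assoc, left_unitality_inv_assoc]

/-- The coherence identity behind the compatibility of the tensor product of two reflection
structures with disjoint unions. -/
theorem tensorμ_tensorHom_μ {P P' Q Q' X X' Y Y' Z Z' : D} (a : P ⟶ K.obj X) (a' : P' ⟶ K.obj X')
    (b : Q ⟶ K.obj Y) (b' : Q' ⟶ K.obj Y') (f : X ⊗ X' ⟶ Z) (g : Y ⊗ Y' ⟶ Z') :
    tensorμ P Q P' Q' ≫ (((a ⊗ₘ a') ≫ μ K X X' ≫ K.map f) ⊗ₘ ((b ⊗ₘ b') ≫ μ K Y Y' ≫ K.map g)) ≫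
        μ K Z Z' =
      (((a ⊗ₘ b) ≫ μ K X Y) ⊗ₘ ((a' ⊗ₘ b') ≫ μ K X' Y')) ≫ μ K _ _ ≫
        K.map (tensorμ X Y X' Y' ≫ (f ⊗ₘ g)) := by
  rw [← MonoidalCategory.tensorHom_comp_tensorHom, ← MonoidalCategory.tensorHom_comp_tensorHom,
    ← MonoidalCategory.tensorHom_comp_tensorHom, Category.assoc, Category.assoc, Category.assoc,
    ← tensorμ_natural_assoc, μ_natural, K.map_comp, tensorμ_comp_μ_tensorHom_μ_comp_μ_assoc]

/-- The coherence identity behind `hermPairing_tensor`. -/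
theorem tensorμ_pairing {L P Q P₁ Q₁ P₂ Q₂ P₃ Q₃ P₄ Q₄ X Y : D} {m : P ⊗ Q ⟶ L} {c : L ⟶ P₁ ⊗ Q₁}
    {a : P ⟶ P₁} {b : Q ⟶ Q₁} (h : m ≫ c = a ⊗ₘ b) (f₁ : P₁ ⟶ P₂) (g₁ : Q₁ ⟶ Q₂)
    (f₂ : P₂ ⊗ X ⟶ P₃) (g₂ : Q₂ ⊗ Y ⟶ Q₃) (f₃ : P₃ ⟶ P₄) (g₃ : Q₃ ⟶ Q₄) (f₄ : P₄ ⟶ 𝟙_ D)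
    (g₄ : Q₄ ⟶ 𝟙_ D) : (m ▷ (X ⊗ Y)) ≫ ((c ≫ (f₁ ⊗ₘ g₁)) ▷ (X ⊗ Y)) ≫
      (tensorμ P₂ Q₂ X Y ≫ (f₂ ⊗ₘ g₂)) ≫ (f₃ ⊗ₘ g₃) ≫ (f₄ ⊗ₘ g₄) ≫ (λ_ (𝟙_ D)).hom =
    tensorμ P Q X Y ≫ ((((a ≫ f₁) ▷ X) ≫ f₂ ≫ f₃ ≫ f₄) ⊗ₘ (((b ≫ g₁) ▷ Y) ≫ g₂ ≫ g₃ ≫ g₄)) ≫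
      (λ_ (𝟙_ D)).hom := by
  rw [← MonoidalCategory.comp_whiskerRight_assoc, reassoc_of% h,
    MonoidalCategory.tensorHom_comp_tensorHom, Category.assoc, tensorμ_natural_left_assoc]
  simp only [MonoidalCategory.tensorHom_comp_tensorHom_assoc]

theorem isReflection_unit (hκ : ε K ≫ K.map (ε K) ≫ (κ (𝟙_ D)).hom = 𝟙 (𝟙_ D))
    {γ : ∀ Y : BObj n I U, (𝟙_ (SMFun (bord n I U) D)).obj Y.op ≅
      K.obj ((𝟙_ (SMFun (bord n I U) D)).obj Y)} (hγ : ∀ Y, (γ Y).hom = ε K) :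
    IsReflection (𝟙_ (SMFun (bord n I U) D)) K κ γ := by
  refine ⟨fun Y Y' f => ?_, ?_, fun Y Y' => ?_, fun Y => ?_⟩
  · rw [hγ, hγ]
    change 𝟙 (𝟙_ D) ≫ ε K = ε K ≫ K.map (𝟙 (𝟙_ D))
    simp
  · rw [hγ]
    change 𝟙 (𝟙_ D) ≫ 𝟙 (𝟙_ D) ≫ ε K = ε K ≫ K.map (𝟙 (𝟙_ D))
    simp
  · rw [hγ, hγ, hγ]
    change (λ_ (𝟙_ D)).hom ≫ 𝟙 (𝟙_ D) ≫ ε K = (ε K ⊗ₘ ε K) ≫ μ K _ _ ≫ K.map (λ_ (𝟙_ D)).hom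
    rw [MonoidalCategory.tensorHom_def', Category.assoc, ← left_unitality]
    simp
  · rw [hγ, hγ]
    exact hκ

variable {F G : SMFun (bord n I U) D}
  {α : ∀ Y : BObj n I U, F.obj Y.op ≅ K.obj (F.obj Y)}
  {β : ∀ Y : BObj n I U, G.obj Y.op ≅ K.obj (G.obj Y)}
  {γ : ∀ Y : BObj n I U, (F ⊗ G).obj Y.op ≅ K.obj ((F ⊗ G).obj Y)}

theorem isReflection_tensor
    (hκ : ∀ X Y : D, μ K (K.obj X) (K.obj Y) ≫ K.map (μ K X Y) ≫ (κ (X ⊗ Y)).hom =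
      (κ X).hom ⊗ₘ (κ Y).hom)
    (hα : IsReflection F K κ α) (hβ : IsReflection G K κ β)
    (hγ : ∀ Y, (γ Y).hom = ((α Y).hom ⊗ₘ (β Y).hom) ≫ μ K (F.obj Y) (G.obj Y)) :
    IsReflection (F ⊗ G) K κ γ := by
  refine ⟨fun Y Y' f => ?_, ?_, fun Y Y' => ?_, fun Y => ?_⟩
  · rw [hγ, hγ]
    change (F.map (BHom.op f) ⊗ₘ G.map (BHom.op f)) ≫ ((α Y').hom ⊗ₘ (β Y').hom) ≫ μ K _ _ =
      (((α Y).hom ⊗ₘ (β Y).hom) ≫ μ K _ _) ≫ K.map (F.map f ⊗ₘ G.map f)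
    rw [Category.assoc, ← μ_natural, MonoidalCategory.tensorHom_comp_tensorHom_assoc,
      MonoidalCategory.tensorHom_comp_tensorHom_assoc, hα.1, hβ.1]
  · rw [hγ]
    change ((λ_ (𝟙_ D)).inv ≫ (F.mapOne.hom ⊗ₘ G.mapOne.hom)) ≫
      (F.map (BHom.opOne n I U) ⊗ₘ G.map (BHom.opOne n I U)) ≫
        ((α (BObj.one n I U)).hom ⊗ₘ (β (BObj.one n I U)).hom) ≫ μ K _ _ =
      ε K ≫ K.map ((λ_ (𝟙_ D)).inv ≫ (F.mapOne.hom ⊗ₘ G.mapOne.hom))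
    rw [Category.assoc, MonoidalCategory.tensorHom_comp_tensorHom_assoc,
      MonoidalCategory.tensorHom_comp_tensorHom_assoc, Category.assoc, Category.assoc]
    have h1 := hα.2.1
    have h2 := hβ.2.1
    refine (congrArg (fun k => (λ_ (𝟙_ D)).inv ≫ k ≫ μ K _ _)
      (congrArg₂ (· ⊗ₘ ·) h1 h2)).trans ?_
    exact tensorHom_map_ε _ _
  · rw [hγ, hγ, hγ]
    change (tensorμ _ _ _ _ ≫ ((F.mapTen Y.op Y'.op).hom ⊗ₘ (G.mapTen Y.op Y'.op).hom)) ≫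
      (F.map (BHom.opTen Y Y') ⊗ₘ G.map (BHom.opTen Y Y')) ≫
        ((α (Y.ten Y')).hom ⊗ₘ (β (Y.ten Y')).hom) ≫ μ K _ _ =
      ((((α Y).hom ⊗ₘ (β Y).hom) ≫ μ K _ _) ⊗ₘ (((α Y').hom ⊗ₘ (β Y').hom) ≫ μ K _ _)) ≫
        μ K _ _ ≫ K.map (tensorμ _ _ _ _ ≫ ((F.mapTen Y Y').hom ⊗ₘ (G.mapTen Y Y').hom))
    rw [Category.assoc, MonoidalCategory.tensorHom_comp_tensorHom_assoc,
      MonoidalCategory.tensorHom_comp_tensorHom_assoc]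
    refine (congrArg (fun k => tensorμ _ _ _ _ ≫ k ≫ μ K _ _)
      (congrArg₂ (· ⊗ₘ ·) ((Category.assoc _ _ _).trans (hα.2.2.1 Y Y'))
        ((Category.assoc _ _ _).trans (hβ.2.2.1 Y Y')))).trans ?_
    exact tensorμ_tensorHom_μ _ _ _ _ _ _
  · rw [hγ, hγ]
    change (((α Y.op).hom ⊗ₘ (β Y.op).hom) ≫ μ K _ _) ≫
      K.map (((α Y).hom ⊗ₘ (β Y).hom) ≫ μ K _ _) ≫ (κ (F.obj Y ⊗ G.obj Y)).hom =
        F.map (BHom.opOp Y) ⊗ₘ G.map (BHom.opOp Y)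
    rw [K.map_comp, Category.assoc, Category.assoc, ← μ_natural_assoc, hκ,
      MonoidalCategory.tensorHom_comp_tensorHom, MonoidalCategory.tensorHom_comp_tensorHom,
      hα.2.2.2, hβ.2.2.2]

/-- The pairing of a tensor product of theories is the tensor product of the pairings, up to the
identification `μ` of the conjugate of a tensor product and the interchange of the factors. -/
theorem hermPairing_tensor
    (hγ : ∀ Y, (γ Y).hom = ((α Y).hom ⊗ₘ (β Y).hom) ≫ μ K (F.obj Y) (G.obj Y))
    (Y : BObj n I U) :
    (μ K (F.obj Y) (G.obj Y) ▷ (F.obj Y ⊗ G.obj Y)) ≫ hermPairing (F ⊗ G) K γ Y =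
      tensorμ _ _ _ _ ≫ (hermPairing F K α Y ⊗ₘ hermPairing G K β Y) ≫ (λ_ (𝟙_ D)).hom := by
  have h : μ K (F.obj Y) (G.obj Y) ≫ (γ Y).inv = (α Y).inv ⊗ₘ (β Y).inv := by
    refine (Iso.comp_inv_eq _).2 ?_
    rw [hγ]
    exact ((Iso.inv_hom_id_assoc (α Y ⊗ᵢ β Y) _)).symm
  exact tensorμ_pairing h _ _ _ _ _ _ _ _

end ReflectionTensor

/-! ### Positive definite sesquilinear forms -/

section Positivity

open scoped TensorProduct

/-- A positive definite sesquilinear form makes a complex vector space an inner product space. The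
form is hermitian by polarization, as its diagonal values are real. -/
@[reducible] def innerCore {V : Type} [AddCommGroup V] [Module ℂ V] (s : V → V → ℂ)
    (addl : ∀ v v' w, s (v + v') w = s v w + s v' w) (addr : ∀ v w w', s v (w + w') = s v w + s v w')
    (smull : ∀ c v w, s (c • v) w = starRingEnd ℂ c * s v w)
    (smulr : ∀ c v w, s v (c • w) = c * s v w)
    (pos : ∀ v, v ≠ 0 → ∃ r : ℝ, 0 < r ∧ s v v = r) : InnerProductSpace.Core ℂ V :=
  have real : ∀ v, (s v v).im = 0 := fun v => by
    by_cases hv : v = 0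
    · have : s v v = 0 := by
        have := smulr 0 v v
        rwa [zero_smul, zero_mul, ← hv] at this
      rw [this, Complex.zero_im]
    · obtain ⟨r, -, h⟩ := pos v hv
      rw [h, Complex.ofReal_im]
  { inner := s
    conj_inner_symm := fun v w => by
      -- The imaginary parts of `s w v` and `s v w` cancel because `s (v + w) (v + w)` is real; the
      -- real parts agree because `s (v + I • w) (v + I • w)` is.
      have h1 := real (v + w)
      have h2 := real (v + Complex.I • w)
      rw [addl, addr, addr] at h1 h2
      rw [smull, smulr, smulr, smull] at h2
      have hv := real v
      have hw := real w
      simp only [Complex.add_im, Complex.mul_im, Complex.I_re, Complex.I_im, Complex.conj_I,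
        Complex.neg_re, Complex.neg_im, hv, hw] at h1 h2
      apply Complex.ext
      · rw [Complex.conj_re]; simp at h2; linarith
      · rw [Complex.conj_im]; linarith
    re_inner_nonneg := fun v => by
      by_cases hv : v = 0
      · have : s v v = 0 := by
          have := smulr 0 v v
          rwa [zero_smul, zero_mul, ← hv] at this
        simp [this]
      · obtain ⟨r, hr, h⟩ := pos v hv
        simpa [h] using hr.le
    add_left := addl
    smul_left := fun v w c => smull c v w
    definite := fun v h => by
      by_contra hv
      obtain ⟨r, hr, h'⟩ := pos v hv
      rw [h'] at h
      exact hr.ne' (by exact_mod_cast h) }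

/-- The tensor product of positive definite sesquilinear forms is positive definite. -/
theorem tensor_posDef {V W : Type} [AddCommGroup V] [Module ℂ V] [AddCommGroup W] [Module ℂ W]
    {s : V → V → ℂ} {t : W → W → ℂ} {m : V ⊗[ℂ] W → V ⊗[ℂ] W → ℂ}
    (cs : InnerProductSpace.Core ℂ V) (ct : InnerProductSpace.Core ℂ W)
    (hs : ∀ v v', cs.inner v v' = s v v') (ht : ∀ w w', ct.inner w w' = t w w')
    (addl : ∀ x x' y, m (x + x') y = m x y + m x' y) (addr : ∀ x y y', m x (y + y') = m x y + m x y')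
    (hm : ∀ v w v' w', m (v ⊗ₜ w) (v' ⊗ₜ w') = s v v' * t w w') (x : V ⊗[ℂ] W) (hx : x ≠ 0) :
    ∃ r : ℝ, 0 < r ∧ m x x = r := by
  let _ : NormedAddCommGroup V := cs.toNormedAddCommGroup
  let _ : InnerProductSpace ℂ V := InnerProductSpace.ofCore cs.toCore
  let _ : NormedAddCommGroup W := ct.toNormedAddCommGroup
  let _ : InnerProductSpace ℂ W := InnerProductSpace.ofCore ct.toCore
  have zl : ∀ y, m 0 y = 0 := fun y => by
    have := addl 0 0 y
    rwa [add_zero, left_eq_add] at this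
  have zr : ∀ x, m x 0 = 0 := fun x => by
    have := addr x 0 0
    rwa [add_zero, left_eq_add] at this
  have key : ∀ x y : V ⊗[ℂ] W, m x y = inner ℂ x y := by
    intro x y
    induction x using TensorProduct.induction_on with
    | zero => rw [zl, inner_zero_left]
    | add x x' h h' => rw [addl, inner_add_left, h, h']
    | tmul v w =>
      induction y using TensorProduct.induction_on with
      | zero => rw [zr, inner_zero_right]
      | add y y' h h' => rw [addr, inner_add_right, h, h']
      | tmul v' w' =>
        rw [hm, TensorProduct.inner_tmul]
        exact congrArg₂ (· * ·) (hs v v').symm (ht w w').symm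
  refine ⟨‖x‖ ^ 2, pow_pos (norm_pos_iff.2 hx) 2, ?_⟩
  exact (key x x).trans ((inner_self_eq_norm_sq_to_K (𝕜 := ℂ) x).trans (by norm_cast))

open VBun in
/-- The function of two vectors given by a sesquilinear form. -/
def sesq {V : FGModuleCat.{0} ℂ} (h : conjFun.obj V ⊗ V ⟶ 𝟙_ (FGModuleCat.{0} ℂ)) (v w : V) : ℂ :=
  h.hom.hom (elt (eltConj v) w)

section

variable {V : FGModuleCat.{0} ℂ} (h : conjFun.obj V ⊗ V ⟶ 𝟙_ (FGModuleCat.{0} ℂ))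

theorem sesq_add_left (v v' w : V) : sesq h (v + v') w = sesq h v w + sesq h v' w :=
  (congrArg h.hom.hom (TensorProduct.add_tmul (VBun.eltConj v) (VBun.eltConj v') w)).trans
    (map_add _ _ _)

theorem sesq_add_right (v w w' : V) : sesq h v (w + w') = sesq h v w + sesq h v w' :=
  (congrArg h.hom.hom (TensorProduct.tmul_add (VBun.eltConj v) w w')).trans (map_add _ _ _)

theorem sesq_smul_right (c : ℂ) (v w : V) : sesq h v (c • w) = c * sesq h v w :=
  (congrArg h.hom.hom (TensorProduct.tmul_smul c (VBun.eltConj v) w)).trans (map_smul _ _ _)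

theorem sesq_smul_left (c : ℂ) (v w : V) : sesq h (c • v) w = starRingEnd ℂ c * sesq h v w := by
  have e : VBun.eltConj (c • v) = starRingEnd ℂ c • VBun.eltConj v := by
    rw [VBun.eltConj_smul, Complex.conj_conj]
  have e' : VBun.elt (VBun.eltConj (c • v)) w = starRingEnd ℂ c • VBun.elt (VBun.eltConj v) w := by
    rw [e]; exact TensorProduct.smul_tmul' _ _ _
  exact (congrArg h.hom.hom e').trans (map_smul _ _ _)

end

open Functor.LaxMonoidal in
theorem isPosDef_tensor {V W : FGModuleCat.{0} ℂ}
    {h : conjFun.obj V ⊗ V ⟶ 𝟙_ (FGModuleCat.{0} ℂ)}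
    {k : conjFun.obj W ⊗ W ⟶ 𝟙_ (FGModuleCat.{0} ℂ)}
    {m : conjFun.obj (V ⊗ W) ⊗ (V ⊗ W) ⟶ 𝟙_ (FGModuleCat.{0} ℂ)}
    (hm : (μ conjFun V W ▷ (V ⊗ W)) ≫ m = tensorμ _ _ _ _ ≫ (h ⊗ₘ k) ≫ (λ_ (𝟙_ _)).hom)
    (hh : IsPosDef h) (hk : IsPosDef k) : IsPosDef m := by
  intro x hx
  refine tensor_posDef (s := sesq h) (t := sesq k) (m := sesq m)
    (innerCore (sesq h) (sesq_add_left h) (sesq_add_right h) (sesq_smul_left h)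
      (sesq_smul_right h) hh)
    (innerCore (sesq k) (sesq_add_left k) (sesq_add_right k) (sesq_smul_left k)
      (sesq_smul_right k) hk) (fun _ _ => rfl) (fun _ _ => rfl) (sesq_add_left m)
    (sesq_add_right m) (fun v w v' w' => ?_) x hx
  -- On pure tensors, `hm` is the formula for the form on a tensor product.
  have e := congrArg (fun f => f.hom.hom
    (VBun.elt (VBun.elt (VBun.eltConj v) (VBun.eltConj w)) (VBun.elt v' w'))) hm
  exact e

theorem isPosDef_unit {m : conjFun.obj (𝟙_ (FGModuleCat.{0} ℂ)) ⊗ 𝟙_ (FGModuleCat.{0} ℂ) ⟶ 𝟙_ _}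
    (hm : (Functor.LaxMonoidal.ε conjFun ▷ 𝟙_ (FGModuleCat.{0} ℂ)) ≫ m = (λ_ (𝟙_ _)).hom) :
    IsPosDef m := by
  intro (z : ℂ) hz
  refine ⟨Complex.normSq z, Complex.normSq_pos.2 hz, ?_⟩
  have e := congrArg (fun f => f.hom.hom (VBun.elt (V := 𝟙_ (FGModuleCat.{0} ℂ))
    (W := 𝟙_ (FGModuleCat.{0} ℂ)) (starRingEnd ℂ z) z)) hm
  have e1 : (Functor.LaxMonoidal.ε conjFun).hom.hom (starRingEnd ℂ z) =
      VBun.eltConj (V := 𝟙_ (FGModuleCat.{0} ℂ)) z :=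
    congrArg (VBun.eltConj (V := 𝟙_ (FGModuleCat.{0} ℂ))) (Complex.conj_conj z)
  have e2 : (starRingEnd ℂ z) * z = Complex.normSq z := Complex.normSq_eq_conj_mul_self.symm
  exact ((congrArg (fun k => m.hom.hom (VBun.elt k (z : 𝟙_ (FGModuleCat.{0} ℂ)))) e1).symm.trans
    e).trans e2

end Positivity

/-! ### Compatibility of double conjugation with tensor products -/

section ConjMonoidal

open Functor.LaxMonoidal

theorem conjConj_unit : ε conjFun ≫ conjFun.map (ε conjFun) ≫ (conjConj (𝟙_ _)).hom =
    𝟙 (𝟙_ (FGModuleCat.{0} ℂ)) := by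
  ext : 1
  exact LinearMap.ext fun (z : ℂ) => Complex.conj_conj z

theorem conjConj_tensor (V W : FGModuleCat.{0} ℂ) :
    μ conjFun (conjFun.obj V) (conjFun.obj W) ≫ conjFun.map (μ conjFun V W) ≫
      (conjConj (V ⊗ W)).hom = (conjConj V).hom ⊗ₘ (conjConj W).hom := by
  ext : 1; apply TensorProduct.ext'; intro v w; rfl

theorem VBun.conjConj_unit (U : Cart) : ε (VBun.conj U) ≫ (VBun.conj U).map (ε (VBun.conj U)) ≫
    (VBun.conjConj (𝟙_ _)).hom = 𝟙 (𝟙_ (VBun U)) := by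
  ext x : 1; exact _root_.conjConj_unit

theorem VBun.conjConj_tensor {U : Cart} (E F : VBun U) :
    μ (VBun.conj U) ((VBun.conj U).obj E) ((VBun.conj U).obj F) ≫
      (VBun.conj U).map (μ (VBun.conj U) E F) ≫ (VBun.conjConj (E ⊗ F)).hom =
        (VBun.conjConj E).hom ⊗ₘ (VBun.conjConj F).hom := by
  ext x : 1; exact _root_.conjConj_tensor (E.fib x) (F.fib x)

end ConjMonoidal

/-! ### Reflection-positive theories -/

section Coherence

variable {D : Type u₁} [Category.{v₁} D] {K : D ⥤ D}

/-! Functors such as evaluation and constant extension are composites, whose structure isomorphisms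
contain additional identity factors. The next lemmas remove them from the conditions on reflections
and from the hermitean pairing. -/

theorem id_comp_map_id {X Y A : D} (f : X ⟶ Y) (g : Y ⟶ K.obj A) :
    𝟙 X ≫ f ≫ g ≫ K.map (𝟙 A) = f ≫ g := by simp

theorem id_comp_eq_comp_map_id {X A : D} (f : X ⟶ K.obj A) : 𝟙 X ≫ f = f ≫ K.map (𝟙 A) := by simp

theorem id_comp_eq_comp_map {X X' Y Z W : D} {f : X ⟶ Y} {g : Y ⟶ K.obj Z} {p : W ⟶ K.obj X'}
    {q : X ⟶ W} {k : X' ⟶ Z} (h : f ≫ g = q ≫ p ≫ K.map k) :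
    (𝟙 X ≫ f) ≫ g = q ≫ p ≫ K.map (𝟙 X' ≫ k) := by simp [h]

theorem id_comp_eq_comp_map₁ {X Y Z : D} {f : X ⟶ Y} {g : Y ⟶ K.obj Z} {p : X ⟶ K.obj X}
    {k : X ⟶ Z} (h : f ≫ g = p ≫ K.map k) : (𝟙 X ≫ f) ≫ g = p ≫ K.map (𝟙 X ≫ k) := by simp [h]

/-- Conjugation by the comparison isomorphisms `c`, `c'` and `d`, `d'` preserves the property of
intertwining reflections. -/
theorem conjugate_intertwines {A A' A₀ A₀' B B' B₀ B₀' : D} {c : A ⟶ A₀} {c' : A' ⟶ A₀'}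
    {s : A₀' ⟶ A'} (hs : s ≫ c' = 𝟙 A₀') {d : B ⟶ B₀} {d' : B' ⟶ B₀'} {t : B₀' ⟶ B'}
    (ht : d' ≫ t = 𝟙 B') {α : A ⟶ K.obj B} {α₀ : A₀ ⟶ K.obj B₀} {α' : A' ⟶ K.obj B'}
    {α₀' : A₀' ⟶ K.obj B₀'} (h : c ≫ α₀ = α ≫ K.map d) (h' : c' ≫ α₀' = α' ≫ K.map d')
    {b : A₀ ⟶ A₀'} {e : B₀ ⟶ B₀'} (hb : b ≫ α₀' = α₀ ≫ K.map e) {x : A ⟶ A'}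
    (hx : x = c ≫ b ≫ s) {y : B ⟶ B'} (hy : y = d ≫ e ≫ t) : x ≫ α' = α ≫ K.map y := by
  have k : s ≫ α' = α₀' ≫ K.map t := by
    rw [← Category.comp_id α', ← K.map_id, ← ht, K.map_comp, ← Category.assoc α', ← h',
      Category.assoc, ← Category.assoc, hs, Category.id_comp]
  rw [hx, hy, Category.assoc, Category.assoc, k, ← Category.assoc b, hb, K.map_comp, K.map_comp,
    ← Category.assoc α, ← h]
  simp only [Category.assoc]

theorem intertwines_id {X Y : D} {c : X ⟶ X} {c' : Y ⟶ Y} (hc : c = 𝟙 X) (hc' : c' = 𝟙 Y)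
    {a a' e : X ⟶ K.obj Y} (ha : a = e) (ha' : a' = e) : c ≫ a = a' ≫ K.map c' := by
  simp [hc, hc', ha, ha']

variable [MonoidalCategory D]

/-- The hermitean pairing of the unit theory, with its structure isomorphisms written out. -/
theorem whiskerRight_leftUnitor {L : D} {e : 𝟙_ D ⟶ L} {c : L ⟶ 𝟙_ D} (h : e ≫ c = 𝟙 (𝟙_ D)) :
    (e ▷ 𝟙_ D) ≫ ((c ≫ 𝟙 (𝟙_ D)) ▷ 𝟙_ D) ≫ (λ_ (𝟙_ D)).hom ≫ 𝟙 (𝟙_ D) ≫ 𝟙 (𝟙_ D) =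
      (λ_ (𝟙_ D)).hom := by
  rw [Category.comp_id c, ← MonoidalCategory.comp_whiskerRight_assoc, h]
  simp

open Functor.LaxMonoidal in
/-- If `c₁`, `d₁` and `c₂`, `d₂` intertwine reflections, then so do their tensor products. -/
theorem intertwines_tensor [K.LaxMonoidal] {A₁ A₂ A₁' A₂' B₁ B₂ B₁' B₂' : D} {c₁ : A₁ ⟶ A₁'}
    {c₂ : A₂ ⟶ A₂'} {d₁ : B₁ ⟶ B₁'} {d₂ : B₂ ⟶ B₂'} {a₁ : A₁' ⟶ K.obj B₁'} {a₂ : A₂' ⟶ K.obj B₂'}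
    {a₁' : A₁ ⟶ K.obj B₁} {a₂' : A₂ ⟶ K.obj B₂} (h₁ : c₁ ≫ a₁ = a₁' ≫ K.map d₁)
    (h₂ : c₂ ≫ a₂ = a₂' ≫ K.map d₂) {c : A₁ ⊗ A₂ ⟶ A₁' ⊗ A₂'} (hc : c = c₁ ⊗ₘ c₂)
    {d : B₁ ⊗ B₂ ⟶ B₁' ⊗ B₂'} (hd : d = d₁ ⊗ₘ d₂) {a : A₁' ⊗ A₂' ⟶ K.obj (B₁' ⊗ B₂')}
    (ha : a = (a₁ ⊗ₘ a₂) ≫ μ K B₁' B₂') {a' : A₁ ⊗ A₂ ⟶ K.obj (B₁ ⊗ B₂)}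
    (ha' : a' = (a₁' ⊗ₘ a₂') ≫ μ K B₁ B₂) : c ≫ a = a' ≫ K.map d := by
  rw [hc, hd, ha, ha', MonoidalCategory.tensorHom_comp_tensorHom_assoc, h₁, h₂, Category.assoc,
    ← μ_natural, MonoidalCategory.tensorHom_comp_tensorHom_assoc]

/-- Two hermitean pairings agree if their factors do, up to identities. -/
theorem pairing_eq {A B C X Y W V : D} {a a' : A ⟶ B} {b b' : B ⟶ C} {f f' : C ⊗ X ⟶ Y}
    {g g' : Y ⟶ W} {h h' : W ⟶ V} (ha : a = a') (hb : b = b') (hf : f = 𝟙 _ ≫ f') (hg : g = g')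
    (hh : h = h' ≫ 𝟙 V) : ((a ≫ b) ▷ X) ≫ f ≫ g ≫ h = ((a' ≫ b') ▷ X) ≫ f' ≫ g' ≫ h' := by
  simp [ha, hb, hf, hg, hh]

end Coherence

section

variable {n : ℕ} [NeZero n] {I : Type} {U : Cart}

/-- The value of the hermitean pairing of a theory over `U` on a fibre. -/
theorem hermPairing_map (Z : SMFun (bord n I U) (VBun U))
    (α : ∀ Y : BObj n I U, Z.obj Y.op ≅ (VBun.conj U).obj (Z.obj Y)) (Y : BObj n I U) (u : U.Pt) :
    VBun.Hom.map (hermPairing Z (VBun.conj U) α Y) u =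
      ((VBun.Hom.map (α Y).inv u ≫ VBun.Hom.map (Z.map (BHom.flat Y)) u) ▷ (Z.obj Y).fib u) ≫
        VBun.Hom.map (Z.mapTen Y.dual Y).hom u ≫ VBun.Hom.map (Z.map (BHom.ev Y)) u ≫
          VBun.Hom.map Z.mapOne.inv u := rfl

end

section ReflectionPositive

open Functor.LaxMonoidal PreOCFFT

variable (n : ℕ) [NeZero n] (I : Type)

variable {n I} in
theorem hermPairing_unit {U : Cart} {D : Type u₁} [Category.{v₁} D] [MonoidalCategory D]
    [SymmetricCategory D] {K : D ⥤ D} [K.Braided]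
    {γ : ∀ Y : BObj n I U, (𝟙_ (SMFun (bord n I U) D)).obj Y.op ≅
      K.obj ((𝟙_ (SMFun (bord n I U) D)).obj Y)} (hγ : ∀ Y, (γ Y).hom = ε K) (Y : BObj n I U) :
    (ε K ▷ 𝟙_ D) ≫ hermPairing (𝟙_ (SMFun (bord n I U) D)) K γ Y = (λ_ (𝟙_ D)).hom := by
  have h : ε K ≫ (γ Y).inv = 𝟙 (𝟙_ D) := by
    rw [← hγ Y]; exact (γ Y).hom_inv_id
  exact whiskerRight_leftUnitor h

theorem PreRefTQFT.α_unit (Y : BObj n I Cart.pt) :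
    (PreRefTQFT.α (𝟙_ (PreRefTQFT n I)) Y).hom = ε conjFun := by
  change 𝟙 (𝟙_ (FGModuleCat.{0} ℂ)) ≫ ε conjFun ≫ conjFun.map (𝟙 (𝟙_ (FGModuleCat.{0} ℂ))) = _
  simp

theorem PreRefTQFT.α_tensor (Z Z' : PreRefTQFT n I) (Y : BObj n I Cart.pt) :
    (PreRefTQFT.α (Z ⊗ Z') Y).hom =
      ((Z.α Y).hom ⊗ₘ (Z'.α Y).hom) ≫ μ conjFun (Z.obj.obj Y) (Z'.obj.obj Y) := by
  exact id_comp_map_id (K := conjFun) _ _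

theorem PreRefFFT.α_unit (U : Cart) (Y : BObj n I U) :
    (PreRefFFT.α (𝟙_ (PreRefFFT n I)) U Y).hom = ε (VBun.conj U) := by
  ext x : 1
  exact PreRefTQFT.α_unit n I (BObj.atPt Y)

theorem PreRefFFT.α_tensor (Z Z' : PreRefFFT n I) (U : Cart) (Y : BObj n I U) :
    (PreRefFFT.α (Z ⊗ Z') U Y).hom = ((Z.α U Y).hom ⊗ₘ (Z'.α U Y).hom) ≫
      μ (VBun.conj U) (((valAt n I U).obj Z.obj).obj Y) (((valAt n I U).obj Z'.obj).obj Y) := by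
  ext x : 1
  exact id_comp_map_id (K := conjFun) _ _

instance : (IsRPTQFT n I).IsMonoidal where
  prop_unit := ⟨isReflection_unit conjConj_unit (PreRefTQFT.α_unit n I),
    fun Y => isPosDef_unit (hermPairing_unit (PreRefTQFT.α_unit n I) Y)⟩
  prop_tensor Z Z' hZ hZ' :=
    ⟨isReflection_tensor conjConj_tensor hZ.1 hZ'.1 (PreRefTQFT.α_tensor n I Z Z'), fun Y =>
      isPosDef_tensor (hermPairing_tensor (PreRefTQFT.α_tensor n I Z Z') Y) (hZ.2 Y) (hZ'.2 Y)⟩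

instance : (IsRPFFT n I).IsMonoidal where
  prop_unit := by
    refine ⟨fun U => isReflection_unit (VBun.conjConj_unit U) (PreRefFFT.α_unit n I U),
      fun V U g Y v => ?_, fun U Y u => isPosDef_unit ?_⟩
    · exact intertwines_id (K := conjFun) (cmp_unit g Y.op v) (cmp_unit g Y v)
        (congrArg (fun k => VBun.Hom.map k (Cart.Hom.toFun g v)) (PreRefFFT.α_unit n I U Y))
        (congrArg (fun k => VBun.Hom.map k v) (PreRefFFT.α_unit n I V (Y.pull g)))
    · exact congrArg (fun k => VBun.Hom.map k u) (hermPairing_unit (PreRefFFT.α_unit n I U) Y)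
  prop_tensor Z Z' hZ hZ' := by
    refine ⟨fun U => isReflection_tensor VBun.conjConj_tensor (hZ.1 U) (hZ'.1 U)
      (PreRefFFT.α_tensor n I Z Z' U), fun V U g Y v => ?_, fun U Y u =>
      isPosDef_tensor ?_ (hZ.2.2 U Y u) (hZ'.2.2 U Y u)⟩
    · exact intertwines_tensor (K := conjFun) (hZ.2.1 V U g Y v) (hZ'.2.1 V U g Y v)
        (cmp_tensor Z.obj.obj Z'.obj.obj g Y.op v) (cmp_tensor Z.obj.obj Z'.obj.obj g Y v)
        (congrArg (fun k => VBun.Hom.map k (Cart.Hom.toFun g v)) (PreRefFFT.α_tensor n I Z Z' U Y))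
        (congrArg (fun k => VBun.Hom.map k v) (PreRefFFT.α_tensor n I Z Z' V (Y.pull g)))
    · exact congrArg (fun k => VBun.Hom.map k u)
        (hermPairing_tensor (PreRefFFT.α_tensor n I Z Z' U) Y)

instance : (IsInvRPTQFT n I).IsMonoidal where
  prop_unit := ⟨(IsRPTQFT n I).prop_unit, (IsInvTQFT n I).prop_unit⟩
  prop_tensor _ _ hZ hZ' := ⟨(IsRPTQFT n I).prop_tensor hZ.1 hZ'.1,
    (IsInvTQFT n I).prop_tensor hZ.2 hZ'.2⟩

instance : (IsInvRPFFT n I).IsMonoidal where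
  prop_unit := ⟨(IsRPFFT n I).prop_unit, (IsInvFFT n I).prop_unit⟩
  prop_tensor _ _ hZ hZ' := ⟨(IsRPFFT n I).prop_tensor hZ.1 hZ'.1,
    (IsInvFFT n I).prop_tensor hZ.2 hZ'.2⟩

instance : (evRef n I).Faithful where
  map_injective h := IsoIns.Hom.ext ((evPt n I).map_injective (congrArg IsoIns.Hom.hom h))

variable {n I}

theorem isRPTQFT_evRef {Z : PreRefFFT n I} (hZ : IsRPFFT n I Z) :
    IsRPTQFT n I ((evRef n I).obj Z) := by
  obtain ⟨h1, h2, h3, h4⟩ := hZ.1 Cart.pt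
  refine ⟨⟨fun Y Y' f => ?_, ?_, fun Y Y' => ?_, fun Y => ?_⟩, fun Y => ?_⟩
  · exact congrArg (fun k => VBun.Hom.map k Cart.star) (h1 Y Y' f)
  · exact id_comp_eq_comp_map₁ (K := conjFun) (congrArg (fun k => VBun.Hom.map k Cart.star) h2)
  · exact id_comp_eq_comp_map (K := conjFun)
      (congrArg (fun k => VBun.Hom.map k Cart.star) (h3 Y Y'))
  · exact congrArg (fun k => VBun.Hom.map k Cart.star) (h4 Y)
  · have e : hermPairing ((evRef n I).obj Z).obj conjFun ((evRef n I).obj Z).α Y =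
        VBun.Hom.map (hermPairing ((valAt n I Cart.pt).obj Z.obj) (VBun.conj Cart.pt)
          (Z.α Cart.pt) Y) Cart.star := by
      rw [hermPairing_map]
      exact pairing_eq rfl rfl rfl rfl rfl
    exact Eq.subst (motive := IsPosDef) e.symm (hZ.2.2 Cart.pt Y Cart.star)

/-- Fullness holds between theories whose reflections are compatible with pullbacks: the extension
of `b` is then conjugate to `b` by comparison maps which intertwine the reflections. -/
theorem evRef_full {Z Z' : PreRefFFT n I} (hZ : IsRPFFT n I Z) (hZ' : IsRPFFT n I Z')
    (b : (evRef n I).obj Z ⟶ (evRef n I).obj Z') : ∃ a, (evRef n I).map a = b := by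
  obtain ⟨a, ha⟩ := (evPt n I).map_surjective b.hom
  refine ⟨⟨a, ?_⟩, IsoIns.Hom.ext ha⟩
  funext ⟨U, Y⟩
  refine VBun.hom_ext fun u => ?_
  change comp a.hom U Y.op u ≫ VBun.Hom.map (Z'.α U Y).hom u =
    VBun.Hom.map (Z.α U Y).hom u ≫ conjFun.map (comp a.hom U Y u)
  have hb : comp a.hom Cart.pt Y.atPt.op Cart.star ≫
        VBun.Hom.map (Z'.α Cart.pt Y.atPt).hom Cart.star =
      VBun.Hom.map (Z.α Cart.pt Y.atPt).hom Cart.star ≫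
        conjFun.map (comp a.hom Cart.pt Y.atPt Cart.star) := by
    have := congrFun b.w Y.atPt
    rw [← ha] at this
    exact this
  exact conjugate_intertwines (K := conjFun) (cmpInv_cmp Z'.obj.obj U.collapse Y.atPt.op u)
    (cmp_cmpInv Z'.obj.obj U.collapse Y.atPt u) (hZ.2.1 U Cart.pt U.collapse Y.atPt u)
    (hZ'.2.1 U Cart.pt U.collapse Y.atPt u) hb (comp_eq a.hom U Y.op u) (comp_eq a.hom U Y u)

/-- The constant extension of a theory with a reflection structure. -/
def constRef (F : PreRefTQFT n I) : PreRefFFT n I :=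
  ⟨constFFT F.obj, Pi.isoMk fun A => VBun.isoMk (fun _ => F.α A.obj.atPt)
    (fun _ _ _ _ x _ _ => Cart.smoothAt_of_const (fun _ _ => rfl) x)
    (fun _ _ _ _ x _ _ => Cart.smoothAt_of_const (fun _ _ => rfl) x)⟩

theorem isRPFFT_constRef {F : PreRefTQFT n I} (hF : IsRPTQFT n I F) :
    IsRPFFT n I (constRef F) := by
  obtain ⟨⟨h1, h2, h3, h4⟩, h5⟩ := hF
  refine ⟨fun U => ⟨fun Y Y' f => ?_, ?_, fun Y Y' => ?_, fun Y => ?_⟩, fun V U g Y v => ?_,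
    fun U Y u => ?_⟩
  · ext u : 1
    exact (congrArg (fun k => F.obj.map k ≫ (F.α Y'.atPt).hom) (BHom.atPt_op f)).trans
      (h1 Y.atPt Y'.atPt (BHom.atPt f))
  · ext u : 1
    exact id_comp_eq_comp_map₁ (K := conjFun) h2
  · ext u : 1
    exact id_comp_eq_comp_map (K := conjFun) (h3 Y.atPt Y'.atPt)
  · ext u : 1
    exact h4 Y.atPt
  · exact id_comp_eq_comp_map_id (K := conjFun) _
  · have e : VBun.Hom.map (hermPairing ((valAt n I U).obj (constRef F).obj) (VBun.conj U)
        ((constRef F).α U) Y) u = hermPairing F.obj conjFun F.α Y.atPt := by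
      rw [hermPairing_map]
      exact pairing_eq rfl rfl rfl rfl rfl
    exact Eq.subst (motive := IsPosDef) e.symm (h5 Y.atPt)

/-- The value on the point of the constant extension of `F` is `F`. -/
def evRefConstRef (F : PreRefTQFT n I) : (evRef n I).obj (constRef F) ≅ F :=
  IsoIns.isoMk (evPtConstFFT F.obj) (by
    funext Y
    exact id_comp_eq_comp_map_id (K := conjFun) (F.α Y).hom)

end ReflectionPositive

end

theorem mainTheorem5 (n : ℕ) [NeZero n] (I : Type) :
    (∀ U : Cart,
      Function.Bijective (fun X : BObj n I Cart.pt => X.pull U.collapse) ∧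
      ∀ X X' : BObj n I Cart.pt,
        Function.Bijective (fun F : BHom X X' => F.pull U.collapse)) ∧
    IsSymMonEquivalence (evPt n I) ∧
    RestrictsToEquivalence (evPt n I) (IsInvFFT n I) (IsInvTQFT n I) ∧
    RestrictsToEquivalence (evRef n I) (IsRPFFT n I) (IsRPTQFT n I) ∧
    RestrictsToEquivalence (evRef n I) (IsInvRPFFT n I) (IsInvRPTQFT n I) := by
  refine ⟨fun U => ⟨BObj.pull_collapse_bijective n I U, BHom.pull_collapse_bijective U⟩,
    isEquivalence_evPt, restrictsToEquivalence_inv n I, ?_, ?_⟩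
  · exact restrictsToEquivalence_of _ _ _ (fun _ => isRPTQFT_evRef)
      (fun _ _ => evRef_full) fun F hF => ⟨constRef F, isRPFFT_constRef hF, ⟨evRefConstRef F⟩⟩
  · exact restrictsToEquivalence_of _ _ _
      (fun _ hZ => ⟨isRPTQFT_evRef hZ.1, isInvTQFT_evPt hZ.2⟩)
      (fun _ _ hZ hZ' => evRef_full hZ.1 hZ'.1) fun F hF => ⟨constRef F,
        ⟨isRPFFT_constRef hF.1, isInvFFT_constFFT hF.2⟩, ⟨evRefConstRef F⟩⟩
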